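/- **Setting.** Let $d\ge 1$. The distance-$d$ planar surface code has sites $(i,j)$, $0\le i,j\le 2d-2$: data qubits at sites with $i+j$ even, $X$-checks at sites with $i$ even and $j$ odd, $Z$-checks at sites with $i$ odd and $j$ even; the stabilizer generator of a check is the product of $X$'s (resp. $Z$'s) over the data qubits at unit distance from it. The *teleported surface code* with $L$ rounds (the RHG cluster state) has a physical qubit at $(i,j,t)$, $0\le t\le 2L$, whenever $(i,j)$ is a data site, or $(i,j)$ is an $X$-check and $t$ is odd, or $(i,j)$ is a $Z$-check and $t\geq 2$ is even. The data qubits with $t=0$ carry an encoded input state; all other qubits are prepared in $|+\rangle$; a CZ gate is applied to every pair of qubits at unit distance, in four time steps with at most one gate per qubit and step; all qubits except the data qubits with $t=2L$ (the output block) are measured in the $X$ basis. Finally the stabilizers of the output block are measured without error, the Pauli frame determined by the teleportation outcomes is undone, and a decoder, which sees only the cluster-state stabilizer values, applies a Pauli correction. The cluster-state stabilizers (cells) are centred at $(c,\tau)$, $0\le\tau\le 2L+1$, with $c$ an $X$-check and $\tau$ even or $c$ a $Z$-check and $\tau$ odd; the value is the sum mod 2 of the $X$-outcomes of the measured qubits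 at unit distance from $(c,\tau)$, plus, if $\tau\ge 2L$, the final outcome of $c$. *Coherent noise of angle $\theta$:* the unitary $e^{i\theta Z}$ acts on every physical qubit with $t\ge1$ at each of its 5 spacetime locations (after preparation and after each of the four time steps). *Pauli noise of rate $p$:* each physical qubit with $t\geq 1$ independently suffers one $Z$ error with probability $p$, and there is no other noise. A *minimum-weight decoder* applies the residual Pauli error of a set of $Z$ faults of least cardinality consistent with the observed cluster-state stabilizer values (ties broken arbitrarily). For a polynomially bounded number of rounds $L=L(d)$ and a decoder for each $d$, noise is *corrected* if, as $d\to\infty$, the infidelity $1-\langle\psi|\Lambda_d(|\psi\rangle\langle\psi|)|\psi\rangle$ of the resulting channel $\Lambda_d$ tends to $0$ uniformly over the normalized code states $\psi$. Let $p_{\rm th}$ be the supremum of the $p\in[0,1]$ such that Pauli noise of every rate $p'\in[0,p)$ is corrected, and $\theta_{\rm th}$ the supremum of the $\theta\in[0,\pi/10]$ such that coherent noise of every angle $\theta'\in[0,\theta)$ is corrected. **Theorem.** 1. For all $d$, $L$, $\theta\in\mathbb R$ and all values $s$ of the cluster-state stabilizers, coherent noise of angle $\theta$ and Pauli noise of rate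 $p=\sin^2(5\theta)$ yield the same map from encoded input states to unnormalized output states conditioned on $s$ (before the correction, after averaging over all measurement records with stabilizer values $s$). Hence they yield the same channel after decoding, for every decoder. 2. In the decoding graph, whose vertices are the cluster-state stabilizers and in which two of them are adjacent if a $Z$ fault on one qubit flips both, every vertex has at most $B=6$ neighbours. 3. For every polynomially bounded $L(d)$ and all minimum-weight decoders, $$p_{\rm th}\ \ge\ \frac1{[2(B-1)]^2}=\frac1{100},\qquad \theta_{\rm th}=\frac{\arcsin\sqrt{p_{\rm th}}}{5}\ \ge\ \frac{\arcsin(1/10)}{5},$$ and coherent noise of every angle $\theta$ with $|\theta|<\arcsin(1/10)/5$ is corrected. 4. $\left|\arcsin(1/10)/5-0.02\right|<10^{-4}$. -/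

import Mathlib

open scoped Matrix

noncomputable section

namespace TeleportedSurfaceCode

/-! ### Qubit registers -/

/-- Computational basis labels of a register with one qubit per element of `ι`. -/
abbrev Bits (ι : Type) : Type := ι → ZMod 2

/-- Operators on a register with one qubit per element of `ι`. -/
abbrev Op (ι : Type) : Type := Matrix (Bits ι) (Bits ι) ℂ

/-- `(-1)^b`. -/
def sgn (b : ZMod 2) : ℂ := if b = 0 then 1 else -1

/-- `X^a = ⨂ X^(a_v)`, which maps `|x⟩` to `|x + a⟩`. -/
def pauliX {ι : Type} [Fintype ι] [DecidableEq ι] (a : Bits ι) : Op ι :=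
  Matrix.of fun y x => if y = x + a then 1 else 0

/-- `Z^b = ⨂ Z^(b_v)`, which maps `|x⟩` to `(-1)^(b ⬝ x) |x⟩`. -/
def pauliZ {ι : Type} [Fintype ι] [DecidableEq ι] (b : Bits ι) : Op ι :=
  Matrix.diagonal fun x => sgn (∑ v, b v * x v)

/-! ### The planar surface code of distance `d`

Sites are points `(i, j)` with `0 ≤ i, j ≤ 2d - 2`.  Data qubits sit on sites with `i + j` even,
`X` checks on sites with `i` even and `j` odd, `Z` checks on sites with `i` odd and `j` even.
A check acts on the (at most four) data qubits at unit distance. -/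

abbrev IsData (i j : ℕ) : Prop := Even (i + j)
abbrev IsXCheck (i j : ℕ) : Prop := Even i ∧ Odd j
abbrev IsZCheck (i j : ℕ) : Prop := Odd i ∧ Even j

abbrev Data (d : ℕ) : Type :=
  {q : Fin (2 * d - 1) × Fin (2 * d - 1) // IsData q.1 q.2}

abbrev Check (d : ℕ) : Type :=
  {c : Fin (2 * d - 1) × Fin (2 * d - 1) // IsXCheck c.1 c.2 ∨ IsZCheck c.1 c.2}

/-- Two points of the cubic grid at unit distance. -/
abbrev Near (u v : ℕ × ℕ × ℕ) : Prop :=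
  ((u.1 : ℤ) - v.1).natAbs + ((u.2.1 : ℤ) - v.2.1).natAbs + ((u.2.2 : ℤ) - v.2.2).natAbs = 1

/-- Indicator of the data qubits on which a check acts. -/
def support {d : ℕ} (c : Check d) : Bits (Data d) := fun q =>
  if Near (c.1.1, c.1.2, 0) (q.1.1, q.1.2, 0) then 1 else 0

/-- The stabilizer generator of a check: a product of `X`s or of `Z`s over its support. -/
def stabilizer {d : ℕ} (c : Check d) : Op (Data d) :=
  if IsXCheck c.1.1 c.1.2 then pauliX (support c) else pauliZ (support c)

/-- Normalized vectors of the code space. -/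
def IsCodeState {d : ℕ} (ψ : Bits (Data d) → ℂ) : Prop :=
  star ψ ⬝ᵥ ψ = 1 ∧ ∀ c : Check d, stabilizer c *ᵥ ψ = ψ

/-- Operators supported on the code space (in particular all mixed code states). -/
def IsCodeOperator {d : ℕ} (ρ : Op (Data d)) : Prop :=
  ∀ c : Check d, stabilizer c * ρ = ρ ∧ ρ * stabilizer c = ρ

/-- Noiseless projective measurement of all stabilizer generators with outcomes `σ`. The factors
commute, so their order is irrelevant. -/
def syndromeProjector {d : ℕ} (σ : Check d → ZMod 2) : Op (Data d) :=
  ((Finset.univ : Finset (Check d)).toList.map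
    fun c => (1 / 2 : ℂ) • (1 + sgn (σ c) • stabilizer c)).prod

/-! ### The foliated code: the RHG cluster state

The data qubits are teleported `2L` times, so there are `2L + 1` time slices `t = 0, …, 2L`.
The `X` checks are measured by ancillas in odd slices (where the teleported block carries a
Hadamard), the `Z` checks by ancillas in the even slices `t ≥ 2`.  Slice `0` carries the input,
and the data qubits of slice `2L` the output. -/

abbrev IsClusterQubit (i j t : ℕ) : Prop :=
  IsData i j ∨ (IsXCheck i j ∧ Odd t) ∨ (IsZCheck i j ∧ Even t ∧ 0 < t)

/-- The physical qubits of the foliated code with `L` rounds. -/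
abbrev Qubit (d L : ℕ) : Type :=
  {v : Fin (2 * d - 1) × Fin (2 * d - 1) × Fin (2 * L + 1) // IsClusterQubit v.1 v.2.1 v.2.2}

/-- Position in the cubic grid. -/
def Qubit.pos {d L : ℕ} (v : Qubit d L) : ℕ × ℕ × ℕ := (v.1.1, v.1.2.1, v.1.2.2)

/-- The physical qubit that carries data qubit `q` in slice `t`. -/
def dataAt {d L : ℕ} (t : Fin (2 * L + 1)) (q : Data d) : Qubit d L :=
  ⟨(q.1.1, q.1.2, t), Or.inl q.2⟩

abbrev IsOutput {d L : ℕ} (v : Qubit d L) : Prop :=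
  IsData v.1.1 v.1.2.1 ∧ (v.1.2.2 : ℕ) = 2 * L

/-- Qubits measured in the `X` basis: all except the output block. -/
abbrev Measured (d L : ℕ) : Type := {v : Qubit d L // ¬ IsOutput v}

/-- Qubits prepared in `|+⟩` and subject to noise: all except the input block. -/
abbrev Noisy (d L : ℕ) : Type := {v : Qubit d L // 0 < (v.1.2.2 : ℕ)}

/-- Extension by zero of a bit assignment on a subset of the qubits. -/
def extend {ι : Type} {P : ι → Prop} [DecidablePred P] (f : {v : ι // P v} → ZMod 2) : Bits ι :=
  fun v => if h : P v then f ⟨v, h⟩ else 0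

/-- A CZ gate acts on every pair of cluster qubits at unit distance; here `v` is the one with the
larger coordinate.  The gates are executed in four time steps, numbered `0, 1, 2, 3`, so that
each qubit takes part in at most one gate per step. -/
abbrev GateAt (k : ℕ) (u v : ℕ × ℕ × ℕ) : Prop :=
  (v = (u.1 + 1, u.2.1, u.2.2) ∧ k = 2 * ((u.2.2 + 1) % 2) + u.1 % 2) ∨
  (v = (u.1, u.2.1 + 1, u.2.2) ∧ k = 2 * (u.2.2 % 2) + u.2.1 % 2) ∨
  (v = (u.1, u.2.1, u.2.2 + 1) ∧ k = 2 * (u.1 % 2) + u.2.2 % 2)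

/-- All CZ gates of time step `k`; CZ multiplies `|x⟩` by `(-1)^(x_u x_v)`. -/
def czStep (d L k : ℕ) : Op (Qubit d L) :=
  Matrix.diagonal fun x => ∏ u : Qubit d L, ∏ v : Qubit d L,
    if GateAt k u.pos v.pos then sgn (x u * x v) else 1

/-- `e^{iθZ}` on every noisy qubit. -/
def zRotations (d L : ℕ) (θ : ℝ) : Op (Qubit d L) :=
  Matrix.diagonal fun x => ∏ v : Noisy d L, Complex.exp (Complex.I * θ * sgn (x v.1))

/-- Entangling circuit with circuit-level coherent noise: `e^{iθZ}` strikes each physical qubit at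
its five spacetime locations, namely after its preparation and after each of the four steps (in
which it undergoes a CZ gate or, at a boundary of the lattice, idles). -/
def coherentCircuit (d L : ℕ) (θ : ℝ) : Op (Qubit d L) :=
  zRotations d L θ * czStep d L 3 * zRotations d L θ * czStep d L 2 *
    zRotations d L θ * czStep d L 1 * zRotations d L θ * czStep d L 0 * zRotations d L θ

/-- Noiseless entangling circuit followed by Pauli `Z` faults on the qubits with `e v = 1`. -/
def pauliCircuit {d L : ℕ} (e : Noisy d L → ZMod 2) : Op (Qubit d L) :=
  pauliZ (extend e) * czStep d L 3 * czStep d L 2 * czStep d L 1 * czStep d L 0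

/-- Adjoins all other qubits, in state `|+⟩`, to an input block. -/
def prepare (d L : ℕ) : Matrix (Bits (Qubit d L)) (Bits (Data d)) ℂ :=
  Matrix.of fun x y =>
    if (fun q => x (dataAt 0 q)) = y then ((√2 : ℝ) : ℂ)⁻¹ ^ Fintype.card (Noisy d L) else 0

/-- Destructive `X`-basis measurement of all qubits but the output block, with outcomes `o`
(`o v = 0` for `|+⟩` and `o v = 1` for `|-⟩`). -/
def measure {d L : ℕ} (o : Measured d L → ZMod 2) :
    Matrix (Bits (Data d)) (Bits (Qubit d L)) ℂ :=
  Matrix.of fun y x =>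
    if (fun q => x (dataAt (Fin.last (2 * L)) q)) = y then
      ∏ v : Measured d L, ((√2 : ℝ) : ℂ)⁻¹ * sgn (o v * x v.1) else 0

/-- Total parity over the odd slices: the `X` exponent of a Pauli frame or of a residual error. -/
def xPart {d L : ℕ} (f : Bits (Qubit d L)) : Bits (Data d) := fun q =>
  ∑ t : Fin (2 * L + 1), if Odd (t : ℕ) then f (dataAt t q) else 0

/-- Total parity over the even slices: the `Z` exponent of a Pauli frame or of a residual error. -/
def zPart {d L : ℕ} (f : Bits (Qubit d L)) : Bits (Data d) := fun q =>
  ∑ t : Fin (2 * L + 1), if Even (t : ℕ) then f (dataAt t q) else 0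

/-- The Kraus operator on the code block for the outcomes `o` of the cluster measurements and the
outcomes `σ` of a final noiseless stabilizer measurement, for the entangling circuit `U`,
including the Pauli frame update. -/
def kraus {d L : ℕ} (U : Op (Qubit d L)) (o : Measured d L → ZMod 2) (σ : Check d → ZMod 2) :
    Op (Data d) :=
  pauliZ (zPart (extend o)) * pauliX (xPart (extend o)) * syndromeProjector σ *
    measure o * U * prepare d L

/-! ### Cluster state stabilizers (cells) and decoding -/

/-- Cluster state stabilizers are centred at `(c, τ)`, with `τ` even for an `X` check `c` and odd
for a `Z` check `c`; those with `τ ≥ 2L` involve the final noiseless measurement. -/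
abbrev Cell (d L : ℕ) : Type :=
  {v : Fin (2 * d - 1) × Fin (2 * d - 1) × Fin (2 * L + 2) //
    (IsXCheck v.1 v.2.1 ∧ Even (v.2.2 : ℕ)) ∨ (IsZCheck v.1 v.2.1 ∧ Odd (v.2.2 : ℕ))}

def Cell.pos {d L : ℕ} (a : Cell d L) : ℕ × ℕ × ℕ := (a.1.1, a.1.2.1, a.1.2.2)

def Cell.check {d L : ℕ} (a : Cell d L) : Check d :=
  ⟨(a.1.1, a.1.2.1), a.2.imp And.left And.left⟩

abbrev Syndrome (d L : ℕ) : Type := Cell d L → ZMod 2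

/-- Sum of the bits of the (at most six) qubits at unit distance from the centre of a cell.
For outcomes `o` and `(c, τ)` this is `s_{τ+1} + s_{τ-1}` of the check `c` plus the outcomes of the
data qubits in its support in slice `τ`. -/
def cellParity {d L : ℕ} (f : Bits (Qubit d L)) (a : Cell d L) : ZMod 2 :=
  ∑ v : Qubit d L, if Near a.pos v.pos then f v else 0

/-- The measured values of the cluster state stabilizers. -/
def measuredSyndrome {d L : ℕ} (o : Measured d L → ZMod 2) (σ : Check d → ZMod 2) :
    Syndrome d L := fun a =>
  cellParity (extend o) a + if 2 * L ≤ (a.1.2.2 : ℕ) then σ a.check else 0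

/-- Unnormalized state after the protocol, averaged over all measurement records with cluster
state stabilizer values `s`. -/
def instrument {d L : ℕ} (U : Op (Qubit d L)) (s : Syndrome d L) (ρ : Op (Data d)) :
    Op (Data d) :=
  ∑ o : Measured d L → ZMod 2, ∑ σ : Check d → ZMod 2,
    if measuredSyndrome o σ = s then kraus U o σ * ρ * (kraus U o σ)ᴴ else 0

/-- The protocol with circuit-level `e^{iθZ}` noise. -/
def coherentInstrument {d L : ℕ} (θ : ℝ) (s : Syndrome d L) (ρ : Op (Data d)) : Op (Data d) :=
  instrument (coherentCircuit d L θ) s ρ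

/-- The protocol with an independent Pauli `Z` error of probability `p` on each physical qubit. -/
def pauliInstrument {d L : ℕ} (p : ℝ) (s : Syndrome d L) (ρ : Op (Data d)) : Op (Data d) :=
  ∑ e : Noisy d L → ZMod 2,
    ((∏ v, if e v = 1 then p else 1 - p : ℝ) : ℂ) • instrument (pauliCircuit e) s ρ

/-- A decoder turns the values of the cluster state stabilizers into a Pauli correction `X^a Z^b`
of the output block. -/
abbrev Decoder (d L : ℕ) : Type := Syndrome d L → Bits (Data d) × Bits (Data d)

/-- The channel on the code block after decoding and correction. -/
def decodedChannel {d L : ℕ} (D : Decoder d L) (I : Syndrome d L → Op (Data d) → Op (Data d))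
    (ρ : Op (Data d)) : Op (Data d) :=
  ∑ s : Syndrome d L, pauliX (D s).1 * pauliZ (D s).2 * I s ρ *
    (pauliX (D s).1 * pauliZ (D s).2)ᴴ

/-- Decoding graph: cells are nearest neighbours if the fault of some qubit flips both. -/
def decodingGraph (d L : ℕ) : SimpleGraph (Cell d L) where
  Adj a b := a ≠ b ∧ ∃ v : Noisy d L, Near a.pos v.1.pos ∧ Near b.pos v.1.pos
  symm := ⟨fun _ _ h => ⟨h.1.symm, h.2.imp fun _ hv => hv.symm⟩⟩
  loopless := ⟨fun _ h => h.1 rfl⟩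

/-- Number of faulty qubits. -/
def weight {d L : ℕ} (e : Noisy d L → ZMod 2) : ℕ := (Finset.univ.filter fun v => e v = 1).card

/-- Cluster state stabilizers flipped by a fault pattern. -/
def faultSyndrome {d L : ℕ} (e : Noisy d L → ZMod 2) : Syndrome d L := cellParity (extend e)

/-- Minimum-weight decoding (minimum-weight matching): the correction is the residual error
of a fault pattern of least weight among those with the given syndrome; ties are broken
arbitrarily. -/
def IsMinimumWeight {d L : ℕ} (D : Decoder d L) : Prop :=
  ∀ s : Syndrome d L, (∃ e, faultSyndrome e = s) →
    ∃ e, faultSyndrome e = s ∧ (∀ e', faultSyndrome e' = s → weight e ≤ weight e') ∧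
      D s = (xPart (extend e), zPart (extend e))

theorem exists_isMinimumWeight (d L : ℕ) : ∃ D : Decoder d L, IsMinimumWeight D := by
  have h : ∀ s : Syndrome d L, ∃ r : Bits (Data d) × Bits (Data d),
      (∃ e, faultSyndrome e = s) →
        ∃ e, faultSyndrome e = s ∧ (∀ e', faultSyndrome e' = s → weight e ≤ weight e') ∧
          r = (xPart (extend e), zPart (extend e)) := by
    intro s
    by_cases hs : ∃ e : Noisy d L → ZMod 2, faultSyndrome e = s
    · obtain ⟨e, he, hmin⟩ :=
        Set.exists_min_image {e : Noisy d L → ZMod 2 | faultSyndrome e = s} weight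
          (Set.toFinite _) hs
      exact ⟨_, fun _ => ⟨e, he, hmin, rfl⟩⟩
    · exact ⟨0, fun h => absurd h hs⟩
  choose D hD using h
  exact ⟨D, hD⟩

/-! ### Thresholds -/

/-- Fidelity `⟨ψ| Λ(|ψ⟩⟨ψ|) |ψ⟩`. -/
def fidelity {d : ℕ} (Λ : Op (Data d) → Op (Data d)) (ψ : Bits (Data d) → ℂ) : ℝ :=
  (star ψ ⬝ᵥ Λ (Matrix.vecMulVec ψ (star ψ)) *ᵥ ψ).re

/-- As the distance grows, the infidelity tends to zero uniformly over all encoded states. -/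
def LogicalErrorVanishes (Λ : ∀ d : ℕ, Op (Data d) → Op (Data d)) : Prop :=
  ∀ ε : ℝ, 0 < ε → ∀ᶠ d : ℕ in Filter.atTop,
    ∀ ψ : Bits (Data d) → ℂ, IsCodeState ψ → 1 - ε ≤ fidelity (Λ d) ψ

/-- `L d` rounds of the distance-`d` code with decoder `D d` under coherent noise. -/
def CoherentNoiseCorrected (L : ℕ → ℕ) (D : ∀ d, Decoder d (L d)) (θ : ℝ) : Prop :=
  LogicalErrorVanishes fun d => decodedChannel (D d) (coherentInstrument θ)

/-- `L d` rounds of the distance-`d` code with decoder `D d` under Pauli noise. -/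
def PauliNoiseCorrected (L : ℕ → ℕ) (D : ∀ d, Decoder d (L d)) (p : ℝ) : Prop :=
  LogicalErrorVanishes fun d => decodedChannel (D d) (pauliInstrument p)

/-- Threshold probability: the largest `p` below which the logical error always vanishes. -/
def pThreshold (L : ℕ → ℕ) (D : ∀ d, Decoder d (L d)) : ℝ :=
  sSup {p | p ∈ Set.Icc 0 1 ∧ ∀ p' ∈ Set.Ico 0 p, PauliNoiseCorrected L D p'}

/-- Threshold angle: the largest `θ` below which the logical error always vanishes, within the
range `[0, π/10]` of rotation angles over which `5θ` runs through `[0, π/2]`. -/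
def θThreshold (L : ℕ → ℕ) (D : ∀ d, Decoder d (L d)) : ℝ :=
  sSup {θ | θ ∈ Set.Icc 0 (Real.pi / 10) ∧ ∀ θ' ∈ Set.Ico 0 θ, CoherentNoiseCorrected L D θ'}

end TeleportedSurfaceCode

end

noncomputable section
namespace TeleportedSurfaceCode

/-! ### Signs and Pauli operators -/

@[simp] lemma sgn_zero : sgn 0 = 1 := by simp [sgn]

lemma zmod_two_cases (a : ZMod 2) : a = 0 ∨ a = 1 := by
  revert a; decide

lemma zmod_two_add_eq_one {a b : ZMod 2} (h : a ≠ b) : a + b = 1 := by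
  revert a b; decide

lemma sgn_one : sgn 1 = -1 := by simp [sgn]

lemma sgn_add (a b : ZMod 2) : sgn (a + b) = sgn a * sgn b := by
  rcases zmod_two_cases a with rfl | rfl <;> rcases zmod_two_cases b with rfl | rfl <;>
    simp [sgn_one, CharTwo.add_self_eq_zero]

@[simp] lemma sgn_mul_self (a : ZMod 2) : sgn a * sgn a = 1 := by
  rw [← sgn_add, CharTwo.add_self_eq_zero, sgn_zero]

@[simp] lemma star_sgn (a : ZMod 2) : star (sgn a) = sgn a := by
  rcases zmod_two_cases a with rfl | rfl <;> simp [sgn_one]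

lemma sgn_sum {κ : Type*} (s : Finset κ) (f : κ → ZMod 2) :
    sgn (∑ i ∈ s, f i) = ∏ i ∈ s, sgn (f i) := by
  classical
  induction s using Finset.induction_on with
  | empty => simp
  | insert a s ha ih => rw [Finset.sum_insert ha, Finset.prod_insert ha, sgn_add, ih]

lemma sgn_eq_one_iff (a : ZMod 2) : sgn a = 1 ↔ a = 0 := by
  rcases zmod_two_cases a with rfl | rfl <;> norm_num [sgn_one]

lemma bits_add_self {ι : Type*} (a : ι → ZMod 2) : a + a = 0 := by
  ext i; exact CharTwo.add_self_eq_zero _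

lemma bits_eq_add_iff {ι : Type*} {x y a : ι → ZMod 2} : y = x + a ↔ x = y + a := by
  constructor <;> rintro rfl <;> rw [add_assoc, bits_add_self, add_zero]

section Pauli

variable {ι κ : Type} [Fintype ι] [DecidableEq ι]

lemma pauliZ_eq (b : Bits ι) : pauliZ b = Matrix.diagonal fun x => sgn (b ⬝ᵥ x) := rfl

lemma mul_pauliX_apply (M : Matrix κ (Bits ι) ℂ) (a : Bits ι) (y : κ) (x : Bits ι) :
    (M * pauliX a) y x = M y (x + a) := by
  simp [Matrix.mul_apply, pauliX]

lemma pauliX_mul_apply (M : Matrix (Bits ι) κ ℂ) (a : Bits ι) (y : Bits ι) (x : κ) :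
    (pauliX a * M) y x = M (y + a) x := by
  simp [Matrix.mul_apply, pauliX, bits_eq_add_iff (y := y)]

lemma mul_pauliZ_apply (M : Matrix κ (Bits ι) ℂ) (b : Bits ι) (y : κ) (x : Bits ι) :
    (M * pauliZ b) y x = M y x * sgn (b ⬝ᵥ x) := by
  simp [pauliZ_eq, Matrix.mul_diagonal]

lemma pauliZ_mul_apply (M : Matrix (Bits ι) κ ℂ) (b : Bits ι) (y : Bits ι) (x : κ) :
    (pauliZ b * M) y x = sgn (b ⬝ᵥ y) * M y x := by
  simp [pauliZ_eq, Matrix.diagonal_mul]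

@[simp] lemma pauliX_zero : pauliX (0 : Bits ι) = 1 := by
  ext y x; simp [pauliX, Matrix.one_apply]

@[simp] lemma pauliZ_zero : pauliZ (0 : Bits ι) = 1 := by
  ext y x; simp [pauliZ_eq]

lemma pauliX_add (a b : Bits ι) : pauliX (a + b) = pauliX a * pauliX b := by
  ext y x
  rw [pauliX_mul_apply]
  simp only [pauliX, Matrix.of_apply]
  congr 1
  rw [eq_iff_iff, bits_eq_add_iff, bits_eq_add_iff (x := x), add_assoc]

lemma pauliZ_add (a b : Bits ι) : pauliZ (a + b) = pauliZ a * pauliZ b := by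
  simp [pauliZ_eq, add_dotProduct, sgn_add]

@[simp] lemma pauliX_mul_self (a : Bits ι) : pauliX a * pauliX a = 1 := by
  rw [← pauliX_add, bits_add_self, pauliX_zero]

@[simp] lemma pauliZ_mul_self (a : Bits ι) : pauliZ a * pauliZ a = 1 := by
  rw [← pauliZ_add, bits_add_self, pauliZ_zero]

lemma pauliX_comm (a b : Bits ι) : pauliX a * pauliX b = pauliX b * pauliX a := by
  rw [← pauliX_add, add_comm, pauliX_add]

lemma pauliZ_comm (a b : Bits ι) : pauliZ a * pauliZ b = pauliZ b * pauliZ a := by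
  rw [← pauliZ_add, add_comm, pauliZ_add]

lemma pauliZ_mul_pauliX (b a : Bits ι) :
    pauliZ b * pauliX a = sgn (b ⬝ᵥ a) • (pauliX a * pauliZ b) := by
  ext y x
  rw [mul_pauliX_apply, Matrix.smul_apply, pauliX_mul_apply]
  simp only [pauliZ_eq, Matrix.diagonal_apply]
  have h : (y = x + a) ↔ (y + a = x) := by rw [bits_eq_add_iff, eq_comm]
  by_cases hx : y = x + a
  · rw [if_pos hx, if_pos (h.1 hx), dotProduct_add, sgn_add, smul_eq_mul]
    linear_combination (-sgn (b ⬝ᵥ y)) * sgn_mul_self (b ⬝ᵥ a)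
  · rw [if_neg hx, if_neg (fun h' => hx (h.2 h')), smul_zero]

lemma pauliX_mul_pauliZ (a b : Bits ι) :
    pauliX a * pauliZ b = sgn (b ⬝ᵥ a) • (pauliZ b * pauliX a) := by
  rw [pauliZ_mul_pauliX, smul_smul, sgn_mul_self, one_smul]

@[simp] lemma conjTranspose_pauliX (a : Bits ι) : (pauliX a)ᴴ = pauliX a := by
  ext y x
  simp only [pauliX, Matrix.conjTranspose_apply, Matrix.of_apply, bits_eq_add_iff (y := x)]
  split_ifs <;> simp

@[simp] lemma conjTranspose_pauliZ (a : Bits ι) : (pauliZ a)ᴴ = pauliZ a := by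
  simp only [pauliZ_eq, Matrix.diagonal_conjTranspose]
  congr 1; ext x; simp

lemma pauliX_mulVec_apply (a : Bits ι) (ψ : Bits ι → ℂ) (y : Bits ι) :
    (pauliX a *ᵥ ψ) y = ψ (y + a) := by
  have := pauliX_mul_apply (Matrix.of fun (y : Bits ι) (_ : Unit) => ψ y) a y ()
  simpa [Matrix.mul_apply, Matrix.mulVec, dotProduct] using this

lemma pauliZ_mulVec_apply (b : Bits ι) (ψ : Bits ι → ℂ) (y : Bits ι) :
    (pauliZ b *ᵥ ψ) y = sgn (b ⬝ᵥ y) * ψ y := by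
  simp [pauliZ_eq, Matrix.mulVec_diagonal]

end Pauli

/-! ### Stabilizer generators and their joint measurement -/

section Stabilizer

variable {d : ℕ}

/-- `1` if the Pauli operator `X^a Z^b` anticommutes with the stabilizer generator of `c`. -/
def anticommBit (a b : Bits (Data d)) (c : Check d) : ZMod 2 :=
  if IsXCheck c.1.1 c.1.2 then support c ⬝ᵥ b else support c ⬝ᵥ a

lemma stabilizer_mul_self (c : Check d) : stabilizer c * stabilizer c = 1 := by
  unfold stabilizer; split_ifs <;> simp

lemma conjTranspose_stabilizer (c : Check d) : (stabilizer c)ᴴ = stabilizer c := by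
  unfold stabilizer; split_ifs <;> simp

lemma stabilizer_mul_pauli (c : Check d) (a b : Bits (Data d)) :
    stabilizer c * (pauliX a * pauliZ b) =
      sgn (anticommBit a b c) • (pauliX a * pauliZ b * stabilizer c) := by
  unfold stabilizer anticommBit
  split_ifs
  · rw [← mul_assoc, pauliX_comm, mul_assoc, pauliX_mul_pauliZ, mul_assoc, dotProduct_comm,
      Matrix.mul_smul]
  · rw [← mul_assoc, pauliZ_mul_pauliX, Matrix.smul_mul, mul_assoc, pauliZ_comm, mul_assoc]

/-- Projector onto the `(-1)^b` eigenspace of the stabilizer generator of `c`. -/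
def checkProjector (c : Check d) (b : ZMod 2) : Op (Data d) :=
  (1 / 2 : ℂ) • (1 + sgn b • stabilizer c)

lemma syndromeProjector_eq (σ : Check d → ZMod 2) : syndromeProjector σ =
    ((Finset.univ : Finset (Check d)).toList.map fun c => checkProjector c (σ c)).prod := rfl

lemma checkProjector_mul_pauli (c : Check d) (s : ZMod 2) (a b : Bits (Data d)) :
    checkProjector c s * (pauliX a * pauliZ b) =
      pauliX a * pauliZ b * checkProjector c (s + anticommBit a b c) := by
  simp only [checkProjector, Matrix.smul_mul, Matrix.mul_smul, add_mul, mul_add, one_mul, mul_one,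
    stabilizer_mul_pauli, smul_smul, sgn_add]

lemma syndromeProjector_mul_pauli (σ : Check d → ZMod 2) (a b : Bits (Data d)) :
    syndromeProjector σ * (pauliX a * pauliZ b) =
      pauliX a * pauliZ b * syndromeProjector (σ + anticommBit a b) := by
  simp only [syndromeProjector_eq]
  induction (Finset.univ : Finset (Check d)).toList with
  | nil => simp
  | cons c l ih =>
    rw [List.map_cons, List.prod_cons, mul_assoc, ih, ← mul_assoc, checkProjector_mul_pauli,
      List.map_cons, List.prod_cons, mul_assoc]
    rfl

lemma support_dotProduct_support {c c' : Check d} (hc : IsXCheck c.1.1 c.1.2)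
    (hc' : ¬ IsXCheck c'.1.1 c'.1.2) : support c ⬝ᵥ support c' = 0 := by
  obtain ⟨⟨⟨i, hi⟩, ⟨j, hj⟩⟩, h⟩ := c
  obtain ⟨⟨⟨i', hi'⟩, ⟨j', hj'⟩⟩, h'⟩ := c'
  have hz := h'.resolve_left hc'
  simp only [IsXCheck, IsZCheck, Nat.even_iff, Nat.odd_iff] at hc hz
  by_cases hn : ((i : ℤ) - i').natAbs = 1 ∧ ((j : ℤ) - j').natAbs = 1
  · have key : ∀ q : Data d, support ⟨(⟨i, hi⟩, ⟨j, hj⟩), h⟩ q *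
        support ⟨(⟨i', hi'⟩, ⟨j', hj'⟩), h'⟩ q =
        (if q = ⟨(⟨i, hi⟩, ⟨j', hj'⟩), by simp only [IsData, Nat.even_iff]; omega⟩ then 1 else 0) +
        (if q = ⟨(⟨i', hi'⟩, ⟨j, hj⟩), by simp only [IsData, Nat.even_iff]; omega⟩
          then 1 else 0) := by
      rintro ⟨⟨⟨a, ha⟩, ⟨b, hb⟩⟩, hq⟩
      simp only [support, Near, Subtype.mk.injEq, Prod.mk.injEq, Fin.mk.injEq, ite_mul, one_mul,
        zero_mul]
      simp only [IsData, Nat.even_iff] at hq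
      split_ifs <;> first | rfl | (exfalso; omega)
    simp [dotProduct, key, Finset.sum_add_distrib, CharTwo.add_self_eq_zero]
  · refine Finset.sum_eq_zero fun q _ => ?_
    obtain ⟨⟨⟨a, ha⟩, ⟨b, hb⟩⟩, hq⟩ := q
    simp only [support, Near, ite_mul, one_mul, zero_mul]
    simp only [IsData, Nat.even_iff] at hq
    split_ifs <;> first | rfl | (exfalso; omega)

lemma stabilizer_comm (c c' : Check d) : stabilizer c * stabilizer c' =
    stabilizer c' * stabilizer c := by
  unfold stabilizer
  split_ifs with h h' h'
  · rw [pauliX_comm]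
  · rw [pauliX_mul_pauliZ, dotProduct_comm, support_dotProduct_support h h']; simp
  · rw [pauliZ_mul_pauliX, dotProduct_comm, support_dotProduct_support h' h]; simp
  · rw [pauliZ_comm]

lemma stabilizer_mul_checkProjector (c : Check d) (b : ZMod 2) :
    stabilizer c * checkProjector c b = sgn b • checkProjector c b := by
  simp only [checkProjector, Matrix.mul_smul, mul_add, mul_one, stabilizer_mul_self, smul_add,
    smul_smul]
  rw [mul_left_comm (sgn b), sgn_mul_self, mul_one, mul_comm (sgn b), add_comm]

lemma stabilizer_mul_syndromeProjector (c : Check d) (σ : Check d → ZMod 2) :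
    stabilizer c * syndromeProjector σ = sgn (σ c) • syndromeProjector σ := by
  have key : ∀ l : List (Check d), c ∈ l →
      stabilizer c * (l.map fun c => checkProjector c (σ c)).prod =
        sgn (σ c) • (l.map fun c => checkProjector c (σ c)).prod := by
    intro l
    induction l with
    | nil => simp
    | cons c' l ih =>
      intro hc
      rw [List.map_cons, List.prod_cons, ← mul_assoc]
      by_cases h : c = c'
      · subst h
        rw [stabilizer_mul_checkProjector, Matrix.smul_mul]
      · have hcomm : stabilizer c * checkProjector c' (σ c') =
            checkProjector c' (σ c') * stabilizer c := by
          simp only [checkProjector, Matrix.mul_smul, Matrix.smul_mul, mul_add, add_mul, mul_one,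
            one_mul, stabilizer_comm c c']
        rw [hcomm, mul_assoc, ih ((List.mem_cons.1 hc).resolve_left h), Matrix.mul_smul]
  exact key _ (by simp)

lemma stabilizer_comm_syndromeProjector (c : Check d) (σ : Check d → ZMod 2) :
    stabilizer c * syndromeProjector σ = syndromeProjector σ * stabilizer c := by
  rw [syndromeProjector_eq]
  induction (Finset.univ : Finset (Check d)).toList with
  | nil => simp
  | cons c' l ih =>
    have hcomm : stabilizer c * checkProjector c' (σ c') =
        checkProjector c' (σ c') * stabilizer c := by
      simp only [checkProjector, Matrix.mul_smul, Matrix.smul_mul, mul_add, add_mul, mul_one,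
        one_mul, stabilizer_comm c c']
    rw [List.map_cons, List.prod_cons, ← mul_assoc, hcomm, mul_assoc, ih, mul_assoc]

lemma syndromeProjector_mul_stabilizer (c : Check d) (σ : Check d → ZMod 2) :
    syndromeProjector σ * stabilizer c = sgn (σ c) • syndromeProjector σ := by
  rw [← stabilizer_comm_syndromeProjector, stabilizer_mul_syndromeProjector]

lemma conjTranspose_mul_checkProjector (c : Check d) (b : ZMod 2) :
    (checkProjector c b)ᴴ * checkProjector c b = checkProjector c b := by
  have h : (checkProjector c b)ᴴ = checkProjector c b := by
    simp [checkProjector, Matrix.conjTranspose_smul, conjTranspose_stabilizer]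
  rw [h]
  conv_lhs => enter [1]; rw [checkProjector]
  rw [Matrix.smul_mul, add_mul, one_mul, Matrix.smul_mul, stabilizer_mul_checkProjector, smul_smul,
    sgn_mul_self, one_smul, ← two_smul ℂ, smul_smul]
  norm_num

lemma checkProjector_add (c : Check d) (b : ZMod 2) :
    checkProjector c b + checkProjector c (b + 1) = 1 := by
  simp only [checkProjector, sgn_add, sgn_one, ← smul_add]
  rw [mul_neg_one, neg_smul, add_add_add_comm, add_neg_cancel, add_zero, ← two_smul ℂ, smul_smul]
  norm_num

lemma sum_syndromeProjector : ∑ σ : Check d → ZMod 2,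
    (syndromeProjector σ)ᴴ * syndromeProjector σ = 1 := by
  have key : ∀ l : List (Check d), l.Nodup → (2 : ℂ) ^ l.length • ∑ σ : Check d → ZMod 2,
      ((l.map fun c => checkProjector c (σ c)).prod)ᴴ *
        (l.map fun c => checkProjector c (σ c)).prod =
      (Fintype.card (Check d → ZMod 2) : ℂ) • (1 : Op (Data d)) := by
    intro l
    induction l with
    | nil => intro _; simp [← Nat.cast_smul_eq_nsmul ℂ]
    | cons c l ih =>
      intro hl
      obtain ⟨hcl, hl⟩ := List.nodup_cons.1 hl
      rw [← ih hl, List.length_cons, pow_succ, mul_smul, two_smul]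
      congr 1
      conv_lhs => enter [2]; rw [← Equiv.sum_comp (Equiv.addRight (Pi.single c (1 : ZMod 2)))]
      rw [← Finset.sum_add_distrib]
      refine Finset.sum_congr rfl fun σ _ => ?_
      have hmap : (l.map fun c' => checkProjector c' ((σ + Pi.single c (1 : ZMod 2) : Check d → ZMod 2) c')) =
          l.map fun c' => checkProjector c' (σ c') := by
        refine List.map_congr_left fun c' hc' => ?_
        have : c' ≠ c := fun h => hcl (h ▸ hc')
        simp [this]
      simp only [List.map_cons, List.prod_cons, Equiv.coe_addRight, hmap, Matrix.conjTranspose_mul]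
      set M := (l.map fun c' => checkProjector c' (σ c')).prod
      have assoc4 : ∀ P : Op (Data d), Mᴴ * Pᴴ * (P * M) = Mᴴ * (Pᴴ * P) * M := fun P => by
        simp only [mul_assoc]
      rw [assoc4, assoc4, conjTranspose_mul_checkProjector, conjTranspose_mul_checkProjector,
        ← add_mul, ← mul_add]
      simp [checkProjector_add]
  have h := key _ (Finset.nodup_toList Finset.univ)
  simp only [syndromeProjector_eq]
  rw [Finset.length_toList, Finset.card_univ] at h
  have hcard : (Fintype.card (Check d → ZMod 2) : ℂ) = 2 ^ Fintype.card (Check d) := by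
    rw [Fintype.card_fun, ZMod.card]; push_cast; rfl
  rw [hcard] at h
  exact smul_right_injective _ (pow_ne_zero _ two_ne_zero) h

end Stabilizer

/-! ### Slices of the cluster -/

section Slices

variable {d L : ℕ}

/-- The bits of the data qubits in slice `t`. -/
def atSlice (t : Fin (2 * L + 1)) (g : Bits (Qubit d L)) : Bits (Data d) := fun q => g (dataAt t q)

/-- Bits `b` on the data qubits of slice `t`, zero elsewhere. -/
def liftSlice (t : Fin (2 * L + 1)) (b : Bits (Data d)) : Bits (Qubit d L) := fun v =>
  if h : IsData v.1.1 v.1.2.1 ∧ v.1.2.2 = t then b ⟨(v.1.1, v.1.2.1), h.1⟩ else 0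

/-- Restriction to the measured qubits. -/
def onMeasured (g : Bits (Qubit d L)) : Measured d L → ZMod 2 := fun v => g v.1

lemma dataAt_inj {t t' : Fin (2 * L + 1)} {q q' : Data d} :
    dataAt t q = dataAt t' q' ↔ t = t' ∧ q = q' := by
  simp only [dataAt, Subtype.ext_iff, Prod.ext_iff]
  tauto

lemma exists_dataAt {v : Qubit d L} (hv : IsData v.1.1 v.1.2.1) :
    ∃ q : Data d, v = dataAt v.1.2.2 q := ⟨⟨(v.1.1, v.1.2.1), hv⟩, rfl⟩

@[simp] lemma liftSlice_dataAt (t t' : Fin (2 * L + 1)) (b : Bits (Data d)) (q : Data d) :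
    liftSlice t b (dataAt t' q) = if t' = t then b q else 0 := by
  by_cases h : t' = t
  · rw [if_pos h]; exact dif_pos (c := IsData q.1.1 q.1.2 ∧ t' = t) ⟨q.2, h⟩
  · rw [if_neg h]; exact dif_neg (c := IsData q.1.1 q.1.2 ∧ t' = t) (fun h' => h h'.2)

lemma atSlice_liftSlice (t t' : Fin (2 * L + 1)) (b : Bits (Data d)) :
    atSlice t' (liftSlice t b) = if t' = t then b else 0 := by
  ext q; simp only [atSlice, liftSlice_dataAt]; split_ifs <;> rfl

lemma sum_data {M : Type*} [AddCommMonoid M] (φ : Qubit d L → M)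
    (hφ : ∀ v, ¬ IsData v.1.1 v.1.2.1 → φ v = 0) :
    ∑ v, φ v = ∑ t : Fin (2 * L + 1), ∑ q : Data d, φ (dataAt t q) := by
  rw [← Finset.sum_product' (f := fun t q => φ (dataAt t q))]
  symm
  refine Finset.sum_of_injOn (fun z : Fin (2 * L + 1) × Data d => dataAt z.1 z.2) ?_ ?_ ?_ ?_
  · intro a _ b _ h
    exact Prod.ext (dataAt_inj.1 h).1 (dataAt_inj.1 h).2
  · intro a _; simp
  · intro v _ hv
    refine hφ v fun h => hv ?_
    obtain ⟨q, hq⟩ := exists_dataAt h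
    exact ⟨(v.1.2.2, q), by simp, hq.symm⟩
  · intro a _; rfl

lemma liftSlice_dotProduct (t : Fin (2 * L + 1)) (b : Bits (Data d)) (x : Bits (Qubit d L)) :
    liftSlice t b ⬝ᵥ x = b ⬝ᵥ atSlice t x := by
  simp only [dotProduct]
  rw [sum_data, Finset.sum_eq_single t]
  · simp [atSlice]
  · intro t' _ ht'; simp [ht']
  · simp
  · intro v hv
    simp only [liftSlice]
    rw [dif_neg (fun h => hv h.1), zero_mul]

lemma isOutput_iff (v : Qubit d L) : IsOutput v ↔ ∃ q, v = dataAt (Fin.last (2 * L)) q := by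
  constructor
  · rintro ⟨h, h'⟩
    obtain ⟨q, hq⟩ := exists_dataAt h
    refine ⟨q, hq.trans ?_⟩
    congr 1
    exact Fin.ext h'
  · rintro ⟨q, rfl⟩
    exact ⟨q.2, rfl⟩

lemma extend_dotProduct (o : Measured d L → ZMod 2) (x : Bits (Qubit d L)) :
    extend o ⬝ᵥ x = o ⬝ᵥ onMeasured x := by
  simp only [dotProduct]
  rw [← Fintype.sum_subtype_add_sum_subtype (fun v => ¬ IsOutput v)]
  have h : ∑ v : {v : Qubit d L // ¬ ¬ IsOutput v}, extend o v.1 * x v.1 = 0 := by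
    refine Finset.sum_eq_zero fun v _ => ?_
    rw [extend, dif_neg v.2, zero_mul]
  rw [h, add_zero]
  refine Finset.sum_congr rfl fun v _ => ?_
  rw [extend, dif_pos v.2, onMeasured]

lemma extend_onMeasured (g : Bits (Qubit d L)) :
    extend (onMeasured g) = g + liftSlice (Fin.last (2 * L)) (atSlice (Fin.last (2 * L)) g) := by
  ext v
  by_cases hv : IsOutput v
  · rw [extend, dif_neg (not_not.2 hv)]
    obtain ⟨q, rfl⟩ := (isOutput_iff v).1 hv
    simp [atSlice, CharTwo.add_self_eq_zero]
  · rw [extend, dif_pos hv, Pi.add_apply, liftSlice, dif_neg, add_zero, onMeasured]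
    rintro ⟨h, h'⟩
    exact hv ⟨h, by simp [h']⟩

lemma extend_add {ι : Type} {P : ι → Prop} [DecidablePred P] (f g : {v : ι // P v} → ZMod 2) :
    extend (f + g) = extend f + extend g := by
  ext v; simp only [extend, Pi.add_apply]; split_ifs <;> simp

end Slices

/-! ### The entangling circuit -/

section Circuit

variable {d L : ℕ}

/-- Parity of a bit assignment over the neighbours of each qubit in the cluster state graph. -/
def nbr (g : Bits (Qubit d L)) : Bits (Qubit d L) := fun u =>
  ∑ v : Qubit d L, if Near u.pos v.pos then g v else 0

lemma near_comm (u v : ℕ × ℕ × ℕ) : Near u v ↔ Near v u := by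
  simp only [Near]; omega

/-- `nbr` is symmetric. -/
lemma nbr_dotProduct (g h : Bits (Qubit d L)) : nbr g ⬝ᵥ h = g ⬝ᵥ nbr h := by
  simp only [dotProduct, nbr, Finset.sum_mul, Finset.mul_sum]
  rw [Finset.sum_comm]
  refine Finset.sum_congr rfl fun u _ => Finset.sum_congr rfl fun v _ => ?_
  simp only [near_comm v.pos u.pos]
  split_ifs <;> simp

/-- Number of gates acting on the ordered pair `(u, v)`. -/
def gateCount (u v : ℕ × ℕ × ℕ) : ZMod 2 := ∑ k ∈ Finset.range 4, if GateAt k u v then 1 else 0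

lemma gateCount_eq (u v : ℕ × ℕ × ℕ) : gateCount u v =
    if v = (u.1 + 1, u.2.1, u.2.2) ∨ v = (u.1, u.2.1 + 1, u.2.2) ∨ v = (u.1, u.2.1, u.2.2 + 1)
      then 1 else 0 := by
  obtain ⟨a, b, c⟩ := u
  obtain ⟨a', b', c'⟩ := v
  simp only [gateCount, GateAt, Prod.mk.injEq]
  split_ifs with h
  · have hk : ∃ k₀ < 4, ∀ k, (((a' = a + 1 ∧ b' = b ∧ c' = c) ∧ k = 2 * ((c + 1) % 2) + a % 2 ∨
        (a' = a ∧ b' = b + 1 ∧ c' = c) ∧ k = 2 * (c % 2) + b % 2 ∨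
        (a' = a ∧ b' = b ∧ c' = c + 1) ∧ k = 2 * (a % 2) + c % 2) ↔ k = k₀) := by
      rcases h with h | h | h
      · exact ⟨2 * ((c + 1) % 2) + a % 2, by omega, fun k => by omega⟩
      · exact ⟨2 * (c % 2) + b % 2, by omega, fun k => by omega⟩
      · exact ⟨2 * (a % 2) + c % 2, by omega, fun k => by omega⟩
    obtain ⟨k₀, hk₀, hk⟩ := hk
    simp [hk, hk₀]
  · refine Finset.sum_eq_zero fun k _ => if_neg fun h' => h ?_
    tauto

lemma gateCount_add_gateCount (u v : ℕ × ℕ × ℕ) :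
    gateCount u v + gateCount v u = if Near u v then 1 else 0 := by
  obtain ⟨a, b, c⟩ := u
  obtain ⟨a', b', c'⟩ := v
  simp only [gateCount_eq, Near, Prod.mk.injEq]
  split_ifs <;> first | rfl | (exfalso; omega)

lemma gateCount_eq_zero {u v : ℕ × ℕ × ℕ} (h : ¬ Near u v) : gateCount u v = 0 := by
  obtain ⟨a, b, c⟩ := u
  obtain ⟨a', b', c'⟩ := v
  simp only [gateCount_eq, Near, Prod.mk.injEq] at h ⊢
  rw [if_neg]; omega

/-- The quadratic form of the phases acquired under the CZ gates. -/
def czForm (x : Bits (Qubit d L)) : ZMod 2 :=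
  ∑ u : Qubit d L, ∑ v : Qubit d L, gateCount u.pos v.pos * (x u * x v)

lemma czForm_add (x g : Bits (Qubit d L)) :
    czForm (x + g) = czForm x + czForm g + nbr g ⬝ᵥ x := by
  have h : nbr g ⬝ᵥ x = ∑ u : Qubit d L, ∑ v : Qubit d L, gateCount u.pos v.pos * (x u * g v) +
      ∑ u : Qubit d L, ∑ v : Qubit d L, gateCount u.pos v.pos * (g u * x v) := by
    rw [Finset.sum_comm (f := fun u v : Qubit d L => gateCount u.pos v.pos * (g u * x v)),
      ← Finset.sum_add_distrib]
    simp only [dotProduct, nbr, Finset.sum_mul, ← Finset.sum_add_distrib]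
    refine Finset.sum_congr rfl fun u _ => Finset.sum_congr rfl fun v _ => ?_
    have := gateCount_add_gateCount u.pos v.pos
    by_cases hn : Near u.pos v.pos
    · rw [if_pos hn] at this ⊢
      linear_combination (-(g v * x u)) * this
    · rw [if_neg hn] at this ⊢
      linear_combination (-(g v * x u)) * this
  rw [h]
  simp only [czForm, ← Finset.sum_add_distrib]
  refine Finset.sum_congr rfl fun u _ => Finset.sum_congr rfl fun v _ => ?_
  simp only [Pi.add_apply]; ring

lemma czForm_eq_zero {g : Bits (Qubit d L)}
    (h : ∀ u v : Qubit d L, Near u.pos v.pos → g u * g v = 0) : czForm g = 0 := by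
  refine Finset.sum_eq_zero fun u _ => Finset.sum_eq_zero fun v _ => ?_
  by_cases hn : Near u.pos v.pos
  · rw [h u v hn, mul_zero]
  · rw [gateCount_eq_zero hn, zero_mul]

/-- All CZ gates of the noiseless circuit. -/
def czCircuit (d L : ℕ) : Op (Qubit d L) := Matrix.diagonal fun x => sgn (czForm x)

lemma czStep_eq (k : ℕ) : czStep d L k = Matrix.diagonal fun x =>
    sgn (∑ u : Qubit d L, ∑ v : Qubit d L,
      (if GateAt k u.pos v.pos then 1 else 0) * (x u * x v)) := by
  unfold czStep
  congr 1; ext x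
  simp only [sgn_sum]
  refine Finset.prod_congr rfl fun u _ => Finset.prod_congr rfl fun v _ => ?_
  split_ifs <;> simp

lemma czSteps_eq : czStep d L 3 * czStep d L 2 * czStep d L 1 * czStep d L 0 = czCircuit d L := by
  simp only [czStep_eq, Matrix.diagonal_mul_diagonal, czCircuit, ← sgn_add]
  congr 1; ext x; congr 1
  simp only [czForm, gateCount, Finset.sum_range_succ, Finset.sum_range_zero, zero_add, add_mul,
    Finset.sum_add_distrib]
  ring

lemma pauliCircuit_eq (e : Noisy d L → ZMod 2) :
    pauliCircuit e = pauliZ (extend e) * czCircuit d L := by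
  rw [pauliCircuit, ← czSteps_eq]
  simp only [mul_assoc]

lemma czCircuit_mul_pauliX (g : Bits (Qubit d L)) :
    czCircuit d L * pauliX g = sgn (czForm g) • (pauliX g * pauliZ (nbr g) * czCircuit d L) := by
  ext y x
  rw [mul_pauliX_apply, Matrix.smul_apply, mul_assoc, pauliX_mul_apply, pauliZ_mul_apply]
  simp only [czCircuit, Matrix.diagonal_apply]
  have h : (y = x + g) ↔ (y + g = x) := by rw [bits_eq_add_iff, eq_comm]
  by_cases hx : y = x + g
  · rw [if_pos hx, if_pos (h.1 hx), h.1 hx, hx, czForm_add, sgn_add, sgn_add, smul_eq_mul]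
    ring
  · rw [if_neg hx, if_neg (fun h' => hx (h.2 h')), mul_zero, smul_zero]

lemma pauliCircuit_mul_pauliX (e : Noisy d L → ZMod 2) (g : Bits (Qubit d L)) :
    pauliCircuit e * pauliX g =
      sgn (czForm g + extend e ⬝ᵥ g) • (pauliX g * pauliZ (nbr g) * pauliCircuit e) := by
  rw [pauliCircuit_eq, mul_assoc, czCircuit_mul_pauliX, Matrix.mul_smul, ← mul_assoc, ← mul_assoc,
    pauliZ_mul_pauliX, Matrix.smul_mul, Matrix.smul_mul, smul_smul, sgn_add]
  rw [mul_assoc (pauliX g), pauliZ_comm, mul_assoc (pauliX g), mul_assoc (pauliX g), mul_assoc]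

lemma measure_mul_pauliX (o : Measured d L → ZMod 2) (g : Bits (Qubit d L)) :
    measure o * pauliX g =
      sgn (extend o ⬝ᵥ g) • (pauliX (atSlice (Fin.last (2 * L)) g) * measure o) := by
  ext y x
  rw [mul_pauliX_apply, Matrix.smul_apply, pauliX_mul_apply, extend_dotProduct]
  simp only [measure, Matrix.of_apply]
  have h : ((fun q => (x + g) (dataAt (Fin.last (2 * L)) q)) = y) ↔
      (fun q => x (dataAt (Fin.last (2 * L)) q)) = y + atSlice (Fin.last (2 * L)) g := by
    rw [← bits_eq_add_iff, eq_comm]; rfl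
  by_cases hx : (fun q => x (dataAt (Fin.last (2 * L)) q)) = y + atSlice (Fin.last (2 * L)) g
  · rw [if_pos hx, if_pos (h.2 hx), dotProduct, sgn_sum, smul_eq_mul, ← Finset.prod_mul_distrib]
    refine Finset.prod_congr rfl fun v _ => ?_
    rw [Pi.add_apply, mul_add, sgn_add, onMeasured]; ring
  · rw [if_neg hx, if_neg (fun h' => hx (h.1 h')), smul_zero]

lemma measure_mul_pauliZ (o : Measured d L → ZMod 2) (h : Bits (Qubit d L)) :
    measure o * pauliZ h =
      pauliZ (atSlice (Fin.last (2 * L)) h) * measure (o + onMeasured h) := by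
  ext y x
  rw [mul_pauliZ_apply, pauliZ_mul_apply]
  simp only [measure, Matrix.of_apply]
  split_ifs with hx
  · have : h ⬝ᵥ x = onMeasured h ⬝ᵥ onMeasured x + atSlice (Fin.last (2 * L)) h ⬝ᵥ y := by
      rw [← extend_dotProduct, extend_onMeasured, add_dotProduct, liftSlice_dotProduct, ← hx]
      change _ = _ + (_ ⬝ᵥ atSlice (Fin.last (2 * L)) x) + (_ ⬝ᵥ atSlice (Fin.last (2 * L)) x)
      rw [add_assoc, CharTwo.add_self_eq_zero, add_zero]
    rw [this, sgn_add, mul_comm (sgn _) (sgn _), mul_left_comm]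
    congr 1
    rw [dotProduct, sgn_sum, ← Finset.prod_mul_distrib]
    refine Finset.prod_congr rfl fun v _ => ?_
    rw [Pi.add_apply, add_mul, sgn_add, onMeasured, onMeasured]; ring
  · simp

lemma pauliX_mul_prepare (g : Bits (Qubit d L)) :
    pauliX g * prepare d L = prepare d L * pauliX (atSlice 0 g) := by
  ext x y
  rw [mul_pauliX_apply, pauliX_mul_apply]
  simp only [prepare, Matrix.of_apply]
  congr 1
  rw [eq_iff_iff, ← bits_eq_add_iff, eq_comm]; rfl

lemma pauliZ_liftSlice_mul_prepare (b : Bits (Data d)) :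
    pauliZ (liftSlice (L := L) 0 b) * prepare d L = prepare d L * pauliZ b := by
  ext x y
  rw [mul_pauliZ_apply, pauliZ_mul_apply, liftSlice_dotProduct]
  simp only [prepare, Matrix.of_apply]
  split_ifs with h
  · rw [← h, mul_comm]; rfl
  · simp

/-- The action on the code block of the faulty circuit with cluster outcomes `o`, before the
final stabilizer measurement and the frame update. -/
def clusterOp (o : Measured d L → ZMod 2) (e : Noisy d L → ZMod 2) : Op (Data d) :=
  measure o * pauliCircuit e * prepare d L

/-- Graph state stabilizers act on the cluster measurement outcomes. -/
lemma clusterOp_mul_pauliX (o : Measured d L → ZMod 2) (e : Noisy d L → ZMod 2)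
    (g : Bits (Qubit d L)) :
    clusterOp o e * pauliX (atSlice 0 g) = sgn (czForm g + (extend e + extend o) ⬝ᵥ g) •
      (pauliX (atSlice (Fin.last (2 * L)) g) * pauliZ (atSlice (Fin.last (2 * L)) (nbr g)) *
        clusterOp (o + onMeasured (nbr g)) e) := by
  rw [clusterOp, Matrix.mul_assoc, ← pauliX_mul_prepare, Matrix.mul_assoc (measure o),
    ← Matrix.mul_assoc (pauliCircuit e), pauliCircuit_mul_pauliX, Matrix.smul_mul, Matrix.mul_smul,
    Matrix.mul_assoc (pauliX g), Matrix.mul_assoc (pauliX g), ← Matrix.mul_assoc (measure o),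
    measure_mul_pauliX, Matrix.smul_mul, smul_smul, add_dotProduct, ← add_assoc, sgn_add,
    Matrix.mul_assoc (pauliX _), ← Matrix.mul_assoc (measure o), ← Matrix.mul_assoc (measure o),
    measure_mul_pauliZ]
  simp only [Matrix.mul_assoc, clusterOp, sgn_add]

lemma pauliCircuit_comm_pauliZ (e : Noisy d L → ZMod 2) (h : Bits (Qubit d L)) :
    pauliZ h * pauliCircuit e = pauliCircuit e * pauliZ h := by
  simp only [pauliCircuit_eq, pauliZ_eq, czCircuit, Matrix.diagonal_mul_diagonal]
  congr 1; ext x; ring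

/-- Graph state stabilizers that reach the input and output blocks only. -/
lemma clusterOp_conj (o : Measured d L → ZMod 2) (e : Noisy d L → ZMod 2)
    {g : Bits (Qubit d L)} {b₀ b₁ : Bits (Data d)} (hg : czForm g = 0)
    (hn : nbr g = liftSlice 0 b₀ + liftSlice (Fin.last (2 * L)) b₁) :
    clusterOp o e * pauliX (atSlice 0 g) = sgn ((extend e + extend o) ⬝ᵥ g) •
      (pauliX (atSlice (Fin.last (2 * L)) g) * pauliZ b₁ * clusterOp o e * pauliZ b₀) := by
  have hlast : measure o * pauliZ (liftSlice (Fin.last (2 * L)) b₁) = pauliZ b₁ * measure o := by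
    rw [measure_mul_pauliZ, atSlice_liftSlice, if_pos rfl]
    congr 2
    ext v
    simp only [Pi.add_apply, onMeasured, liftSlice]
    rw [dif_neg, add_zero]
    rintro ⟨h, h'⟩
    exact v.2 ⟨h, by simp [h']⟩
  rw [clusterOp, Matrix.mul_assoc, ← pauliX_mul_prepare, Matrix.mul_assoc (measure o),
    ← Matrix.mul_assoc (pauliCircuit e), pauliCircuit_mul_pauliX, hn, add_comm (liftSlice 0 b₀),
    pauliZ_add, Matrix.smul_mul, Matrix.mul_smul, hg, zero_add,
    Matrix.mul_assoc (pauliX g), Matrix.mul_assoc (pauliX g), ← Matrix.mul_assoc (measure o),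
    measure_mul_pauliX, Matrix.smul_mul, smul_smul, add_dotProduct, sgn_add]
  congr 1
  simp only [Matrix.mul_assoc]
  congr 1
  rw [← Matrix.mul_assoc (pauliZ _) (pauliCircuit _), pauliCircuit_comm_pauliZ,
    Matrix.mul_assoc, pauliZ_liftSlice_mul_prepare, ← Matrix.mul_assoc (measure o), hlast]
  simp only [Matrix.mul_assoc]

end Circuit

/-! ### Geometry of the cluster -/

section Geometry

variable {d L : ℕ}

lemma near_iff (u v : ℕ × ℕ × ℕ) : Near u v ↔
    (v.2.1 = u.2.1 ∧ v.2.2 = u.2.2 ∧ (v.1 = u.1 + 1 ∨ u.1 = v.1 + 1)) ∨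
    (v.1 = u.1 ∧ v.2.2 = u.2.2 ∧ (v.2.1 = u.2.1 + 1 ∨ u.2.1 = v.2.1 + 1)) ∨
    (v.1 = u.1 ∧ v.2.1 = u.2.1 ∧ (v.2.2 = u.2.2 + 1 ∨ u.2.2 = v.2.2 + 1)) := by
  simp only [Near]; omega

lemma nbr_add (g h : Bits (Qubit d L)) : nbr (g + h) = nbr g + nbr h := by
  ext u
  simp only [nbr, Pi.add_apply, ← Finset.sum_add_distrib]
  refine Finset.sum_congr rfl fun v _ => ?_
  split_ifs <;> simp

lemma nbr_zero : nbr (0 : Bits (Qubit d L)) = 0 := by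
  ext u; simp [nbr]

lemma nbr_sum {κ : Type*} (s : Finset κ) (f : κ → Bits (Qubit d L)) :
    nbr (∑ i ∈ s, f i) = ∑ i ∈ s, nbr (f i) := by
  classical
  induction s using Finset.induction_on with
  | empty => simp [nbr_zero]
  | insert a s ha ih => rw [Finset.sum_insert ha, Finset.sum_insert ha, nbr_add, ih]

/-- The check at the site of an ancilla. -/
def checkSite (u : Qubit d L) (hu : ¬ IsData u.1.1 u.1.2.1) : Check d :=
  ⟨(u.1.1, u.1.2.1), (u.2.resolve_left hu).imp And.left And.left⟩

lemma nbr_liftSlice_dataAt (t t' : Fin (2 * L + 1)) (b : Bits (Data d)) (q : Data d) :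
    nbr (liftSlice t b) (dataAt t' q) =
      if ((t : ℤ) - (t' : ℤ)).natAbs = 1 then b q else 0 := by
  have h1 : nbr (liftSlice t b) (dataAt t' q) =
      ∑ q' : Data d, if Near (dataAt t' q : Qubit d L).pos (dataAt t q' : Qubit d L).pos
        then b q' else 0 := by
    rw [nbr, sum_data, Finset.sum_eq_single t]
    · simp
    · intro t'' _ h; simp [h]
    · simp
    · intro v hv
      rw [liftSlice, dif_neg (fun h => hv h.1), ite_self]
  rw [h1]
  have h2 : ∀ q' : Data d, Near (dataAt t' q : Qubit d L).pos (dataAt t q' : Qubit d L).pos ↔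
      ((t : ℤ) - (t' : ℤ)).natAbs = 1 ∧ q' = q := by
    intro q'
    obtain ⟨⟨⟨a, ha⟩, ⟨b, hb⟩⟩, hq⟩ := q
    obtain ⟨⟨⟨a', ha'⟩, ⟨b', hb'⟩⟩, hq'⟩ := q'
    simp only [IsData, Nat.even_iff] at hq hq'
    simp only [Near, Qubit.pos, dataAt, Subtype.mk.injEq, Prod.mk.injEq, Fin.mk.injEq]
    omega
  simp only [h2]
  split_ifs with h <;> simp [h]

lemma nbr_liftSlice_check (t : Fin (2 * L + 1)) (b : Bits (Data d)) (u : Qubit d L)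
    (hu : ¬ IsData u.1.1 u.1.2.1) :
    nbr (liftSlice t b) u = if u.1.2.2 = t then support (checkSite u hu) ⬝ᵥ b else 0 := by
  have h1 : nbr (liftSlice t b) u =
      ∑ q' : Data d, if Near u.pos (dataAt t q' : Qubit d L).pos then b q' else 0 := by
    rw [nbr, sum_data, Finset.sum_eq_single t]
    · simp
    · intro t'' _ h; simp [h]
    · simp
    · intro v hv
      rw [liftSlice, dif_neg (fun h => hv h.1), ite_self]
  have h2 : ∀ q' : Data d, Near u.pos (dataAt t q' : Qubit d L).pos ↔
      u.1.2.2 = t ∧ Near ((checkSite u hu).1.1, (checkSite u hu).1.2, 0) (q'.1.1, q'.1.2, 0) := by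
    intro q'
    obtain ⟨⟨⟨a, ha⟩, ⟨b, hb⟩, ⟨c, hc⟩⟩, hu'⟩ := u
    obtain ⟨⟨⟨a', ha'⟩, ⟨b', hb'⟩⟩, hq'⟩ := q'
    obtain ⟨t, ht⟩ := t
    simp only [IsData, Nat.even_iff] at hu hq'
    simp only [Near, Qubit.pos, dataAt, checkSite, Fin.mk.injEq]
    omega
  rw [h1]
  simp only [h2]
  split_ifs with h
  · simp [dotProduct, support, h]
  · simp [h]

lemma sum_fin_near (n t' : ℕ) (φ : ℕ → ZMod 2) :
    ∑ t : Fin n, (if ((t : ℤ) - (t' : ℤ)).natAbs = 1 then φ t else 0) =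
      (if 0 < t' ∧ t' - 1 < n then φ (t' - 1) else 0) + if t' + 1 < n then φ (t' + 1) else 0 := by
  rw [Fin.sum_univ_eq_sum_range
    (fun t : ℕ => if ((t : ℤ) - (t' : ℤ)).natAbs = 1 then φ t else 0) n]
  have h : ∀ t : ℕ, (if ((t : ℤ) - (t' : ℤ)).natAbs = 1 then φ t else 0) =
      (if t = t' - 1 then (if 0 < t' then φ t else 0) else 0) + (if t = t' + 1 then φ t else 0) := by
    intro t
    split_ifs <;> first | (exfalso; omega) | simp
  simp only [h, Finset.sum_add_distrib, Finset.sum_ite_eq', Finset.mem_range]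
  congr 1
  split_ifs <;> first | rfl | (exfalso; omega)

/-- Bits `b` on the data qubits of all odd slices. -/
def oddSheet (b : Bits (Data d)) : Bits (Qubit d L) :=
  ∑ t : Fin (2 * L + 1), if Odd (t : ℕ) then liftSlice t b else 0

/-- Bits `b` on the data qubits of all even slices. -/
def evenSheet (b : Bits (Data d)) : Bits (Qubit d L) :=
  ∑ t : Fin (2 * L + 1), if Even (t : ℕ) then liftSlice t b else 0

lemma dotProduct_oddSheet (f : Bits (Qubit d L)) (b : Bits (Data d)) :
    f ⬝ᵥ oddSheet b = xPart f ⬝ᵥ b := by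
  have h : f ⬝ᵥ oddSheet b = ∑ t : Fin (2 * L + 1),
      f ⬝ᵥ (if Odd (t : ℕ) then liftSlice t b else 0) :=
    dotProduct_sum f Finset.univ (fun t : Fin (2 * L + 1) => if Odd (t : ℕ) then liftSlice t b else 0)
  rw [h, dotProduct_comm (xPart f)]
  simp only [dotProduct, xPart, Finset.mul_sum]
  rw [Finset.sum_comm (γ := Data d)]
  refine Finset.sum_congr rfl fun t _ => ?_
  split_ifs with h
  · exact (dotProduct_comm _ _).trans (liftSlice_dotProduct t b f)
  · simp

lemma dotProduct_evenSheet (f : Bits (Qubit d L)) (b : Bits (Data d)) :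
    f ⬝ᵥ evenSheet b = zPart f ⬝ᵥ b := by
  have h : f ⬝ᵥ evenSheet b = ∑ t : Fin (2 * L + 1),
      f ⬝ᵥ (if Even (t : ℕ) then liftSlice t b else 0) :=
    dotProduct_sum f Finset.univ (fun t : Fin (2 * L + 1) => if Even (t : ℕ) then liftSlice t b else 0)
  rw [h, dotProduct_comm (zPart f)]
  simp only [dotProduct, zPart, Finset.mul_sum]
  rw [Finset.sum_comm (γ := Data d)]
  refine Finset.sum_congr rfl fun t _ => ?_
  split_ifs with h
  · exact (dotProduct_comm _ _).trans (liftSlice_dotProduct t b f)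
  · simp

lemma oddSheet_dataAt (b : Bits (Data d)) (t : Fin (2 * L + 1)) (q : Data d) :
    oddSheet b (dataAt t q) = if Odd (t : ℕ) then b q else 0 := by
  rw [oddSheet, Finset.sum_apply, Finset.sum_eq_single t]
  · split_ifs <;> simp
  · intro t' _ h; split_ifs <;> simp [h.symm]
  · simp

lemma evenSheet_dataAt (b : Bits (Data d)) (t : Fin (2 * L + 1)) (q : Data d) :
    evenSheet b (dataAt t q) = if Even (t : ℕ) then b q else 0 := by
  rw [evenSheet, Finset.sum_apply, Finset.sum_eq_single t]
  · split_ifs <;> simp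
  · intro t' _ h; split_ifs <;> simp [h.symm]
  · simp

lemma oddSheet_check (b : Bits (Data d)) (u : Qubit d L) (hu : ¬ IsData u.1.1 u.1.2.1) :
    oddSheet b u = 0 := by
  rw [oddSheet, Finset.sum_apply]
  refine Finset.sum_eq_zero fun t _ => ?_
  split_ifs
  · rw [liftSlice, dif_neg (fun h => hu h.1)]
  · rfl

lemma evenSheet_check (b : Bits (Data d)) (u : Qubit d L) (hu : ¬ IsData u.1.1 u.1.2.1) :
    evenSheet b u = 0 := by
  rw [evenSheet, Finset.sum_apply]
  refine Finset.sum_eq_zero fun t _ => ?_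
  split_ifs
  · rw [liftSlice, dif_neg (fun h => hu h.1)]
  · rfl

lemma nbr_oddSheet_dataAt (b : Bits (Data d)) (t : Fin (2 * L + 1)) (q : Data d) :
    nbr (oddSheet b) (dataAt t q) =
      (if t = 0 then b q else 0) + if t = Fin.last (2 * L) then b q else 0 := by
  have h : ∀ t' : Fin (2 * L + 1),
      nbr (if Odd (t' : ℕ) then liftSlice t' b else 0) (dataAt t q) =
        if ((t' : ℤ) - ((t : ℕ) : ℤ)).natAbs = 1 then (if Odd (t' : ℕ) then b q else 0) else 0 := by
    intro t'
    split_ifs with h1 h2 h2 <;> simp [nbr_liftSlice_dataAt, nbr_zero, h2]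
  rw [oddSheet, nbr_sum, Finset.sum_apply, Finset.sum_congr rfl fun t' _ => h t',
    sum_fin_near (2 * L + 1) t fun t' => if Odd t' then b q else 0]
  obtain ⟨t, ht⟩ := t
  simp only [Fin.ext_iff, Fin.val_zero, Fin.val_last, Nat.odd_iff]
  split_ifs <;> first | (exfalso; omega) | simp [CharTwo.add_self_eq_zero]

lemma nbr_evenSheet_dataAt (b : Bits (Data d)) (t : Fin (2 * L + 1)) (q : Data d) :
    nbr (evenSheet b) (dataAt t q) = 0 := by
  have h : ∀ t' : Fin (2 * L + 1),
      nbr (if Even (t' : ℕ) then liftSlice t' b else 0) (dataAt t q) =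
        if ((t' : ℤ) - ((t : ℕ) : ℤ)).natAbs = 1 then (if Even (t' : ℕ) then b q else 0) else 0 := by
    intro t'
    split_ifs with h1 h2 h2 <;> simp [nbr_liftSlice_dataAt, nbr_zero, h2]
  rw [evenSheet, nbr_sum, Finset.sum_apply, Finset.sum_congr rfl fun t' _ => h t',
    sum_fin_near (2 * L + 1) t fun t' => if Even t' then b q else 0]
  obtain ⟨t, ht⟩ := t
  simp only [Nat.even_iff]
  split_ifs <;> first | (exfalso; omega) | simp [CharTwo.add_self_eq_zero]

lemma nbr_oddSheet_check (b : Bits (Data d)) (u : Qubit d L) (hu : ¬ IsData u.1.1 u.1.2.1) :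
    nbr (oddSheet b) u =
      if IsXCheck u.1.1 u.1.2.1 then support (checkSite u hu) ⬝ᵥ b else 0 := by
  have hodd : IsXCheck u.1.1 u.1.2.1 ↔ Odd (u.1.2.2 : ℕ) := by
    have := u.2
    simp only [IsClusterQubit, IsData, IsXCheck, IsZCheck, Nat.even_iff, Nat.odd_iff] at this hu ⊢
    omega
  rw [oddSheet, nbr_sum, Finset.sum_apply, Finset.sum_eq_single u.1.2.2]
  · split_ifs with h1 h2 h2
    · rw [nbr_liftSlice_check _ _ _ hu, if_pos rfl]
    · exact absurd (hodd.2 h1) h2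
    · exact absurd (hodd.1 h2) h1
    · rw [nbr_zero]; rfl
  · intro t _ ht
    split_ifs
    · rw [nbr_liftSlice_check _ _ _ hu, if_neg ht.symm]
    · rw [nbr_zero]; rfl
  · simp

lemma nbr_evenSheet_check (b : Bits (Data d)) (u : Qubit d L) (hu : ¬ IsData u.1.1 u.1.2.1) :
    nbr (evenSheet b) u =
      if IsXCheck u.1.1 u.1.2.1 then 0 else support (checkSite u hu) ⬝ᵥ b := by
  have hodd : IsXCheck u.1.1 u.1.2.1 ↔ ¬ Even (u.1.2.2 : ℕ) := by
    have := u.2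
    simp only [IsClusterQubit, IsData, IsXCheck, IsZCheck, Nat.even_iff, Nat.odd_iff] at this hu ⊢
    omega
  rw [evenSheet, nbr_sum, Finset.sum_apply, Finset.sum_eq_single u.1.2.2]
  · split_ifs with h1 h2 h2
    · exact absurd h1 (hodd.1 h2)
    · rw [nbr_liftSlice_check _ _ _ hu, if_pos rfl]
    · rw [nbr_zero]; rfl
    · exact absurd (hodd.2 h1) h2
  · intro t _ ht
    split_ifs
    · rw [nbr_liftSlice_check _ _ _ hu, if_neg ht.symm]
    · rw [nbr_zero]; rfl
  · simp

lemma czForm_oddSheet (b : Bits (Data d)) : czForm (oddSheet b : Bits (Qubit d L)) = 0 := by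
  refine czForm_eq_zero fun u v huv => ?_
  by_cases hu : IsData u.1.1 u.1.2.1
  · by_cases hv : IsData v.1.1 v.1.2.1
    · obtain ⟨q, hq⟩ := exists_dataAt hu
      obtain ⟨q', hq'⟩ := exists_dataAt hv
      rw [hq, hq', oddSheet_dataAt, oddSheet_dataAt]
      simp only [IsData, Near, Qubit.pos, Nat.even_iff] at hu hv huv
      simp only [Nat.odd_iff]
      split_ifs <;> first | (exfalso; omega) | simp
    · rw [oddSheet_check _ _ hv, mul_zero]
  · rw [oddSheet_check _ _ hu, zero_mul]

lemma czForm_evenSheet (b : Bits (Data d)) : czForm (evenSheet b : Bits (Qubit d L)) = 0 := by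
  refine czForm_eq_zero fun u v huv => ?_
  by_cases hu : IsData u.1.1 u.1.2.1
  · by_cases hv : IsData v.1.1 v.1.2.1
    · obtain ⟨q, hq⟩ := exists_dataAt hu
      obtain ⟨q', hq'⟩ := exists_dataAt hv
      rw [hq, hq', evenSheet_dataAt, evenSheet_dataAt]
      simp only [IsData, Near, Qubit.pos, Nat.even_iff] at hu hv huv
      simp only [Nat.even_iff]
      split_ifs <;> first | (exfalso; omega) | simp
    · rw [evenSheet_check _ _ hv, mul_zero]
  · rw [evenSheet_check _ _ hu, zero_mul]

/-! ### Cells -/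

/-- Indicator of the qubits at unit distance from the centre of a cell. -/
def cellBits (a : Cell d L) : Bits (Qubit d L) := fun v => if Near a.pos v.pos then 1 else 0

lemma cellParity_eq (f : Bits (Qubit d L)) (a : Cell d L) : cellParity f a = f ⬝ᵥ cellBits a := by
  simp [cellParity, cellBits, dotProduct]

lemma cellParity_add (f g : Bits (Qubit d L)) (a : Cell d L) :
    cellParity (f + g) a = cellParity f a + cellParity g a := by
  simp only [cellParity_eq, add_dotProduct]

/-- Positions occupied by a cluster qubit. -/
def IsQubitPos (d L : ℕ) (p : ℕ × ℕ × ℕ) : Prop :=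
  p.1 < 2 * d - 1 ∧ p.2.1 < 2 * d - 1 ∧ p.2.2 < 2 * L + 1 ∧ IsClusterQubit p.1 p.2.1 p.2.2

instance (p : ℕ × ℕ × ℕ) : Decidable (IsQubitPos d L p) := by unfold IsQubitPos; infer_instance

lemma Qubit.pos_injective : Function.Injective (Qubit.pos : Qubit d L → ℕ × ℕ × ℕ) := by
  rintro ⟨⟨a, b, c⟩, h⟩ ⟨⟨a', b', c'⟩, h'⟩ hp
  simp only [Qubit.pos, Prod.mk.injEq] at hp
  simp only [Subtype.mk.injEq, Prod.mk.injEq, Fin.ext_iff]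
  exact hp

lemma exists_pos_eq_iff (p : ℕ × ℕ × ℕ) : (∃ v : Qubit d L, v.pos = p) ↔ IsQubitPos d L p := by
  constructor
  · rintro ⟨v, rfl⟩
    exact ⟨v.1.1.2, v.1.2.1.2, v.1.2.2.2, v.2⟩
  · rintro ⟨h1, h2, h3, h⟩
    exact ⟨⟨(⟨_, h1⟩, ⟨_, h2⟩, ⟨_, h3⟩), h⟩, rfl⟩

lemma sum_pos_eq (p : ℕ × ℕ × ℕ) :
    ∑ v : Qubit d L, (if v.pos = p then 1 else 0 : ZMod 2) = if IsQubitPos d L p then 1 else 0 := by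
  split_ifs with h
  · obtain ⟨v₀, rfl⟩ := (exists_pos_eq_iff p).2 h
    simp [Qubit.pos_injective.eq_iff]
  · refine Finset.sum_eq_zero fun v _ => if_neg fun hv => h ((exists_pos_eq_iff p).1 ⟨v, hv⟩)

lemma atSlice_cellBits (a : Cell d L) (t : Fin (2 * L + 1)) :
    atSlice t (cellBits a) = if (a.1.2.2 : ℕ) = t then support a.check else 0 := by
  ext q
  obtain ⟨⟨⟨i, hi⟩, ⟨j, hj⟩, ⟨τ, hτ⟩⟩, ha⟩ := a
  obtain ⟨⟨⟨x, hx⟩, ⟨y, hy⟩⟩, hq⟩ := q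
  obtain ⟨t, ht⟩ := t
  simp only [IsData, IsXCheck, IsZCheck, Nat.even_iff, Nat.odd_iff] at hq ha
  by_cases h : τ = t
  · simp only [atSlice, cellBits, Cell.pos, Qubit.pos, dataAt, Cell.check, support, near_iff,
      if_pos h]
    congr 1
    rw [eq_iff_iff]
    lia
  · simp only [atSlice, cellBits, Cell.pos, Qubit.pos, dataAt, near_iff, if_neg h]
    rw [Pi.zero_apply, if_neg]
    lia

lemma czForm_cellBits (a : Cell d L) : czForm (cellBits a) = 0 := by
  refine czForm_eq_zero fun u v huv => ?_
  simp only [cellBits, Near] at huv ⊢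
  split_ifs <;> first | (exfalso; omega) | simp

lemma nbr_cellBits (a : Cell d L) : nbr (cellBits a) =
    liftSlice 0 (if (a.1.2.2 : ℕ) = 1 then support a.check else 0) +
      liftSlice (Fin.last (2 * L))
        (if (a.1.2.2 : ℕ) = 2 * L + 1 then support a.check else 0) := by
  ext u
  by_cases hu : IsData u.1.1 u.1.2.1
  · obtain ⟨q, hq⟩ := exists_dataAt hu
    generalize u.1.2.2 = t at hq
    subst hq
    rw [Pi.add_apply, liftSlice_dataAt, liftSlice_dataAt]
    obtain ⟨⟨⟨i, hi⟩, ⟨j, hj⟩, ⟨τ, hτ⟩⟩, ha⟩ := a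
    obtain ⟨⟨⟨x, hx⟩, ⟨y, hy⟩⟩, hq⟩ := q
    obtain ⟨t, ht⟩ := t
    have key : ∀ v : Qubit d L,
        (if Near (dataAt ⟨t, ht⟩ ⟨(⟨x, hx⟩, ⟨y, hy⟩), hq⟩ : Qubit d L).pos v.pos then
          cellBits ⟨(⟨i, hi⟩, ⟨j, hj⟩, ⟨τ, hτ⟩), ha⟩ v else 0) =
        if Near (i, j, 0) (x, y, 0) ∧ ((t : ℤ) - τ).natAbs = 1 then
          (if v.pos = (x, y, τ) then 1 else 0) + (if v.pos = (i, j, t) then 1 else 0) else 0 := by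
      rintro ⟨⟨⟨v1, hv1⟩, ⟨v2, hv2⟩, ⟨v3, hv3⟩⟩, hv⟩
      simp only [cellBits, Cell.pos, Qubit.pos, dataAt, near_iff, Prod.mk.injEq]
      simp only [IsClusterQubit, IsData, IsXCheck, IsZCheck, Nat.even_iff, Nat.odd_iff] at hq ha hv
      split_ifs <;> first | rfl | (exfalso; lia)
    rw [nbr, Finset.sum_congr rfl fun v _ => key v]
    simp only [IsData, IsXCheck, IsZCheck, Nat.even_iff, Nat.odd_iff] at hq ha
    by_cases hs : Near (i, j, 0) (x, y, 0)
    · have hs' : support (Cell.check ⟨(⟨i, hi⟩, ⟨j, hj⟩, ⟨τ, hτ⟩), by assumption⟩ : Check d)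
          ⟨(⟨x, hx⟩, ⟨y, hy⟩), by assumption⟩ = 1 := if_pos hs
      simp only [ite_apply, Pi.zero_apply, hs', Fin.ext_iff, Fin.val_zero,
        Fin.val_last]
      by_cases ht : ((t : ℤ) - τ).natAbs = 1
      · rw [Finset.sum_congr rfl fun v _ => if_pos (And.intro hs ht), Finset.sum_add_distrib,
          sum_pos_eq, sum_pos_eq]
        have h1 : IsQubitPos d L (x, y, τ) ↔ τ < 2 * L + 1 := by
          simp only [IsQubitPos, IsClusterQubit, IsData, Nat.even_iff]; lia
        have h2 : IsQubitPos d L (i, j, t) ↔ 0 < t ∨ τ ≠ 1 := by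
          simp only [IsQubitPos, IsClusterQubit, IsData, IsXCheck, IsZCheck, Nat.even_iff,
            Nat.odd_iff]
          rcases ha with ha | ha <;> lia
        simp only [h1, h2]
        split_ifs <;> first | rfl | (exfalso; lia)
      · rw [Finset.sum_congr rfl fun v _ => if_neg (fun h => ht h.2), Finset.sum_const_zero]
        split_ifs <;> first | rfl | (exfalso; lia)
    · have hs' : support (Cell.check ⟨(⟨i, hi⟩, ⟨j, hj⟩, ⟨τ, hτ⟩), by assumption⟩ : Check d)
          ⟨(⟨x, hx⟩, ⟨y, hy⟩), by assumption⟩ = 0 := if_neg hs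
      simp [hs, ite_apply, hs']
  · have hz : ∀ t b, liftSlice t b u = 0 := fun t b => dif_neg fun h => hu h.1
    rw [Pi.add_apply, hz, hz, add_zero]
    by_cases hτ : (u.1.2.2 : ℕ) = a.1.2.2
    · have h1 : ∀ v : Qubit d L, (if Near u.pos v.pos then cellBits a v else 0) =
          if Near u.pos v.pos then liftSlice u.1.2.2 (support a.check) v else 0 := by
        intro v
        split_ifs with hv
        · have hd : IsData v.1.1 v.1.2.1 := by
            have := u.2
            have := v.2
            simp only [near_iff, Qubit.pos] at hv
            simp only [IsClusterQubit, IsData, IsXCheck, IsZCheck, Nat.even_iff,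
              Nat.odd_iff] at *
            lia
          obtain ⟨q, hq⟩ := exists_dataAt hd
          have h2 := congrFun (atSlice_cellBits a v.1.2.2) q
          rw [atSlice, ← hq] at h2
          rw [h2]
          conv_rhs => rw [hq, liftSlice_dataAt]
          rw [← hτ]
          simp only [Fin.val_inj, eq_comm (a := u.1.2.2)]
          split_ifs <;> rfl
        · rfl
      rw [nbr, Finset.sum_congr rfl fun v _ => h1 v, ← nbr, nbr_liftSlice_check _ _ _ hu,
        if_pos rfl]
      have h3 : IsXCheck u.1.1 u.1.2.1 ↔ ¬ IsXCheck a.1.1 a.1.2.1 := by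
        have := u.2
        have := a.2
        simp only [IsClusterQubit, IsData, IsXCheck, IsZCheck, Nat.even_iff, Nat.odd_iff] at *
        lia
      by_cases hx : IsXCheck u.1.1 u.1.2.1
      · exact support_dotProduct_support hx (h3.1 hx)
      · rw [dotProduct_comm]
        exact support_dotProduct_support (not_not.1 (mt h3.2 hx)) hx
    · refine Finset.sum_eq_zero fun v _ => ?_
      have := u.2
      have := a.2
      have := v.2
      simp only [cellBits, near_iff, Cell.pos, Qubit.pos]
      simp only [IsClusterQubit, IsData, IsXCheck, IsZCheck, Nat.even_iff, Nat.odd_iff] at *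
      split_ifs <;> first | rfl | (exfalso; lia)

end Geometry

/-! ### Coherent faults act incoherently -/

section Decoherence

variable {d L : ℕ}

/-- Pauli frame update after the final stabilizer measurement. -/
def frameOp (o : Measured d L → ZMod 2) (σ : Check d → ZMod 2) : Op (Data d) :=
  pauliZ (zPart (extend o)) * pauliX (xPart (extend o)) * syndromeProjector σ

lemma kraus_pauliCircuit (e : Noisy d L → ZMod 2) (o : Measured d L → ZMod 2)
    (σ : Check d → ZMod 2) : kraus (pauliCircuit e) o σ = frameOp o σ * clusterOp o e := by
  simp only [kraus, frameOp, clusterOp, Matrix.mul_assoc]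

lemma xPart_add (f g : Bits (Qubit d L)) : xPart (f + g) = xPart f + xPart g := by
  ext q
  simp only [xPart, Pi.add_apply, ← Finset.sum_add_distrib]
  refine Finset.sum_congr rfl fun t _ => ?_
  split_ifs <;> simp

lemma zPart_add (f g : Bits (Qubit d L)) : zPart (f + g) = zPart f + zPart g := by
  ext q
  simp only [zPart, Pi.add_apply, ← Finset.sum_add_distrib]
  refine Finset.sum_congr rfl fun t _ => ?_
  split_ifs <;> simp

lemma xPart_liftSlice_last (b : Bits (Data d)) :
    xPart (liftSlice (Fin.last (2 * L)) b : Bits (Qubit d L)) = 0 := by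
  ext q
  refine Finset.sum_eq_zero fun t _ => ?_
  rw [liftSlice_dataAt]
  split_ifs with h1 h2
  · subst h2; exact absurd h1 (by simp)
  · rfl
  · rfl

lemma zPart_liftSlice_last (b : Bits (Data d)) :
    zPart (liftSlice (Fin.last (2 * L)) b : Bits (Qubit d L)) = b := by
  ext q
  rw [zPart, Finset.sum_eq_single (Fin.last (2 * L))]
  · simp
  · intro t _ h; simp [h]
  · simp

lemma dotProduct_single_apply {ι : Type} [Fintype ι] [DecidableEq ι] (f : Bits ι) (i : ι) :
    f ⬝ᵥ Pi.single i 1 = f i := by simp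

lemma xPart_nbr_single (v : Qubit d L) (q : Data d) :
    xPart (nbr (Pi.single v 1)) q = nbr (oddSheet (Pi.single q 1)) v := by
  rw [← dotProduct_single_apply (xPart _), ← dotProduct_oddSheet, nbr_dotProduct,
    dotProduct_comm, dotProduct_single_apply]

lemma zPart_nbr_single (v : Qubit d L) (q : Data d) :
    zPart (nbr (Pi.single v 1)) q = nbr (evenSheet (Pi.single q 1)) v := by
  rw [← dotProduct_single_apply (zPart _), ← dotProduct_evenSheet, nbr_dotProduct,
    dotProduct_comm, dotProduct_single_apply]

/-- The neighbourhood of a noisy qubit changes the Pauli frame by at most a stabilizer, up to the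
error that it puts on the output block. -/
lemma frame_nbr_single (v : Noisy d L) :
    (xPart (nbr (Pi.single v.1 1)) = atSlice (Fin.last (2 * L)) (Pi.single v.1 1) ∧
      zPart (nbr (Pi.single v.1 1)) = 0) ∨
    ∃ c : Check d, pauliZ (zPart (nbr (Pi.single v.1 1))) *
      pauliX (xPart (nbr (Pi.single v.1 1)) + atSlice (Fin.last (2 * L)) (Pi.single v.1 1)) =
        stabilizer c := by
  obtain ⟨v, hv⟩ := v
  dsimp only
  by_cases hd : IsData v.1.1 v.1.2.1
  · left
    obtain ⟨q₀, hq₀⟩ := exists_dataAt hd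
    generalize v.1.2.2 = t at hq₀ hv
    subst hq₀
    have ht : t ≠ 0 := by rintro rfl; simp at hv
    constructor
    · ext q
      rw [xPart_nbr_single, nbr_oddSheet_dataAt, if_neg ht, zero_add, atSlice, Pi.single_apply,
        Pi.single_apply]
      simp only [dataAt_inj]
      by_cases h : t = Fin.last (2 * L)
      · simp [h, eq_comm]
      · simp [h, eq_comm]
    · ext q
      rw [zPart_nbr_single, nbr_evenSheet_dataAt]; rfl
  · right
    have hout : atSlice (Fin.last (2 * L)) (Pi.single v 1) = 0 := by
      ext q
      rw [atSlice, Pi.single_apply, if_neg]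
      · rfl
      · rintro rfl; exact hd q.2
    refine ⟨checkSite v hd, ?_⟩
    have hX : xPart (nbr (Pi.single v 1)) =
        if IsXCheck v.1.1 v.1.2.1 then support (checkSite v hd) else 0 := by
      ext q
      rw [xPart_nbr_single, nbr_oddSheet_check _ _ hd, dotProduct_single_apply, ite_apply]; rfl
    have hZ : zPart (nbr (Pi.single v 1)) =
        if IsXCheck v.1.1 v.1.2.1 then 0 else support (checkSite v hd) := by
      ext q
      rw [zPart_nbr_single, nbr_evenSheet_check _ _ hd, dotProduct_single_apply, ite_apply]; rfl
    rw [hout, hX, hZ, add_zero]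
    unfold stabilizer
    by_cases h : IsXCheck v.1.1 v.1.2.1
    · rw [if_pos h, if_pos h, pauliZ_zero, one_mul]
      exact (if_pos h).symm
    · rw [if_neg h, if_neg h, pauliX_zero, mul_one]
      exact (if_neg h).symm

/-- Change of the final outcomes under the graph state stabilizer of a qubit. -/
def finalFlip (v : Qubit d L) : Check d → ZMod 2 :=
  anticommBit (atSlice (Fin.last (2 * L)) (Pi.single v 1))
    (atSlice (Fin.last (2 * L)) (nbr (Pi.single v 1)))

lemma measuredSyndrome_flip (v : Noisy d L) (o : Measured d L → ZMod 2) (σ : Check d → ZMod 2) :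
    measuredSyndrome (o + onMeasured (nbr (Pi.single v.1 1))) (σ + finalFlip v.1) =
      measuredSyndrome o σ := by
  ext a
  have h1 : cellParity (nbr (Pi.single v.1 1)) a =
      if (a.1.2.2 : ℕ) = 2 * L + 1 then
        support a.check ⬝ᵥ atSlice (Fin.last (2 * L)) (Pi.single v.1 1) else 0 := by
    rw [cellParity_eq, nbr_dotProduct, nbr_cellBits, dotProduct_comm, add_dotProduct,
      liftSlice_dotProduct, liftSlice_dotProduct]
    have h0 : atSlice 0 (Pi.single v.1 1 : Bits (Qubit d L)) = 0 := by
      ext q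
      rw [atSlice, Pi.single_apply, if_neg]
      · rfl
      · intro h
        have hv := v.2
        rw [← h] at hv
        simp [dataAt] at hv
    rw [h0, dotProduct_zero, zero_add]
    split_ifs <;> simp
  have h2 : ∀ b, cellParity (liftSlice (Fin.last (2 * L)) b : Bits (Qubit d L)) a =
      if (a.1.2.2 : ℕ) = 2 * L then support a.check ⬝ᵥ b else 0 := by
    intro b
    rw [cellParity_eq, liftSlice_dotProduct, atSlice_cellBits, dotProduct_comm]
    simp only [Fin.val_last]
    split_ifs <;> simp
  simp only [measuredSyndrome]
  rw [extend_add, cellParity_add, extend_onMeasured, cellParity_add, h1, h2]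
  have ha := a.2
  have hτ := a.1.2.2.2
  by_cases hX : IsXCheck a.1.1 a.1.2.1
  · have hf : finalFlip v.1 a.check = support a.check ⬝ᵥ
        (atSlice (Fin.last (2 * L)) (nbr (Pi.single v.1 1))) := if_pos hX
    simp only [IsXCheck, IsZCheck, Nat.even_iff, Nat.odd_iff] at ha hX
    have h3 : ¬ (a.1.2.2 : ℕ) = 2 * L + 1 := by lia
    rw [if_neg h3, zero_add, Pi.add_apply, hf]
    by_cases h4 : (a.1.2.2 : ℕ) = 2 * L
    · rw [if_pos h4, if_pos h4.ge, if_pos h4.ge]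
      linear_combination CharTwo.add_self_eq_zero (support a.check ⬝ᵥ
        (atSlice (Fin.last (2 * L)) (nbr (Pi.single v.1 1))))
    · have h5 : ¬ 2 * L ≤ (a.1.2.2 : ℕ) := by lia
      rw [if_neg h4, if_neg h5, if_neg h5, add_zero, add_zero]
  · have hf : finalFlip v.1 a.check = support a.check ⬝ᵥ
        (atSlice (Fin.last (2 * L)) (Pi.single v.1 1)) := if_neg hX
    simp only [IsXCheck, IsZCheck, Nat.even_iff, Nat.odd_iff] at ha hX
    have h3 : ¬ (a.1.2.2 : ℕ) = 2 * L := by lia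
    rw [if_neg h3, add_zero, Pi.add_apply, hf]
    by_cases h4 : (a.1.2.2 : ℕ) = 2 * L + 1
    · have h5 : 2 * L ≤ (a.1.2.2 : ℕ) := by lia
      rw [if_pos h4, if_pos h5, if_pos h5]
      linear_combination CharTwo.add_self_eq_zero (support a.check ⬝ᵥ
        (atSlice (Fin.last (2 * L)) (Pi.single v.1 1)))
    · have h5 : ¬ 2 * L ≤ (a.1.2.2 : ℕ) := by lia
      rw [if_neg h4, if_neg h5, if_neg h5, add_zero, add_zero]

lemma pauli_mul_of_absorbs {ι κ : Type} [Fintype ι] [DecidableEq ι] (z x : Bits ι) {z' x' : Bits ι}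
    {M : Matrix (Bits ι) κ ℂ} {b : ZMod 2} (h : pauliZ z' * pauliX x' * M = sgn b • M) :
    pauliZ (z + z') * pauliX (x + x') * M =
      sgn (z' ⬝ᵥ x + b) • (pauliZ z * pauliX x * M) := by
  have h1 : pauliZ (z + z') * pauliX (x + x') =
      sgn (z' ⬝ᵥ x) • (pauliZ z * pauliX x * (pauliZ z' * pauliX x')) := by
    rw [pauliX_add, pauliZ_add, mul_assoc, ← mul_assoc (pauliZ z'), pauliZ_mul_pauliX,
      Matrix.smul_mul, Matrix.mul_smul]
    simp only [mul_assoc]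
  rw [h1, Matrix.smul_mul, Matrix.mul_assoc, h, Matrix.mul_smul, smul_smul, sgn_add]

lemma frameOp_flip (v : Noisy d L) (o : Measured d L → ZMod 2) (σ : Check d → ZMod 2) :
    ∃ b : ZMod 2, frameOp o σ * (pauliX (atSlice (Fin.last (2 * L)) (Pi.single v.1 1)) *
        pauliZ (atSlice (Fin.last (2 * L)) (nbr (Pi.single v.1 1)))) =
      sgn b • frameOp (o + onMeasured (nbr (Pi.single v.1 1))) (σ + finalFlip v.1) := by
  set g : Bits (Qubit d L) := Pi.single v.1 1 with hg
  set p := atSlice (Fin.last (2 * L)) g with hp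
  set r := atSlice (Fin.last (2 * L)) (nbr g) with hr
  have hx : xPart (extend (o + onMeasured (nbr g))) =
      (xPart (extend o) + p) + (xPart (nbr g) + p) := by
    rw [extend_add, extend_onMeasured, xPart_add, xPart_add, xPart_liftSlice_last, add_zero,
      add_add_add_comm, add_comm (xPart (extend o)), add_comm p p, bits_add_self, add_zero,
      add_comm]
  have hz : zPart (extend (o + onMeasured (nbr g))) = (zPart (extend o) + r) + zPart (nbr g) := by
    rw [extend_add, extend_onMeasured, zPart_add, zPart_add, zPart_liftSlice_last]
    abel
  obtain ⟨b, hb⟩ : ∃ b : ZMod 2, pauliZ (zPart (nbr g)) * pauliX (xPart (nbr g) + p) *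
      syndromeProjector (σ + finalFlip v.1) = sgn b • syndromeProjector (σ + finalFlip v.1) := by
    rcases frame_nbr_single v with ⟨h1, h2⟩ | ⟨c, hc⟩
    · refine ⟨0, ?_⟩
      rw [h1, h2, bits_add_self, pauliX_zero, pauliZ_zero]; simp
    · exact ⟨_, by rw [hc, stabilizer_mul_syndromeProjector]⟩
  have hL : frameOp o σ * (pauliX p * pauliZ r) = sgn (r ⬝ᵥ (xPart (extend o) + p)) •
      (pauliZ (zPart (extend o) + r) * pauliX (xPart (extend o) + p) *
        syndromeProjector (σ + finalFlip v.1)) := by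
    rw [frameOp, mul_assoc, syndromeProjector_mul_pauli, ← mul_assoc, ← mul_assoc,
      mul_assoc (pauliZ _), ← pauliX_add, mul_assoc (pauliZ _), pauliX_mul_pauliZ,
      Matrix.mul_smul, Matrix.smul_mul, ← mul_assoc, ← pauliZ_add, finalFlip]
  have hR : frameOp (o + onMeasured (nbr g)) (σ + finalFlip v.1) =
      sgn (zPart (nbr g) ⬝ᵥ (xPart (extend o) + p) + b) •
      (pauliZ (zPart (extend o) + r) * pauliX (xPart (extend o) + p) *
        syndromeProjector (σ + finalFlip v.1)) := by
    rw [frameOp, hx, hz]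
    exact pauli_mul_of_absorbs _ _ hb
  refine ⟨r ⬝ᵥ (xPart (extend o) + p) + (zPart (nbr g) ⬝ᵥ (xPart (extend o) + p) + b), ?_⟩
  rw [hL, hR, smul_smul, ← sgn_add, add_assoc, CharTwo.add_self_eq_zero, add_zero]

/-- The stabilizer of a noisy qubit relates the Kraus operators of two measurement records with the
same cluster state stabilizer values, up to a sign that detects a fault of the qubit. -/
lemma kraus_flip (v : Noisy d L) (o : Measured d L → ZMod 2) (σ : Check d → ZMod 2) :
    ∃ b : ZMod 2, ∀ e : Noisy d L → ZMod 2, kraus (pauliCircuit e) o σ = sgn (b + e v) •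
      kraus (pauliCircuit e) (o + onMeasured (nbr (Pi.single v.1 1))) (σ + finalFlip v.1) := by
  obtain ⟨b, hb⟩ := frameOp_flip v o σ
  refine ⟨b + (czForm (Pi.single v.1 1 : Bits (Qubit d L)) + extend o v.1), fun e => ?_⟩
  have h0 : atSlice 0 (Pi.single v.1 1 : Bits (Qubit d L)) = 0 := by
    ext q
    rw [atSlice, Pi.single_apply, if_neg]
    · rfl
    · intro h
      have hv := v.2
      rw [← h] at hv
      simp [dataAt] at hv
  have h := clusterOp_mul_pauliX o e (Pi.single v.1 1)
  rw [h0, pauliX_zero, mul_one, dotProduct_single_apply] at h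
  have he : extend e v.1 = e v := dif_pos v.2
  rw [kraus_pauliCircuit, h, Matrix.mul_smul, ← mul_assoc, hb, Matrix.smul_mul, smul_smul,
    ← sgn_add, kraus_pauliCircuit, Pi.add_apply, he]
  congr 2
  ring

/-- Contribution of a pair of fault patterns to the output conditioned on `s`. -/
def crossTerm (s : Syndrome d L) (ρ : Op (Data d)) (e e' : Noisy d L → ZMod 2) : Op (Data d) :=
  ∑ o : Measured d L → ZMod 2, ∑ σ : Check d → ZMod 2,
    if measuredSyndrome o σ = s then
      kraus (pauliCircuit e) o σ * ρ * (kraus (pauliCircuit e') o σ)ᴴ else 0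

lemma crossTerm_eq_zero (s : Syndrome d L) (ρ : Op (Data d)) {e e' : Noisy d L → ZMod 2}
    (h : e ≠ e') : crossTerm s ρ e e' = 0 := by
  obtain ⟨v, hv⟩ := Function.ne_iff.1 h
  have key : crossTerm s ρ e e' = sgn (e v + e' v) • crossTerm s ρ e e' := by
    conv_rhs =>
      rw [crossTerm, ← Equiv.sum_comp (Equiv.addRight (onMeasured (nbr (Pi.single v.1 1))))]
      enter [2, 2, o]
      rw [← Equiv.sum_comp (Equiv.addRight (finalFlip v.1))]
    rw [crossTerm, Finset.smul_sum]
    refine Finset.sum_congr rfl fun o _ => ?_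
    rw [Finset.smul_sum]
    refine Finset.sum_congr rfl fun σ _ => ?_
    simp only [Equiv.coe_addRight, measuredSyndrome_flip]
    split_ifs
    · obtain ⟨b, hb⟩ := kraus_flip v o σ
      rw [hb e, hb e', Matrix.conjTranspose_smul, star_sgn, Matrix.mul_smul, Matrix.smul_mul,
        Matrix.smul_mul, smul_smul, ← sgn_add]
      congr 2
      linear_combination CharTwo.add_self_eq_zero b
    · simp
  have h1 : e v + e' v = 1 := zmod_two_add_eq_one hv
  rw [h1, sgn_one, neg_one_smul] at key
  ext i j
  exact self_eq_neg.1 (congrFun₂ key i j)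

/-- Amplitude of a fault pattern in the expansion of the coherent noise. -/
def amplitude (θ : ℝ) (e : Noisy d L → ZMod 2) : ℂ :=
  ∏ v, if e v = 1 then Complex.I * Complex.sin (5 * θ) else Complex.cos (5 * θ)

lemma exp_sgn (φ : ℂ) (x : ZMod 2) :
    Complex.exp (φ * Complex.I * sgn x) = Complex.cos φ + Complex.I * Complex.sin φ * sgn x := by
  rcases zmod_two_cases x with rfl | rfl
  · rw [sgn_zero, mul_one, Complex.exp_mul_I]; ring
  · rw [sgn_one, mul_neg_one, ← neg_mul, Complex.exp_mul_I, Complex.cos_neg, Complex.sin_neg]; ring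

lemma prod_exp_eq_sum (θ : ℝ) (x : Bits (Qubit d L)) :
    ∏ v : Noisy d L, Complex.exp (Complex.I * θ * sgn (x v.1)) ^ 5 =
      ∑ e : Noisy d L → ZMod 2, amplitude θ e * sgn (extend e ⬝ᵥ x) := by
  have h1 : ∀ v : Noisy d L, Complex.exp (Complex.I * θ * sgn (x v.1)) ^ 5 =
      ∑ b : ZMod 2, (if b = 1 then Complex.I * Complex.sin (5 * θ) else Complex.cos (5 * θ)) *
        sgn (b * x v.1) := by
    intro v
    have h2 : ∀ f : ZMod 2 → ℂ, ∑ b, f b = f 0 + f 1 := fun f => Fin.sum_univ_two f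
    rw [← Complex.exp_nat_mul, h2]
    have : ((5 : ℕ) : ℂ) * (Complex.I * θ * sgn (x v.1)) =
        (5 * θ) * Complex.I * sgn (x v.1) := by push_cast; ring
    rw [this, exp_sgn]
    simp
  rw [Finset.prod_congr rfl fun v _ => h1 v, Finset.prod_univ_sum, Fintype.piFinset_univ]
  refine Finset.sum_congr rfl fun e _ => ?_
  rw [Finset.prod_mul_distrib, amplitude, ← sgn_sum]
  congr 2
  simp only [dotProduct]
  rw [← Fintype.sum_subtype_add_sum_subtype (fun v : Qubit d L => 0 < (v.1.2.2 : ℕ))]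
  have h : ∑ v : {v : Qubit d L // ¬ 0 < (v.1.2.2 : ℕ)}, extend e v.1 * x v.1 = 0 := by
    refine Finset.sum_eq_zero fun v _ => ?_
    rw [extend, dif_neg v.2, zero_mul]
  rw [h, add_zero]
  refine Finset.sum_congr rfl fun v _ => ?_
  rw [extend, dif_pos v.2]

lemma coherentCircuit_eq_sum (θ : ℝ) : coherentCircuit d L θ =
    ∑ e : Noisy d L → ZMod 2, amplitude θ e • pauliCircuit e := by
  have h1 : coherentCircuit d L θ = Matrix.diagonal (fun x =>
      ∏ v : Noisy d L, Complex.exp (Complex.I * θ * sgn (x v.1)) ^ 5) * czCircuit d L := by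
    rw [coherentCircuit, ← czSteps_eq]
    simp only [zRotations, czStep, Matrix.diagonal_mul_diagonal]
    congr 1; ext x
    rw [Finset.prod_pow]
    ring
  rw [h1]
  simp only [pauliCircuit_eq, ← Matrix.smul_mul, ← Finset.sum_mul]
  congr 1
  ext y x
  rw [Matrix.sum_apply]
  simp only [Matrix.smul_apply, pauliZ_eq, Matrix.diagonal_apply]
  split_ifs
  · simp only [prod_exp_eq_sum, smul_eq_mul]
  · simp

lemma amplitude_mul_star (θ : ℝ) (e : Noisy d L → ZMod 2) : amplitude θ e * star (amplitude θ e) =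
    ((∏ v, if e v = 1 then Real.sin (5 * θ) ^ 2 else 1 - Real.sin (5 * θ) ^ 2 : ℝ) : ℂ) := by
  rw [amplitude, star_prod, ← Finset.prod_mul_distrib, Complex.ofReal_prod]
  refine Finset.prod_congr rfl fun v _ => ?_
  have hs : Complex.sin (5 * θ) = ((Real.sin (5 * θ) : ℝ) : ℂ) := by push_cast; rfl
  have hc : Complex.cos (5 * θ) = ((Real.cos (5 * θ) : ℝ) : ℂ) := by push_cast; rfl
  rw [hs, hc]
  split_ifs
  · simp only [star_mul', Complex.star_def, Complex.conj_I, Complex.conj_ofReal]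
    push_cast
    linear_combination (-(Complex.sin (5 * θ)) ^ 2) * Complex.I_mul_I
  · rw [Complex.star_def, Complex.conj_ofReal, ← Real.cos_sq']
    push_cast
    ring

theorem coherentInstrument_eq_pauliInstrument (θ : ℝ) (s : Syndrome d L) (ρ : Op (Data d)) :
    coherentInstrument θ s ρ = pauliInstrument (Real.sin (5 * θ) ^ 2) s ρ := by
  have hk : ∀ (o : Measured d L → ZMod 2) (σ : Check d → ZMod 2),
      kraus (coherentCircuit d L θ) o σ =
        ∑ e : Noisy d L → ZMod 2, amplitude θ e • kraus (pauliCircuit e) o σ := by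
    intro o σ
    simp only [kraus, coherentCircuit_eq_sum, Matrix.mul_sum, Matrix.sum_mul, Matrix.mul_smul,
      Matrix.smul_mul]
  have h1 : coherentInstrument θ s ρ = ∑ e : Noisy d L → ZMod 2, ∑ e' : Noisy d L → ZMod 2,
      (amplitude θ e * star (amplitude θ e')) • crossTerm s ρ e e' := by
    simp only [crossTerm, Finset.smul_sum]
    rw [Finset.sum_congr rfl fun e _ => Finset.sum_comm]
    rw [Finset.sum_comm, coherentInstrument, instrument]
    refine Finset.sum_congr rfl fun o _ => ?_
    rw [Finset.sum_congr rfl fun e _ => Finset.sum_comm]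
    rw [Finset.sum_comm]
    refine Finset.sum_congr rfl fun σ _ => ?_
    split_ifs
    · rw [hk, Matrix.conjTranspose_sum, Matrix.sum_mul, Matrix.sum_mul]
      refine Finset.sum_congr rfl fun e _ => ?_
      rw [Matrix.mul_sum]
      refine Finset.sum_congr rfl fun e' _ => ?_
      rw [Matrix.conjTranspose_smul, Matrix.mul_smul, Matrix.smul_mul, Matrix.smul_mul, smul_smul,
        mul_comm]
    · simp
  rw [h1, pauliInstrument]
  refine Finset.sum_congr rfl fun e _ => ?_
  rw [Finset.sum_eq_single e, amplitude_mul_star]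
  · rfl
  · intro e' _ h
    rw [crossTerm_eq_zero s ρ h.symm, smul_zero]
  · simp

end Decoherence

/-! ### Action of the protocol on code states -/

section CodeSpace

variable {d L : ℕ}

/-- `X^a` commutes with all stabilizers. -/
def CommutesX (a : Bits (Data d)) : Prop :=
  ∀ c : Check d, ¬ IsXCheck c.1.1 c.1.2 → support c ⬝ᵥ a = 0

/-- `Z^b` commutes with all stabilizers. -/
def CommutesZ (b : Bits (Data d)) : Prop :=
  ∀ c : Check d, IsXCheck c.1.1 c.1.2 → support c ⬝ᵥ b = 0

lemma CommutesX.syndromeProjector_comm {a : Bits (Data d)} (ha : CommutesX a)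
    (σ : Check d → ZMod 2) :
    syndromeProjector σ * pauliX a = pauliX a * syndromeProjector σ := by
  have h := syndromeProjector_mul_pauli σ a 0
  have h0 : anticommBit a 0 = 0 := by
    ext c
    unfold anticommBit
    split_ifs with hc
    · simp
    · exact ha c hc
  rwa [h0, add_zero, pauliZ_zero, mul_one] at h

lemma CommutesZ.syndromeProjector_comm {b : Bits (Data d)} (hb : CommutesZ b)
    (σ : Check d → ZMod 2) :
    syndromeProjector σ * pauliZ b = pauliZ b * syndromeProjector σ := by
  have h := syndromeProjector_mul_pauli σ 0 b
  have h0 : anticommBit 0 b = 0 := by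
    ext c
    unfold anticommBit
    split_ifs with hc
    · exact hb c hc
    · simp
  rwa [h0, add_zero, pauliX_zero, one_mul] at h

lemma CommutesX.frameOp_comm {a : Bits (Data d)} (ha : CommutesX a) (o : Measured d L → ZMod 2)
    (σ : Check d → ZMod 2) :
    frameOp o σ * pauliX a = sgn (zPart (extend o) ⬝ᵥ a) • (pauliX a * frameOp o σ) := by
  rw [frameOp, mul_assoc, ha.syndromeProjector_comm, ← mul_assoc, mul_assoc (pauliZ _),
    pauliX_comm, ← mul_assoc, pauliZ_mul_pauliX, Matrix.smul_mul, Matrix.smul_mul]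
  simp only [mul_assoc]

lemma CommutesZ.frameOp_comm {b : Bits (Data d)} (hb : CommutesZ b) (o : Measured d L → ZMod 2)
    (σ : Check d → ZMod 2) :
    frameOp o σ * pauliZ b = sgn (xPart (extend o) ⬝ᵥ b) • (pauliZ b * frameOp o σ) := by
  rw [frameOp, mul_assoc, hb.syndromeProjector_comm, ← mul_assoc, mul_assoc (pauliZ _),
    pauliX_mul_pauliZ, Matrix.mul_smul, Matrix.smul_mul, ← mul_assoc, pauliZ_comm,
    dotProduct_comm]
  simp only [mul_assoc]

/-- A logical `X` operator passes through the protocol, up to the sign of the residual error. -/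
lemma CommutesX.kraus_comm {a : Bits (Data d)} (ha : CommutesX a) (e : Noisy d L → ZMod 2)
    (o : Measured d L → ZMod 2) (σ : Check d → ZMod 2) :
    kraus (pauliCircuit e) o σ * pauliX a =
      sgn (zPart (extend e) ⬝ᵥ a) • (pauliX a * kraus (pauliCircuit e) o σ) := by
  have hn : nbr (evenSheet a : Bits (Qubit d L)) =
      liftSlice 0 0 + liftSlice (Fin.last (2 * L)) 0 := by
    have hl : ∀ t : Fin (2 * L + 1), liftSlice t (0 : Bits (Data d)) = 0 := by
      intro t; ext v; simp [liftSlice]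
    rw [hl, hl, add_zero]
    ext v
    by_cases hv : IsData v.1.1 v.1.2.1
    · obtain ⟨q, hq⟩ := exists_dataAt hv
      rw [hq, nbr_evenSheet_dataAt]; rfl
    · rw [nbr_evenSheet_check _ _ hv]
      split_ifs with hX
      · rfl
      · exact ha (checkSite v hv) hX
  have h := clusterOp_conj o e (czForm_evenSheet a) hn
  have h0 : atSlice 0 (evenSheet a : Bits (Qubit d L)) = a := by
    ext q; rw [atSlice, evenSheet_dataAt, if_pos (by simp)]
  have h1 : atSlice (Fin.last (2 * L)) (evenSheet a : Bits (Qubit d L)) = a := by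
    ext q; rw [atSlice, evenSheet_dataAt, if_pos (by simp)]
  rw [h0, h1, pauliZ_zero, mul_one, mul_one, dotProduct_evenSheet, zPart_add] at h
  rw [kraus_pauliCircuit, mul_assoc, h, Matrix.mul_smul, ← mul_assoc, ha.frameOp_comm,
    Matrix.smul_mul, smul_smul, ← sgn_add, mul_assoc, add_dotProduct, add_assoc,
    CharTwo.add_self_eq_zero, add_zero]

/-- A logical `Z` operator passes through the protocol, up to the sign of the residual error. -/
lemma CommutesZ.kraus_comm {b : Bits (Data d)} (hb : CommutesZ b) (e : Noisy d L → ZMod 2)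
    (o : Measured d L → ZMod 2) (σ : Check d → ZMod 2) :
    kraus (pauliCircuit e) o σ * pauliZ b =
      sgn (xPart (extend e) ⬝ᵥ b) • (pauliZ b * kraus (pauliCircuit e) o σ) := by
  have hn : nbr (oddSheet b : Bits (Qubit d L)) =
      liftSlice 0 b + liftSlice (Fin.last (2 * L)) b := by
    ext v
    by_cases hv : IsData v.1.1 v.1.2.1
    · obtain ⟨q, hq⟩ := exists_dataAt hv
      rw [hq, nbr_oddSheet_dataAt, Pi.add_apply, liftSlice_dataAt, liftSlice_dataAt]
    · have hz : ∀ t b, liftSlice t b v = 0 := fun t b => dif_neg fun h => hv h.1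
      rw [nbr_oddSheet_check _ _ hv, Pi.add_apply, hz, hz, add_zero]
      split_ifs with hX
      · exact hb (checkSite v hv) hX
      · rfl
  have h := clusterOp_conj o e (czForm_oddSheet b) hn
  have h0 : atSlice 0 (oddSheet b : Bits (Qubit d L)) = 0 := by
    ext q; rw [atSlice, oddSheet_dataAt, if_neg (by simp)]; rfl
  have h1 : atSlice (Fin.last (2 * L)) (oddSheet b : Bits (Qubit d L)) = 0 := by
    ext q; rw [atSlice, oddSheet_dataAt, if_neg (by simp)]; rfl
  rw [h0, h1, pauliX_zero, mul_one, one_mul, dotProduct_oddSheet, xPart_add] at h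
  have h2 : clusterOp o e * pauliZ b = sgn (xPart (extend e) ⬝ᵥ b + xPart (extend o) ⬝ᵥ b) •
      (pauliZ b * clusterOp o e) := by
    conv_lhs => rw [h]
    rw [Matrix.smul_mul, mul_assoc _ _ (pauliZ b), pauliZ_mul_self, mul_one, add_dotProduct]
  rw [kraus_pauliCircuit, mul_assoc, h2, Matrix.mul_smul, ← mul_assoc, hb.frameOp_comm,
    Matrix.smul_mul, smul_smul, ← sgn_add, mul_assoc, add_assoc,
    CharTwo.add_self_eq_zero, add_zero]

lemma IsCodeState.pauliX_support {ψ : Bits (Data d) → ℂ} (hψ : IsCodeState ψ) {c : Check d}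
    (hc : IsXCheck c.1.1 c.1.2) : pauliX (support c) *ᵥ ψ = ψ := by
  have := hψ.2 c
  rwa [stabilizer, if_pos hc] at this

lemma IsCodeState.pauliZ_support {ψ : Bits (Data d) → ℂ} (hψ : IsCodeState ψ) {c : Check d}
    (hc : ¬ IsXCheck c.1.1 c.1.2) : pauliZ (support c) *ᵥ ψ = ψ := by
  have := hψ.2 c
  rwa [stabilizer, if_neg hc] at this

lemma Cell.isXCheck_iff (a : Cell d L) :
    IsXCheck a.check.1.1 a.check.1.2 ↔ Even (a.1.2.2 : ℕ) := by
  have := a.2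
  change IsXCheck a.1.1 a.1.2.1 ↔ _
  simp only [IsXCheck, IsZCheck, Nat.even_iff, Nat.odd_iff] at this ⊢
  lia

/-- The measured cluster state stabilizer values are those flipped by the faults. -/
lemma kraus_mulVec_eq_zero {ψ : Bits (Data d) → ℂ} (hψ : IsCodeState ψ)
    {e : Noisy d L → ZMod 2} {o : Measured d L → ZMod 2} {σ : Check d → ZMod 2}
    (h : measuredSyndrome o σ ≠ faultSyndrome e) : kraus (pauliCircuit e) o σ *ᵥ ψ = 0 := by
  obtain ⟨a, ha⟩ := Function.ne_iff.1 h
  have hA := clusterOp_conj o e (czForm_cellBits a) (nbr_cellBits a)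
  have e0 : atSlice 0 (cellBits a) = if (a.1.2.2 : ℕ) = 0 then support a.check else 0 :=
    atSlice_cellBits a 0
  have e1 : atSlice (Fin.last (2 * L)) (cellBits a) =
      if (a.1.2.2 : ℕ) = 2 * L then support a.check else 0 := atSlice_cellBits a _
  rw [← cellParity_eq, cellParity_add, e0, e1] at hA
  have hX0 : pauliX (if (a.1.2.2 : ℕ) = 0 then support a.check else 0) *ᵥ ψ = ψ := by
    split_ifs with h0
    · exact hψ.pauliX_support (a.isXCheck_iff.2 (by simp [h0]))
    · simp
  have hZ0 : pauliZ (if (a.1.2.2 : ℕ) = 1 then support a.check else 0) *ᵥ ψ = ψ := by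
    split_ifs with h0
    · exact hψ.pauliZ_support (fun h => by simpa [h0] using a.isXCheck_iff.1 h)
    · simp
  have hF : frameOp o σ * (pauliX (if (a.1.2.2 : ℕ) = 2 * L then support a.check else 0) *
      pauliZ (if (a.1.2.2 : ℕ) = 2 * L + 1 then support a.check else 0)) =
      sgn (if 2 * L ≤ (a.1.2.2 : ℕ) then σ a.check else 0) • frameOp o σ := by
    have hτ := a.1.2.2.2
    by_cases h1 : (a.1.2.2 : ℕ) = 2 * L
    · have hs : pauliX (support a.check) = stabilizer a.check := by
        rw [stabilizer, if_pos (a.isXCheck_iff.2 (by simp [h1]))]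
      have h2 : ¬ (a.1.2.2 : ℕ) = 2 * L + 1 := by omega
      rw [if_pos h1, if_neg h2, if_pos h1.ge, pauliZ_zero, mul_one, hs, frameOp, mul_assoc,
        syndromeProjector_mul_stabilizer, Matrix.mul_smul]
    · by_cases h2 : (a.1.2.2 : ℕ) = 2 * L + 1
      · have hs : pauliZ (support a.check) = stabilizer a.check := by
          rw [stabilizer, if_neg fun h => ?_]
          have := a.isXCheck_iff.1 h
          rw [h2] at this
          exact absurd this (by simp)
        have h3 : 2 * L ≤ (a.1.2.2 : ℕ) := by omega
        rw [if_neg h1, if_pos h2, if_pos h3, pauliX_zero, one_mul, hs, frameOp, mul_assoc,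
          syndromeProjector_mul_stabilizer, Matrix.mul_smul]
      · have h3 : ¬ 2 * L ≤ (a.1.2.2 : ℕ) := by omega
        rw [if_neg h1, if_neg h2, if_neg h3]
        simp
  have key : kraus (pauliCircuit e) o σ *ᵥ ψ =
      sgn (faultSyndrome e a + measuredSyndrome o σ a) • (kraus (pauliCircuit e) o σ *ᵥ ψ) := by
    have h1 : clusterOp o e *ᵥ ψ = sgn (cellParity (extend e) a + cellParity (extend o) a) •
        ((pauliX (if (a.1.2.2 : ℕ) = 2 * L then support a.check else 0) *
          pauliZ (if (a.1.2.2 : ℕ) = 2 * L + 1 then support a.check else 0)) *ᵥ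
            (clusterOp o e *ᵥ ψ)) := by
      conv_lhs => rw [← hX0, Matrix.mulVec_mulVec, hA]
      rw [Matrix.smul_mulVec, ← Matrix.mulVec_mulVec, hZ0, ← Matrix.mulVec_mulVec]
    conv_lhs => rw [kraus_pauliCircuit, ← Matrix.mulVec_mulVec, h1, Matrix.mulVec_smul,
      Matrix.mulVec_mulVec, hF, Matrix.smul_mulVec, smul_smul, ← sgn_add, add_assoc,
      Matrix.mulVec_mulVec, ← kraus_pauliCircuit]
    rfl
  have h1 : faultSyndrome e a + measuredSyndrome o σ a = 1 :=
    zmod_two_add_eq_one ha.symm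
  rw [h1, sgn_one, neg_one_smul] at key
  ext i
  exact self_eq_neg.1 (congrFun key i)

/-- Vectors orthogonal to everything orthogonal to a family lie in its span. -/
lemma mem_span_of_forall_dotProduct {ι κ : Type} [Fintype ι] [DecidableEq ι]
    {S : κ → Bits ι} {h : Bits ι}
    (hh : ∀ b : Bits ι, (∀ k, S k ⬝ᵥ b = 0) → h ⬝ᵥ b = 0) :
    h ∈ Submodule.span (ZMod 2) (Set.range S) := by
  by_contra hn
  obtain ⟨f, hf, hf'⟩ := Submodule.exists_le_ker_of_notMem hn
  have hfb : ∀ x : Bits ι, f x = x ⬝ᵥ fun i => f (Pi.single i 1) := by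
    intro x
    conv_lhs => rw [pi_eq_sum_univ' x, map_sum]
    simp [dotProduct]
  refine hf ?_
  rw [hfb]
  refine hh _ fun k => ?_
  rw [← hfb]
  exact hf' (Submodule.subset_span ⟨k, rfl⟩)

lemma IsCodeState.apply_eq {ψ : Bits (Data d) → ℂ} (hψ : IsCodeState ψ) {x y : Bits (Data d)}
    (h : ∀ b, CommutesZ b → (x + y) ⬝ᵥ b = 0) : ψ x = ψ y := by
  have hmem := mem_span_of_forall_dotProduct
    (S := fun c : {c : Check d // IsXCheck c.1.1 c.1.2} => support c.1) (h := x + y)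
    (fun b hb => h b fun c hc => hb ⟨c, hc⟩)
  have key : ∀ g ∈ Submodule.span (ZMod 2)
      (Set.range fun c : {c : Check d // IsXCheck c.1.1 c.1.2} => support c.1),
      ∀ y, ψ (y + g) = ψ y := by
    intro g hg
    induction hg using Submodule.span_induction with
    | mem g hg =>
      obtain ⟨c, rfl⟩ := hg
      intro y
      have := congrFun (hψ.pauliX_support c.2) y
      rwa [pauliX_mulVec_apply] at this
    | zero => intro y; rw [add_zero]
    | add g g' _ _ h1 h2 => intro y; rw [← add_assoc, h2, h1]
    | smul r g _ h1 =>
      intro y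
      rcases zmod_two_cases r with rfl | rfl
      · rw [zero_smul, add_zero]
      · rw [one_smul, h1]
  have := key _ hmem y
  rwa [add_comm x, ← add_assoc, bits_add_self, zero_add] at this

lemma IsCodeState.commutesX_of_ne_zero {ψ : Bits (Data d) → ℂ} (hψ : IsCodeState ψ)
    {y : Bits (Data d)} (h : ψ y ≠ 0) : CommutesX y := by
  intro c hc
  have h1 := congrFun (hψ.pauliZ_support hc) y
  rw [pauliZ_mulVec_apply] at h1
  exact (sgn_eq_one_iff _).1 (mul_right_cancel₀ h (h1.trans (one_mul _).symm))

/-- An operator that commutes with all logical operators is a scalar on the code space. -/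
lemma IsCodeState.exists_mulVec_eq_smul {ψ : Bits (Data d) → ℂ} (hψ : IsCodeState ψ)
    {T : Op (Data d)} (hX : ∀ a, CommutesX a → T * pauliX a = pauliX a * T)
    (hZ : ∀ b, CommutesZ b → T * pauliZ b = pauliZ b * T) : ∃ z : ℂ, T *ᵥ ψ = z • ψ := by
  refine ⟨∑ x, T 0 x, ?_⟩
  ext y
  have h1 : ∀ x, T y x * ψ x = T y x * ψ y := by
    intro x
    by_cases hT : T y x = 0
    · rw [hT, zero_mul, zero_mul]
    · congr 1
      refine hψ.apply_eq fun b hb => ?_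
      have := congrFun₂ (hZ b hb) y x
      rw [mul_pauliZ_apply, pauliZ_mul_apply, mul_comm] at this
      have := mul_right_cancel₀ hT this
      rw [← sgn_eq_one_iff, dotProduct_comm, dotProduct_add, sgn_add, this, sgn_mul_self]
  have h2 : (T *ᵥ ψ) y = ∑ x, T y x * ψ y := Finset.sum_congr rfl fun x _ => h1 x
  rw [h2, ← Finset.sum_mul, Pi.smul_apply, smul_eq_mul]
  by_cases hy : ψ y = 0
  · rw [hy, mul_zero, mul_zero]
  · congr 1
    rw [← Equiv.sum_comp (Equiv.addRight y) fun x => T 0 x]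
    refine Finset.sum_congr rfl fun x _ => ?_
    have := congrFun₂ (hX y (hψ.commutesX_of_ne_zero hy)) 0 x
    rw [mul_pauliX_apply, pauliX_mul_apply, zero_add] at this
    exact this.symm

end CodeSpace

/-! ### The protocol preserves the trace -/

section TracePreserving

variable {d L : ℕ}

lemma sqrt_two_inv_mul_self : ((√2 : ℝ) : ℂ)⁻¹ * ((√2 : ℝ) : ℂ)⁻¹ = 1 / 2 := by
  rw [← mul_inv, ← Complex.ofReal_mul, Real.mul_self_sqrt (by norm_num)]
  norm_num

lemma star_sqrt_two_inv : star (((√2 : ℝ) : ℂ)⁻¹) = ((√2 : ℝ) : ℂ)⁻¹ := by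
  rw [← Complex.ofReal_inv, Complex.star_def, Complex.conj_ofReal]

lemma sum_measure : ∑ o : Measured d L → ZMod 2, (measure o)ᴴ * measure o = 1 := by
  ext x x'
  rw [Matrix.sum_apply]
  have h1 : ∀ o : Measured d L → ZMod 2, ((measure o)ᴴ * measure o) x x' =
      if atSlice (Fin.last (2 * L)) x = atSlice (Fin.last (2 * L)) x' then
        ∏ v : Measured d L, (1 / 2 : ℂ) * sgn (o v * (x v.1 + x' v.1)) else 0 := by
    intro o
    rw [Matrix.mul_apply, Finset.sum_eq_single (atSlice (Fin.last (2 * L)) x')]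
    · rw [Matrix.conjTranspose_apply]
      simp only [measure, Matrix.of_apply]
      change star (if atSlice (Fin.last (2 * L)) x = _ then _ else 0) *
        (if atSlice (Fin.last (2 * L)) x' = _ then _ else 0) = _
      rw [if_pos rfl]
      split_ifs
      · rw [star_prod, ← Finset.prod_mul_distrib]
        refine Finset.prod_congr rfl fun v _ => ?_
        rw [star_mul', star_sqrt_two_inv, star_sgn, mul_add, sgn_add, ← sqrt_two_inv_mul_self]
        ring
      · simp
    · intro y _ hy
      have : measure o y x' = 0 := if_neg fun h => hy h.symm
      rw [this, mul_zero]
    · simp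
  rw [Finset.sum_congr rfl fun o _ => h1 o, Matrix.one_apply]
  by_cases hout : atSlice (Fin.last (2 * L)) x = atSlice (Fin.last (2 * L)) x'
  · simp only [if_pos hout]
    have h2 := Finset.prod_univ_sum (fun _ : Measured d L => (Finset.univ : Finset (ZMod 2)))
      (fun v b => (1 / 2 : ℂ) * sgn (b * (x v.1 + x' v.1)))
    rw [Fintype.piFinset_univ] at h2
    rw [← h2]
    have h3 : ∀ v : Measured d L, ∑ b : ZMod 2, (1 / 2 : ℂ) * sgn (b * (x v.1 + x' v.1)) =
        if x v.1 = x' v.1 then 1 else 0 := by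
      intro v
      have h4 : ∀ f : ZMod 2 → ℂ, ∑ b, f b = f 0 + f 1 := fun f => Fin.sum_univ_two f
      rw [h4, zero_mul, one_mul, sgn_zero]
      split_ifs with h
      · rw [h, CharTwo.add_self_eq_zero, sgn_zero]; norm_num
      · have h5 : x v.1 + x' v.1 = 1 := zmod_two_add_eq_one h
        rw [h5, sgn_one]; norm_num
    simp only [h3]
    split_ifs with h
    · exact Finset.prod_eq_one fun v _ => by rw [h, if_pos rfl]
    · obtain ⟨v, hv⟩ := Function.ne_iff.1 h
      have hm : ¬ IsOutput v := by
        intro ho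
        obtain ⟨q, rfl⟩ := (isOutput_iff v).1 ho
        exact hv (congrFun hout q)
      exact Finset.prod_eq_zero (Finset.mem_univ ⟨v, hm⟩) (if_neg hv)
  · simp only [if_neg hout, Finset.sum_const_zero]
    rw [if_neg]
    rintro rfl
    exact hout rfl

lemma card_input_fiber (y : Bits (Data d)) :
    (Finset.univ.filter fun x : Bits (Qubit d L) => (fun q => x (dataAt 0 q)) = y).card =
      2 ^ Fintype.card (Noisy d L) := by
  have : Fintype.card (Noisy d L → ZMod 2) = 2 ^ Fintype.card (Noisy d L) := by
    rw [Fintype.card_fun, ZMod.card]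
  rw [← this, ← Finset.card_univ]
  have hdata : ∀ v : Qubit d L, ¬ 0 < (v.1.2.2 : ℕ) → ∃ q, v = dataAt 0 q := by
    intro v hv
    have h2 := v.2
    have hd : IsData v.1.1 v.1.2.1 := by
      simp only [IsClusterQubit, IsData, IsXCheck, IsZCheck, Nat.even_iff, Nat.odd_iff] at h2 ⊢
      lia
    obtain ⟨q, hq⟩ := exists_dataAt hd
    refine ⟨q, hq.trans ?_⟩
    congr 1
    exact Fin.ext (by simpa using hv)
  refine Finset.card_bij' (fun x _ => fun v : Noisy d L => x v.1)
    (fun f _ => fun v => if h : 0 < (v.1.2.2 : ℕ) then f ⟨v, h⟩ else liftSlice 0 y v)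
    (fun _ _ => Finset.mem_univ _) ?_ ?_ ?_
  · intro f _
    refine Finset.mem_filter.2 ⟨Finset.mem_univ _, ?_⟩
    ext q
    have h0 : ¬ 0 < ((dataAt 0 q : Qubit d L).1.2.2 : ℕ) := by simp [dataAt]
    exact (dif_neg h0).trans (by simp)
  · intro x hx
    ext v
    dsimp only
    split_ifs with h
    · rfl
    · obtain ⟨q, rfl⟩ := hdata v h
      rw [liftSlice_dataAt, if_pos rfl, ← (Finset.mem_filter.1 hx).2]
  · intro f _
    ext v
    exact dif_pos v.2

lemma prepare_isometry : (prepare d L)ᴴ * prepare d L = 1 := by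
  ext y y'
  rw [Matrix.mul_apply, Matrix.one_apply]
  have h1 : ∀ x : Bits (Qubit d L), (prepare d L)ᴴ y x * prepare d L x y' =
      if (fun q => x (dataAt 0 q)) = y ∧ y = y' then (1 / 2 : ℂ) ^ Fintype.card (Noisy d L)
        else 0 := by
    intro x
    rw [Matrix.conjTranspose_apply]
    simp only [prepare, Matrix.of_apply]
    by_cases h : (fun q => x (dataAt 0 q)) = y
    · by_cases h' : y = y'
      · rw [if_pos h, if_pos (h.trans h'), if_pos ⟨h, h'⟩, star_pow, star_sqrt_two_inv,
          ← mul_pow, sqrt_two_inv_mul_self]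
      · rw [if_neg (fun hh => h' (h.symm.trans hh)), mul_zero]
        exact (if_neg fun hh => h' hh.2).symm
    · rw [if_neg h, star_zero, zero_mul]
      exact (if_neg fun hh => h hh.1).symm
  rw [Finset.sum_congr rfl fun x _ => h1 x]
  by_cases h : y = y'
  · simp only [h, and_true, if_true]
    rw [← Finset.sum_filter, Finset.sum_const, card_input_fiber, nsmul_eq_mul]
    push_cast
    rw [← mul_pow]
    norm_num
  · simp [h]

lemma pauliCircuit_unitary (e : Noisy d L → ZMod 2) : (pauliCircuit e)ᴴ * pauliCircuit e = 1 := by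
  have h : (czCircuit d L)ᴴ * czCircuit d L = 1 := by
    rw [czCircuit, Matrix.diagonal_conjTranspose, Matrix.diagonal_mul_diagonal,
      ← Matrix.diagonal_one]
    congr 1
    ext x
    rw [Pi.star_apply, star_sgn, sgn_mul_self]
  rw [pauliCircuit_eq, Matrix.conjTranspose_mul, conjTranspose_pauliZ, mul_assoc,
    ← mul_assoc (pauliZ _), pauliZ_mul_self, one_mul, h]

lemma frameOp_conjTranspose_mul (o : Measured d L → ZMod 2) (σ : Check d → ZMod 2) :
    (frameOp o σ)ᴴ * frameOp o σ = (syndromeProjector σ)ᴴ * syndromeProjector σ := by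
  simp only [frameOp, Matrix.conjTranspose_mul, conjTranspose_pauliX, conjTranspose_pauliZ]
  have h : ∀ A P Q B : Op (Data d), Q * Q = 1 → P * P = 1 → A * (P * Q) * (Q * P * B) = A * B := by
    intro A P Q B hQ hP
    calc A * (P * Q) * (Q * P * B) = A * (P * (Q * Q) * P) * B := by simp only [mul_assoc]
      _ = A * B := by rw [hQ, mul_one, hP, mul_one]
  exact h _ _ _ _ (pauliZ_mul_self _) (pauliX_mul_self _)

lemma sum_kraus (e : Noisy d L → ZMod 2) :
    ∑ o : Measured d L → ZMod 2, ∑ σ : Check d → ZMod 2,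
      (kraus (pauliCircuit e) o σ)ᴴ * kraus (pauliCircuit e) o σ = 1 := by
  have h1 : ∀ o : Measured d L → ZMod 2, ∑ σ : Check d → ZMod 2,
      (kraus (pauliCircuit e) o σ)ᴴ * kraus (pauliCircuit e) o σ =
        (clusterOp o e)ᴴ * clusterOp o e := by
    intro o
    have h2 : ∀ σ : Check d → ZMod 2, (kraus (pauliCircuit e) o σ)ᴴ * kraus (pauliCircuit e) o σ =
        (clusterOp o e)ᴴ * ((syndromeProjector σ)ᴴ * syndromeProjector σ) * clusterOp o e := by
      intro σ
      rw [kraus_pauliCircuit, Matrix.conjTranspose_mul, ← frameOp_conjTranspose_mul o σ]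
      simp only [mul_assoc]
    rw [Finset.sum_congr rfl fun σ _ => h2 σ, ← Finset.sum_mul, ← Finset.mul_sum,
      sum_syndromeProjector, mul_one]
  rw [Finset.sum_congr rfl fun o _ => h1 o]
  have h3 : ∀ o : Measured d L → ZMod 2, (clusterOp o e)ᴴ * clusterOp o e =
      (pauliCircuit e * prepare d L)ᴴ * ((measure o)ᴴ * measure o) *
        (pauliCircuit e * prepare d L) := by
    intro o
    rw [clusterOp, Matrix.mul_assoc, Matrix.conjTranspose_mul (measure o)]
    simp only [Matrix.mul_assoc]
  rw [Finset.sum_congr rfl fun o _ => h3 o, ← Matrix.sum_mul, ← Matrix.mul_sum, sum_measure,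
    Matrix.mul_one, Matrix.conjTranspose_mul, Matrix.mul_assoc,
    ← Matrix.mul_assoc (pauliCircuit e)ᴴ, pauliCircuit_unitary, Matrix.one_mul, prepare_isometry]

end TracePreserving

/-! ### Fidelity of the decoded channel -/

section Fidelity

variable {d L : ℕ}

/-- Probability of a fault pattern under Pauli noise of rate `p`. -/
def faultProb (p : ℝ) (e : Noisy d L → ZMod 2) : ℝ := ∏ v, if e v = 1 then p else 1 - p

lemma faultProb_nonneg {p : ℝ} (h0 : 0 ≤ p) (h1 : p ≤ 1) (e : Noisy d L → ZMod 2) :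
    0 ≤ faultProb p e :=
  Finset.prod_nonneg fun v _ => by split_ifs <;> linarith

lemma sum_faultProb (p : ℝ) : ∑ e : Noisy d L → ZMod 2, faultProb p e = 1 := by
  have h := Finset.prod_univ_sum (fun _ : Noisy d L => (Finset.univ : Finset (ZMod 2)))
    (fun _ b => if b = 1 then p else 1 - p)
  rw [Fintype.piFinset_univ] at h
  simp only [faultProb]
  rw [← h]
  have h4 : ∀ f : ZMod 2 → ℝ, ∑ b, f b = f 0 + f 1 := fun f => Fin.sum_univ_two f
  exact Finset.prod_eq_one fun v _ => by rw [h4]; simp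

/-- The residual error of the faults `e` after decoding acts trivially on the code space. -/
def Corrects (D : Decoder d L) (e : Noisy d L → ZMod 2) : Prop :=
  (∀ b, CommutesZ b → (xPart (extend e) + (D (faultSyndrome e)).1) ⬝ᵥ b = 0) ∧
  ∀ a, CommutesX a → (zPart (extend e) + (D (faultSyndrome e)).2) ⬝ᵥ a = 0

/-- The Kraus operators of the decoded channel. -/
def decodedKraus (D : Decoder d L) (e : Noisy d L → ZMod 2) (o : Measured d L → ZMod 2)
    (σ : Check d → ZMod 2) : Op (Data d) :=
  pauliX (D (measuredSyndrome o σ)).1 * pauliZ (D (measuredSyndrome o σ)).2 *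
    kraus (pauliCircuit e) o σ

lemma sum_conditioned_conj {ι S E O Q : Type} [Fintype ι] [DecidableEq ι] [Fintype S]
    [DecidableEq S] [Fintype E] [Fintype O] [Fintype Q] (C : S → Matrix ι ι ℂ) (w : E → ℂ)
    (m : O → Q → S) (K : E → O → Q → Matrix ι ι ℂ) (ρ : Matrix ι ι ℂ) :
    ∑ s, C s * (∑ e, w e • ∑ o, ∑ σ, if m o σ = s then K e o σ * ρ * (K e o σ)ᴴ else 0) * (C s)ᴴ =
      ∑ e, w e • ∑ o, ∑ σ, (C (m o σ) * K e o σ) * ρ * (C (m o σ) * K e o σ)ᴴ := by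
  simp only [Matrix.mul_sum, Matrix.sum_mul, Matrix.mul_smul, Matrix.smul_mul]
  rw [Finset.sum_comm]
  refine Finset.sum_congr rfl fun e _ => ?_
  rw [← Finset.smul_sum, Finset.sum_comm]
  refine congrArg _ (Finset.sum_congr rfl fun o _ => ?_)
  rw [Finset.sum_comm]
  refine Finset.sum_congr rfl fun σ _ => ?_
  rw [Finset.sum_eq_single (m o σ)]
  · rw [if_pos rfl, Matrix.conjTranspose_mul]
    simp only [mul_assoc]
  · intro s _ hs
    rw [if_neg hs.symm, mul_zero, zero_mul]
  · simp

lemma decodedChannel_pauliInstrument (D : Decoder d L) (p : ℝ) (ρ : Op (Data d)) :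
    decodedChannel D (pauliInstrument p) ρ = ∑ e : Noisy d L → ZMod 2, (faultProb p e : ℂ) •
      ∑ o : Measured d L → ZMod 2, ∑ σ : Check d → ZMod 2,
        decodedKraus D e o σ * ρ * (decodedKraus D e o σ)ᴴ :=
  sum_conditioned_conj (fun s => pauliX (D s).1 * pauliZ (D s).2)
    (fun e => (faultProb p e : ℂ)) measuredSyndrome (fun e o σ => kraus (pauliCircuit e) o σ) ρ

lemma dotProduct_conj_mulVec {ι : Type} [Fintype ι] (T : Matrix ι ι ℂ) (ψ : ι → ℂ) :
    star ψ ⬝ᵥ (T * Matrix.vecMulVec ψ (star ψ) * Tᴴ) *ᵥ ψ =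
      (Complex.normSq (star ψ ⬝ᵥ T *ᵥ ψ) : ℂ) := by
  have h1 : (T * Matrix.vecMulVec ψ (star ψ) * Tᴴ) *ᵥ ψ =
      (star (T *ᵥ ψ) ⬝ᵥ ψ) • (T *ᵥ ψ) := by
    rw [← Matrix.mulVec_mulVec, ← Matrix.mulVec_mulVec, Matrix.vecMulVec_mulVec,
      Matrix.dotProduct_mulVec, ← Matrix.star_mulVec]
    ext i
    simp [Matrix.mulVec_smul, mul_comm]
  rw [h1, dotProduct_smul, smul_eq_mul, ← Complex.mul_conj, mul_comm]
  congr 1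
  exact Matrix.star_dotProduct _ _

lemma re_dotProduct_sum_conj {ι E O Q : Type} [Fintype ι] [Fintype E] [Fintype O] [Fintype Q]
    (w : E → ℝ) (T : E → O → Q → Matrix ι ι ℂ) (ψ : ι → ℂ) :
    (star ψ ⬝ᵥ (∑ e, (w e : ℂ) • ∑ o, ∑ σ,
      T e o σ * Matrix.vecMulVec ψ (star ψ) * (T e o σ)ᴴ) *ᵥ ψ).re =
      ∑ e, w e * ∑ o, ∑ σ, Complex.normSq (star ψ ⬝ᵥ T e o σ *ᵥ ψ) := by
  simp only [Matrix.sum_mulVec, Matrix.smul_mulVec, dotProduct_sum, dotProduct_smul,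
    dotProduct_conj_mulVec, smul_eq_mul]
  rw [Complex.re_sum]
  refine Finset.sum_congr rfl fun e _ => ?_
  rw [Complex.re_ofReal_mul, Complex.re_sum]
  simp only [Complex.re_sum, Complex.ofReal_re]

lemma fidelity_pauli (D : Decoder d L) (p : ℝ) (ψ : Bits (Data d) → ℂ) :
    fidelity (decodedChannel D (pauliInstrument p)) ψ = ∑ e : Noisy d L → ZMod 2, faultProb p e *
      ∑ o : Measured d L → ZMod 2, ∑ σ : Check d → ZMod 2,
        Complex.normSq (star ψ ⬝ᵥ decodedKraus D e o σ *ᵥ ψ) := by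
  rw [fidelity, decodedChannel_pauliInstrument]
  exact re_dotProduct_sum_conj (faultProb p) (decodedKraus D) ψ

lemma pauli_mul_isometry {ι : Type} [Fintype ι] [DecidableEq ι] (a b : Bits ι)
    (φ : Bits ι → ℂ) : star ((pauliX a * pauliZ b) *ᵥ φ) ⬝ᵥ ((pauliX a * pauliZ b) *ᵥ φ) =
      star φ ⬝ᵥ φ := by
  rw [Matrix.star_mulVec, ← Matrix.dotProduct_mulVec, Matrix.mulVec_mulVec,
    Matrix.conjTranspose_mul, conjTranspose_pauliX, conjTranspose_pauliZ, mul_assoc,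
    ← mul_assoc (pauliX a), pauliX_mul_self, one_mul, pauliZ_mul_self, Matrix.one_mulVec]

lemma Corrects.normSq_eq {D : Decoder d L} {e : Noisy d L → ZMod 2} (he : Corrects D e)
    {ψ : Bits (Data d) → ℂ} (hψ : IsCodeState ψ) (o : Measured d L → ZMod 2)
    (σ : Check d → ZMod 2) :
    (Complex.normSq (star ψ ⬝ᵥ decodedKraus D e o σ *ᵥ ψ) : ℂ) =
      star (kraus (pauliCircuit e) o σ *ᵥ ψ) ⬝ᵥ (kraus (pauliCircuit e) o σ *ᵥ ψ) := by
  by_cases hs : measuredSyndrome o σ = faultSyndrome e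
  · have hT : ∃ z : ℂ, decodedKraus D e o σ *ᵥ ψ = z • ψ := by
      refine hψ.exists_mulVec_eq_smul (fun a ha => ?_) (fun b hb => ?_)
      · have h1 := he.2 a ha
        rw [add_dotProduct] at h1
        rw [decodedKraus, hs, mul_assoc, ha.kraus_comm, Matrix.mul_smul, ← mul_assoc,
          mul_assoc (pauliX _) (pauliZ _), pauliZ_mul_pauliX, Matrix.mul_smul, Matrix.smul_mul,
          smul_smul, ← sgn_add, h1, sgn_zero, one_smul, ← mul_assoc, pauliX_comm, mul_assoc,
          mul_assoc, mul_assoc]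
      · have h1 := he.1 b hb
        rw [add_dotProduct] at h1
        rw [decodedKraus, hs, mul_assoc, hb.kraus_comm, Matrix.mul_smul, ← mul_assoc,
          mul_assoc (pauliX _) (pauliZ _), pauliZ_comm, ← mul_assoc (pauliX _) (pauliZ b),
          pauliX_mul_pauliZ, Matrix.smul_mul, Matrix.smul_mul,
          smul_smul, ← sgn_add, dotProduct_comm b, h1, sgn_zero, one_smul, mul_assoc, mul_assoc,
          mul_assoc]
    obtain ⟨z, hz⟩ := hT
    have h2 : star (kraus (pauliCircuit e) o σ *ᵥ ψ) ⬝ᵥ (kraus (pauliCircuit e) o σ *ᵥ ψ) =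
        star (decodedKraus D e o σ *ᵥ ψ) ⬝ᵥ (decodedKraus D e o σ *ᵥ ψ) := by
      rw [decodedKraus, ← Matrix.mulVec_mulVec, pauli_mul_isometry]
    rw [h2, hz, dotProduct_smul, hψ.1, star_smul, smul_dotProduct, dotProduct_smul, hψ.1,
      smul_eq_mul, smul_eq_mul, mul_one, ← Complex.mul_conj, Complex.star_def,
      mul_comm]
  · rw [decodedKraus, ← Matrix.mulVec_mulVec, kraus_mulVec_eq_zero hψ hs]
    simp

lemma Corrects.sum_normSq_eq {D : Decoder d L} {e : Noisy d L → ZMod 2} (he : Corrects D e)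
    {ψ : Bits (Data d) → ℂ} (hψ : IsCodeState ψ) :
    ∑ o : Measured d L → ZMod 2, ∑ σ : Check d → ZMod 2,
      Complex.normSq (star ψ ⬝ᵥ decodedKraus D e o σ *ᵥ ψ) = 1 := by
  have h : ((∑ o : Measured d L → ZMod 2, ∑ σ : Check d → ZMod 2,
      Complex.normSq (star ψ ⬝ᵥ decodedKraus D e o σ *ᵥ ψ) : ℝ) : ℂ) = 1 := by
    push_cast
    have h1 : ∀ (o : Measured d L → ZMod 2) (σ : Check d → ZMod 2),
        (Complex.normSq (star ψ ⬝ᵥ decodedKraus D e o σ *ᵥ ψ) : ℂ) =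
          star ψ ⬝ᵥ ((kraus (pauliCircuit e) o σ)ᴴ * kraus (pauliCircuit e) o σ) *ᵥ ψ := by
      intro o σ
      rw [he.normSq_eq hψ, Matrix.star_mulVec, ← Matrix.dotProduct_mulVec, Matrix.mulVec_mulVec]
    simp only [h1]
    simp only [← dotProduct_sum, ← Matrix.sum_mulVec]
    rw [sum_kraus, Matrix.one_mulVec, hψ.1]
  exact_mod_cast h

open Classical in
/-- The infidelity is at most the probability of a fault pattern on which decoding fails. -/
theorem fidelity_ge {p : ℝ} (h0 : 0 ≤ p) (h1 : p ≤ 1) (D : Decoder d L)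
    {ψ : Bits (Data d) → ℂ} (hψ : IsCodeState ψ) :
    1 - ∑ e : Noisy d L → ZMod 2, (if Corrects D e then 0 else faultProb p e) ≤
      fidelity (decodedChannel D (pauliInstrument p)) ψ := by
  rw [fidelity_pauli, ← sum_faultProb (d := d) (L := L) p, ← Finset.sum_sub_distrib]
  refine Finset.sum_le_sum fun e _ => ?_
  split_ifs with he
  · rw [he.sum_normSq_eq hψ, mul_one, sub_zero]
  · rw [sub_self]
    exact mul_nonneg (faultProb_nonneg h0 h1 e)
      (Finset.sum_nonneg fun o _ => Finset.sum_nonneg fun σ _ => Complex.normSq_nonneg _)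

end Fidelity

/-! ### Cycles on one sublattice of the cluster

Positions are points of `ℤ³`.  The cells of a sublattice sit at `(i, j, t)` with `i` even, `j` odd
and `t` of parity `r`; its open boundaries are at `j = -1` and `j = 2d - 1`. -/

section Lattice

/-- The six unit vectors of the cubic lattice. -/
def dirs : Finset (ℤ × ℤ × ℤ) :=
  {(1, 0, 0), (-1, 0, 0), (0, 1, 0), (0, -1, 0), (0, 0, 1), (0, 0, -1)}

lemma card_dirs : dirs.card = 6 := by decide

lemma mem_dirs {v : ℤ × ℤ × ℤ} : v ∈ dirs ↔ v = (1, 0, 0) ∨ v = (-1, 0, 0) ∨ v = (0, 1, 0) ∨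
    v = (0, -1, 0) ∨ v = (0, 0, 1) ∨ v = (0, 0, -1) := by
  simp [dirs]

lemma neg_mem_dirs {v : ℤ × ℤ × ℤ} (h : v ∈ dirs) : -v ∈ dirs := by
  rw [mem_dirs] at h ⊢
  rcases h with rfl | rfl | rfl | rfl | rfl | rfl <;> simp

lemma sum_dirs (F : ℤ × ℤ × ℤ → ZMod 2) (i j t : ℤ) : ∑ v ∈ dirs, F ((i, j, t) + v) =
    F (i + 1, j, t) + F (i - 1, j, t) + F (i, j + 1, t) + F (i, j - 1, t) + F (i, j, t + 1) +
      F (i, j, t - 1) := by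
  have h : ∀ G : ℤ × ℤ × ℤ → ZMod 2, ∑ v ∈ dirs, G v = G (1, 0, 0) + G (-1, 0, 0) + G (0, 1, 0) +
      G (0, -1, 0) + G (0, 0, 1) + G (0, 0, -1) := by
    intro G
    rw [dirs]
    repeat rw [Finset.sum_insert (by decide)]
    rw [Finset.sum_singleton]
    ring
  rw [h]
  simp [sub_eq_add_neg]

/-- A finitely supported chain without boundary on the sublattice of parity `r`. -/
structure IsCycle (d L : ℕ) (r : ℤ) (F : ℤ × ℤ × ℤ → ZMod 2) : Prop where
  supp : ∀ i j t : ℤ, F (i, j, t) ≠ 0 →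
    0 ≤ i ∧ i ≤ 2 * d - 2 ∧ 0 ≤ j ∧ j ≤ 2 * d - 2 ∧ 1 ≤ t ∧ t ≤ 2 * L
  closed : ∀ i j t : ℤ, i % 2 = 0 → j % 2 = 1 → t % 2 = r → 1 ≤ j → j ≤ 2 * d - 3 →
    ∑ v ∈ dirs, F ((i, j, t) + v) = 0

/-- Projection of a chain along the time axis. -/
def project (L : ℕ) (r : ℤ) (F : ℤ × ℤ × ℤ → ZMod 2) (i j : ℤ) : ZMod 2 :=
  ∑ k ∈ Finset.range (L + 1), F (i, j, 2 * k + r)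

/-- Parity of the crossings of the line at height `j`. -/
def lineParity (d : ℕ) (U : ℤ → ℤ → ZMod 2) (j : ℤ) : ZMod 2 :=
  ∑ k ∈ Finset.range d, U (2 * k) j

lemma sum_range_add_succ (a : ℕ → ZMod 2) (n : ℕ) :
    ∑ k ∈ Finset.range n, (a (k + 1) + a k) = a n + a 0 := by
  induction n with
  | zero => simp [CharTwo.add_self_eq_zero]
  | succ n ih =>
    rw [Finset.sum_range_succ, ih]
    linear_combination CharTwo.add_self_eq_zero (a n)

variable {d L : ℕ} {r : ℤ} {F : ℤ × ℤ × ℤ → ZMod 2}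

lemma IsCycle.eq_zero (hF : IsCycle d L r F) {i j t : ℤ}
    (h : ¬ (0 ≤ i ∧ i ≤ 2 * d - 2 ∧ 0 ≤ j ∧ j ≤ 2 * d - 2 ∧ 1 ≤ t ∧ t ≤ 2 * L)) :
    F (i, j, t) = 0 := by
  by_contra h'
  exact h (hF.supp i j t h')

lemma IsCycle.project_eq_zero (hF : IsCycle d L r F) {i j : ℤ}
    (h : ¬ (0 ≤ i ∧ i ≤ 2 * d - 2 ∧ 0 ≤ j ∧ j ≤ 2 * d - 2)) : project L r F i j = 0 :=
  Finset.sum_eq_zero fun _ _ => hF.eq_zero (by omega)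

lemma IsCycle.project_closed (hF : IsCycle d L r F) (hr : r = 0 ∨ r = 1) {i j : ℤ}
    (hi : i % 2 = 0) (hj : j % 2 = 1) (h1 : 1 ≤ j) (h2 : j ≤ 2 * d - 3) :
    project L r F (i + 1) j + project L r F (i - 1) j + project L r F i (j + 1) +
      project L r F i (j - 1) = 0 := by
  have h3 : ∑ k ∈ Finset.range (L + 1), ∑ v ∈ dirs, F ((i, j, 2 * (k : ℤ) + r) + v) = 0 :=
    Finset.sum_eq_zero fun k _ => hF.closed i j _ hi hj (by omega) h1 h2
  have h4 := sum_range_add_succ (fun k : ℕ => F (i, j, 2 * (k : ℤ) + r - 1)) (L + 1)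
  have h5 : F (i, j, 2 * ((L + 1 : ℕ) : ℤ) + r - 1) = 0 := hF.eq_zero (by push_cast; omega)
  have h6 : F (i, j, 2 * ((0 : ℕ) : ℤ) + r - 1) = 0 := hF.eq_zero (by push_cast; omega)
  rw [h5, h6, add_zero, Finset.sum_add_distrib] at h4
  simp only [sum_dirs, Finset.sum_add_distrib] at h3
  have h7 : ∀ k : ℕ, (2 * ((k + 1 : ℕ) : ℤ) + r - 1) = 2 * (k : ℤ) + r + 1 := by
    intro k; push_cast; ring
  simp only [h7] at h4
  simp only [project]
  linear_combination h3 - h4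

lemma lineParity_eq {U : ℤ → ℤ → ZMod 2} (hout : ∀ j, U (-1) j = 0 ∧ U (2 * d - 1) j = 0)
    (hU : ∀ i j : ℤ, i % 2 = 0 → j % 2 = 1 → 1 ≤ j → j ≤ 2 * d - 3 →
      U (i + 1) j + U (i - 1) j + U i (j + 1) + U i (j - 1) = 0)
    (m : ℕ) (hm : m < d) : lineParity d U (2 * m) = lineParity d U 0 := by
  induction m with
  | zero => simp
  | succ m ih =>
    rw [← ih (by omega)]
    have h1 : ∑ k ∈ Finset.range d, (U (2 * (k : ℤ) + 1) (2 * m + 1) +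
        U (2 * (k : ℤ) - 1) (2 * m + 1) + U (2 * (k : ℤ)) (2 * m + 1 + 1) +
        U (2 * (k : ℤ)) (2 * m + 1 - 1)) = 0 :=
      Finset.sum_eq_zero fun k _ => hU _ _ (by omega) (by omega) (by omega) (by omega)
    have h2 := sum_range_add_succ (fun k : ℕ => U (2 * (k : ℤ) - 1) (2 * m + 1)) d
    have h3 : ∀ k : ℕ, 2 * ((k + 1 : ℕ) : ℤ) - 1 = 2 * (k : ℤ) + 1 := by
      intro k; push_cast; ring
    simp only [h3] at h2
    have h4 := (hout (2 * m + 1)).1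
    have h5 := (hout (2 * m + 1)).2
    simp only [Nat.cast_zero, mul_zero, zero_sub, h4, h5, Finset.sum_add_distrib] at h1 h2
    have h6 : (2 * (m : ℤ) + 1 + 1) = 2 * ((m + 1 : ℕ) : ℤ) := by push_cast; ring
    rw [h6, add_sub_cancel_right] at h1
    simp only [lineParity]
    linear_combination h1 - h2 - CharTwo.add_self_eq_zero
      (∑ k ∈ Finset.range d, U (2 * (k : ℤ)) (2 * m))

/-- A planar cycle that crosses the code an even number of times is a boundary. -/
lemma exists_boundary {U : ℤ → ℤ → ZMod 2} (hout : ∀ j, U (-1) j = 0 ∧ U (2 * d - 1) j = 0)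
    (hU : ∀ i j : ℤ, i % 2 = 0 → j % 2 = 1 → 1 ≤ j → j ≤ 2 * d - 3 →
      U (i + 1) j + U (i - 1) j + U i (j + 1) + U i (j - 1) = 0)
    (h0 : lineParity d U 0 = 0) :
    ∃ W : ℤ → ℤ → ZMod 2, (∀ i j, W i j ≠ 0 →
      i % 2 = 1 ∧ j % 2 = 0 ∧ 0 ≤ i ∧ i ≤ 2 * d - 2 ∧ 0 ≤ j ∧ j ≤ 2 * d - 2) ∧
      ∀ i j : ℤ, (i + j) % 2 = 0 → 0 ≤ i → i ≤ 2 * d - 2 → 0 ≤ j → j ≤ 2 * d - 2 →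
        U i j = W (i + 1) j + W (i - 1) j + W i (j + 1) + W i (j - 1) := by
  set W : ℤ → ℤ → ZMod 2 := fun i j =>
    if i % 2 = 1 ∧ j % 2 = 0 ∧ 0 ≤ i ∧ i ≤ 2 * d - 2 ∧ 0 ≤ j ∧ j ≤ 2 * d - 2 then
      ∑ k ∈ Finset.range ((i + 1) / 2).toNat, U (2 * k) j else 0 with hW
  have hWodd : ∀ (m : ℕ) (j : ℤ), 2 * (m : ℤ) + 1 ≤ 2 * d - 2 → j % 2 = 0 → 0 ≤ j →
      j ≤ 2 * d - 2 → W (2 * m + 1) j = ∑ k ∈ Finset.range (m + 1), U (2 * k) j := by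
    intro m j hm hj1 hj2 hj3
    have : ((2 * (m : ℤ) + 1 + 1) / 2).toNat = m + 1 := by omega
    simp only [hW]
    rw [if_pos ⟨by omega, hj1, by omega, hm, hj2, hj3⟩, this]
  refine ⟨W, fun i j h => ?_, fun i j hp hi1 hi2 hj1 hj2 => ?_⟩
  · by_contra hn
    exact h (if_neg hn)
  · rcases Int.emod_two_eq_zero_or_one i with hi | hi
    · obtain ⟨m, rfl⟩ : ∃ m : ℕ, i = 2 * m := ⟨(i / 2).toNat, by omega⟩
      have hz1 : W (2 * m) (j + 1) = 0 := if_neg (by omega)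
      have hz2 : W (2 * m) (j - 1) = 0 := if_neg (by omega)
      have hlow : W (2 * m - 1) j = ∑ k ∈ Finset.range m, U (2 * k) j := by
        rcases Nat.eq_zero_or_pos m with rfl | hm
        · exact (if_neg (by rintro ⟨-, -, h, -⟩; simp at h)).trans (by simp)
        · obtain ⟨m', rfl⟩ : ∃ m', m = m' + 1 := ⟨m - 1, by omega⟩
          have := hWodd m' j (by push_cast at hi2; omega) (by omega) hj1 hj2
          rw [← this]
          congr 1
          push_cast; ring
      rw [hz1, hz2, add_zero, add_zero, hlow]
      by_cases hm : 2 * (m : ℤ) + 1 ≤ 2 * d - 2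
      · rw [hWodd m j hm (by omega) hj1 hj2, Finset.sum_range_succ]
        linear_combination -CharTwo.add_self_eq_zero (∑ k ∈ Finset.range m, U (2 * k) j)
      · have hmd : d = m + 1 := by omega
        have hz3 : W (2 * m + 1) j = 0 := if_neg (by omega)
        obtain ⟨n, rfl⟩ : ∃ n : ℕ, j = 2 * n := ⟨(j / 2).toNat, by omega⟩
        have hT := lineParity_eq hout hU n (by omega)
        rw [h0, lineParity, hmd, Finset.sum_range_succ] at hT
        rw [hz3, zero_add]
        linear_combination hT - CharTwo.add_self_eq_zero (∑ k ∈ Finset.range m, U (2 * k) (2 * n))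
    · obtain ⟨m, rfl⟩ : ∃ m : ℕ, i = 2 * m + 1 := ⟨(i / 2).toNat, by omega⟩
      have hz1 : W (2 * m + 1 + 1) j = 0 := if_neg (by omega)
      have hz2 : W (2 * m + 1 - 1) j = 0 := if_neg (by omega)
      rw [hz1, hz2, hWodd m _ hi2 (by omega) (by omega) (by omega),
        hWodd m _ hi2 (by omega) (by omega) (by omega)]
      have h1 : ∑ k ∈ Finset.range (m + 1), (U (2 * (k : ℤ) + 1) j +
          U (2 * (k : ℤ) - 1) j + U (2 * (k : ℤ)) (j + 1) + U (2 * (k : ℤ)) (j - 1)) = 0 :=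
        Finset.sum_eq_zero fun k _ => hU _ _ (by omega) (by omega) (by omega) (by omega)
      have h2 := sum_range_add_succ (fun k : ℕ => U (2 * (k : ℤ) - 1) j) (m + 1)
      have h3 : ∀ k : ℕ, 2 * ((k + 1 : ℕ) : ℤ) - 1 = 2 * (k : ℤ) + 1 := by
        intro k; push_cast; ring
      simp only [h3] at h2
      have h4 := (hout j).1
      simp only [Nat.cast_zero, mul_zero, zero_sub, h4, Finset.sum_add_distrib] at h1 h2
      linear_combination h1 - h2 - CharTwo.add_self_eq_zero (∑ k ∈ Finset.range (m + 1),
        U (2 * k) (j + 1)) - CharTwo.add_self_eq_zero (∑ k ∈ Finset.range (m + 1),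
        U (2 * k) (j - 1))

/-! ### Paths -/

/-- Cells are joined by the qubits halfway between them at which the chain `F` does not vanish. -/
def chainGraph (F : ℤ × ℤ × ℤ → ZMod 2) : SimpleGraph (ℤ × ℤ × ℤ) where
  Adj p q := ∃ v ∈ dirs, q = p + v + v ∧ F (p + v) ≠ 0
  symm := ⟨by
    rintro p _ ⟨v, hv, rfl, h⟩
    exact ⟨-v, neg_mem_dirs hv, by abel, by simpa using h⟩⟩
  loopless := ⟨by
    rintro p ⟨v, hv, h, -⟩
    obtain ⟨a, b, c⟩ := p
    rw [mem_dirs] at hv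
    rcases hv with rfl | rfl | rfl | rfl | rfl | rfl <;> simp at h <;> omega⟩

/-- Points of the same parity in all coordinates. -/
def SameParity (p q : ℤ × ℤ × ℤ) : Prop :=
  p.1 % 2 = q.1 % 2 ∧ p.2.1 % 2 = q.2.1 % 2 ∧ p.2.2 % 2 = q.2.2 % 2

lemma eq_or_eq_neg_of_sameParity {p q v w : ℤ × ℤ × ℤ} (h : SameParity p q)
    (hv : v ∈ dirs) (hw : w ∈ dirs) (he : p + v = q + w) : w = v ∨ w = -v := by
  obtain ⟨a, b, c⟩ := p
  obtain ⟨a', b', c'⟩ := q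
  rw [mem_dirs] at hv hw
  simp only [SameParity] at h
  rcases hv with rfl | rfl | rfl | rfl | rfl | rfl <;>
    rcases hw with rfl | rfl | rfl | rfl | rfl | rfl <;>
    simp at he ⊢ <;> omega

lemma chainGraph_reachable_sameParity {p q : ℤ × ℤ × ℤ} (h : (chainGraph F).Reachable p q) :
    SameParity q p := by
  obtain ⟨w⟩ := h
  induction w with
  | nil => exact ⟨rfl, rfl, rfl⟩
  | cons hadj _ ih =>
    obtain ⟨v, _, rfl, _⟩ := hadj
    simp only [SameParity, Prod.fst_add, Prod.snd_add] at ih ⊢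
    omega

/-- A cycle that crosses the code an odd number of times contains a path
between the two open boundaries. -/
lemma IsCycle.exists_reachable (hF : IsCycle d L r F) (hr : r = 0 ∨ r = 1) (hd : 1 ≤ d)
    (h : lineParity d (project L r F) 0 ≠ 0) :
    ∃ i₀ t₀ i₁ t₁ : ℤ, i₀ % 2 = 0 ∧ 0 ≤ i₀ ∧ i₀ ≤ 2 * d - 2 ∧ t₀ % 2 = r ∧ 1 ≤ t₀ ∧ t₀ ≤ 2 * L ∧
      (chainGraph F).Reachable (i₀, -1, t₀) (i₁, 2 * d - 1, t₁) := by
  classical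
  by_contra hno
  push Not at hno
  set S : Set (ℤ × ℤ × ℤ) := {p | ∃ i₀ t₀ : ℤ, i₀ % 2 = 0 ∧ 0 ≤ i₀ ∧ i₀ ≤ 2 * d - 2 ∧
    t₀ % 2 = r ∧ 1 ≤ t₀ ∧ t₀ ≤ 2 * L ∧ (chainGraph F).Reachable (i₀, -1, t₀) p} with hS
  have hpar : ∀ i j t, (i, j, t) ∈ S → i % 2 = 0 ∧ j % 2 = 1 ∧ t % 2 = r := by
    rintro i j t ⟨i₀, t₀, h1, -, -, h2, -, -, h3⟩
    have := chainGraph_reachable_sameParity h3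
    simp only [SameParity] at this
    omega
  have hadj : ∀ p q, p ∈ S → (chainGraph F).Adj p q → q ∈ S := by
    rintro p q ⟨i₀, t₀, h1, h2, h3, h4, h5, h6, h7⟩ hpq
    exact ⟨i₀, t₀, h1, h2, h3, h4, h5, h6, h7.trans hpq.reachable⟩
  have hright : ∀ i t, (i, 2 * (d : ℤ) - 1, t) ∉ S := by
    rintro i t ⟨i₀, t₀, h1, h2, h3, h4, h5, h6, h7⟩
    exact hno i₀ t₀ i t h1 h2 h3 h4 h5 h6 h7
  set g : ℤ × ℤ × ℤ → ZMod 2 := fun m => if ∃ v ∈ dirs, m + v ∈ S then F m else 0 with hg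
  have hgF : ∀ m, g m ≠ 0 → F m ≠ 0 ∧ ∃ v ∈ dirs, m + v ∈ S := by
    intro m hm
    by_cases hc : ∃ v ∈ dirs, m + v ∈ S
    · simp only [hg, if_pos hc] at hm
      exact ⟨hm, hc⟩
    · simp only [hg, if_neg hc] at hm
      exact absurd rfl hm
  have hcyc : IsCycle d L r g := by
    refine ⟨fun i j t h => hF.supp i j t (hgF _ h).1, fun i j t hi hj ht h1 h2 => ?_⟩
    by_cases ha : (i, j, t) ∈ S
    · rw [← hF.closed i j t hi hj ht h1 h2]
      refine Finset.sum_congr rfl fun v hv => ?_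
      exact if_pos ⟨-v, neg_mem_dirs hv, by simpa using ha⟩
    · refine Finset.sum_eq_zero fun v hv => ?_
      by_contra hne
      obtain ⟨hFm, w, hw, hwS⟩ := hgF _ hne
      have hsp : SameParity (i, j, t) ((i, j, t) + v + w) := by
        have := hpar _ _ _ hwS
        simp only [SameParity, Prod.fst_add, Prod.snd_add] at this ⊢
        omega
      have he : (i, j, t) + v = ((i, j, t) + v + w) + (-w) := by abel
      rcases eq_or_eq_neg_of_sameParity hsp hv (neg_mem_dirs hw) he with h3 | h3
      · rw [← h3] at hwS
        exact ha (by simpa using hwS)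
      · rw [neg_inj] at h3
        subst h3
        exact ha (hadj _ _ hwS (SimpleGraph.Adj.symm ⟨w, hw, rfl, hFm⟩))
  have hl : lineParity d (project L r g) 0 = lineParity d (project L r F) 0 := by
    refine Finset.sum_congr rfl fun k _ => Finset.sum_congr rfl fun m _ => ?_
    by_cases hz : F (2 * k, 0, 2 * m + r) = 0
    · simp only [hg, hz, ite_self]
    · obtain ⟨h1, h2, -, -, h3, h4⟩ := hF.supp _ _ _ hz
      refine if_pos ⟨(0, -1, 0), by simp [dirs], ?_⟩
      simp only [Prod.mk_add_mk, add_zero, zero_add]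
      exact ⟨_, _, by omega, h1, h2, by omega, h3, h4, SimpleGraph.Reachable.refl _⟩
  have hrz : lineParity d (project L r g) (2 * ((d - 1 : ℕ) : ℤ)) = 0 := by
    refine Finset.sum_eq_zero fun k _ => Finset.sum_eq_zero fun m _ => ?_
    by_contra hne
    obtain ⟨hFm, v, hv, hvS⟩ := hgF _ hne
    have hd' : (2 * ((d - 1 : ℕ) : ℤ)) = 2 * d - 2 := by omega
    rw [hd'] at hFm hvS
    have hp := hpar _ _ _ hvS
    rw [mem_dirs] at hv
    rcases hv with rfl | rfl | rfl | rfl | rfl | rfl <;>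
      simp only [Prod.mk_add_mk, add_zero] at hvS hp
    · omega
    · omega
    · exact hright (2 * k) (2 * m + r) (by convert hvS using 3; ring)
    · refine hright (2 * k) (2 * m + r) (hadj _ _ hvS ⟨(0, 1, 0), by simp [dirs], ?_, ?_⟩)
      · simp only [Prod.mk_add_mk, add_zero, Prod.mk.injEq, true_and, and_true]; ring
      · simpa using hFm
    · omega
    · omega
  have hconst := lineParity_eq (U := project L r g) (d := d)
    (fun j => ⟨hcyc.project_eq_zero (by omega), hcyc.project_eq_zero (by omega)⟩)
    (fun i j hi hj h1 h2 => hcyc.project_closed hr hi hj h1 h2) (d - 1) (by omega)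
  exact h (by rw [← hl, ← hconst, hrz])

/-- Vertices visited from `p` in the directions `l`. -/
def verts : ℤ × ℤ × ℤ → List (ℤ × ℤ × ℤ) → List (ℤ × ℤ × ℤ)
  | p, [] => [p]
  | p, v :: l => p :: verts (p + v + v) l

/-- Edge midpoints traversed from `p` in the directions `l`. -/
def mids : ℤ × ℤ × ℤ → List (ℤ × ℤ × ℤ) → List (ℤ × ℤ × ℤ)
  | _, [] => []
  | p, v :: l => (p + v) :: mids (p + v + v) l

/-- Endpoint of the path from `p` in the directions `l`. -/
def pathEnd : ℤ × ℤ × ℤ → List (ℤ × ℤ × ℤ) → ℤ × ℤ × ℤ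
  | p, [] => p
  | p, v :: l => pathEnd (p + v + v) l

lemma length_mids (p : ℤ × ℤ × ℤ) (l : List (ℤ × ℤ × ℤ)) : (mids p l).length = l.length := by
  induction l generalizing p with
  | nil => rfl
  | cons v l ih => simp [mids, ih]

lemma mem_verts_self (p : ℤ × ℤ × ℤ) (l : List (ℤ × ℤ × ℤ)) : p ∈ verts p l := by
  cases l <;> simp [verts]

lemma exists_directions {p q : ℤ × ℤ × ℤ} (w : (chainGraph F).Walk p q) :
    ∃ l : List (ℤ × ℤ × ℤ), (∀ v ∈ l, v ∈ dirs) ∧ verts p l = w.support ∧ pathEnd p l = q ∧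
      ∀ m ∈ mids p l, F m ≠ 0 := by
  induction w with
  | nil => exact ⟨[], by simp, rfl, rfl, by simp [mids]⟩
  | cons hadj w ih =>
    obtain ⟨v, hv, hq, hFv⟩ := id hadj
    subst hq
    obtain ⟨l, h1, h2, h3, h4⟩ := ih
    refine ⟨v :: l, ?_, ?_, h3, ?_⟩
    · rintro x hx
      rcases List.mem_cons.1 hx with rfl | hx
      · exact hv
      · exact h1 x hx
    · exact congrArg (List.cons _) h2
    · intro m hm
      rcases List.mem_cons.1 hm with rfl | hm
      · exact hFv
      · exact h4 m hm

lemma exists_of_mem_mids {p m : ℤ × ℤ × ℤ} {l : List (ℤ × ℤ × ℤ)} (hl : ∀ v ∈ l, v ∈ dirs)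
    (hm : m ∈ mids p l) : ∃ q, ∃ v ∈ dirs, SameParity q p ∧ m = q + v ∧ q ∈ verts p l ∧
      q + v + v ∈ verts p l := by
  induction l generalizing p with
  | nil => simp [mids] at hm
  | cons v l ih =>
    rcases List.mem_cons.1 hm with rfl | hm
    · exact ⟨p, v, hl v (by simp), ⟨rfl, rfl, rfl⟩, rfl, by simp [verts],
        List.mem_cons_of_mem _ (mem_verts_self _ _)⟩
    · obtain ⟨q, w, hw, h1, h2, h3, h4⟩ := ih (fun x hx => hl x (by simp [hx])) hm
      refine ⟨q, w, hw, ?_, h2, List.mem_cons_of_mem _ h3, List.mem_cons_of_mem _ h4⟩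
      simp only [SameParity, Prod.fst_add, Prod.snd_add] at h1 ⊢
      omega

lemma nodup_mids {p : ℤ × ℤ × ℤ} {l : List (ℤ × ℤ × ℤ)} (hl : ∀ v ∈ l, v ∈ dirs)
    (h : (verts p l).Nodup) : (mids p l).Nodup := by
  induction l generalizing p with
  | nil => simp [mids]
  | cons v l ih =>
    rw [verts, List.nodup_cons] at h
    rw [mids, List.nodup_cons]
    refine ⟨fun hm => h.1 ?_, ih (fun x hx => hl x (by simp [hx])) h.2⟩
    obtain ⟨q, w, hw, h1, h2, h3, h4⟩ := exists_of_mem_mids (fun x hx => hl x (by simp [hx])) hm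
    have hsp : SameParity p q := by
      simp only [SameParity, Prod.fst_add, Prod.snd_add] at h1 ⊢
      omega
    rcases eq_or_eq_neg_of_sameParity hsp (hl v (by simp)) hw h2 with rfl | rfl
    · have hpq : q = p := (add_right_cancel h2).symm
      rw [hpq] at h3
      exact h3
    · have : q + -v + -v = p := by
        rw [← h2]; abel
      rw [this] at h4
      exact h4

/-- Direction sequences of length `n` that do not turn back, preceded by direction `v`. -/
def nonBacktracking : ℕ → ℤ × ℤ × ℤ → Finset (List (ℤ × ℤ × ℤ))
  | 0, _ => {[]}
  | n + 1, v => (dirs.erase (-v)).biUnion fun w => (nonBacktracking n w).image (List.cons w)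

lemma card_nonBacktracking (n : ℕ) {v : ℤ × ℤ × ℤ} (hv : v ∈ dirs) :
    (nonBacktracking n v).card ≤ 5 ^ n := by
  induction n generalizing v with
  | zero => simp [nonBacktracking]
  | succ n ih =>
    rw [nonBacktracking, pow_succ, mul_comm]
    have h5 : (dirs.erase (-v)).card = 5 := by
      rw [Finset.card_erase_of_mem (neg_mem_dirs hv), card_dirs]
    rw [← h5]
    refine Finset.card_biUnion_le_card_mul _ _ _ fun w hw => ?_
    exact Finset.card_image_le.trans (h5 ▸ ih (Finset.mem_of_mem_erase hw))

lemma card_nonBacktracking_zero (n : ℕ) : (nonBacktracking n 0).card ≤ 6 * 5 ^ n := by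
  cases n with
  | zero => simp [nonBacktracking]
  | succ n =>
    rw [nonBacktracking]
    have h6 : (dirs.erase (-0)).card ≤ 6 := (Finset.card_erase_le).trans card_dirs.le
    calc _ ≤ (dirs.erase (-0)).card * 5 ^ n :=
          Finset.card_biUnion_le_card_mul _ _ _ fun w hw =>
            Finset.card_image_le.trans (card_nonBacktracking n (Finset.mem_of_mem_erase hw))
      _ ≤ 6 * 5 ^ (n + 1) := by
          refine Nat.mul_le_mul h6 (Nat.pow_le_pow_right (by norm_num) (by omega))

lemma mem_nonBacktracking {p v : ℤ × ℤ × ℤ} {l : List (ℤ × ℤ × ℤ)} (hl : ∀ v ∈ l, v ∈ dirs)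
    (h : (verts (p + v + v) l).Nodup) (hp : v = 0 ∨ p ∉ verts (p + v + v) l) :
    l ∈ nonBacktracking l.length v := by
  induction l generalizing p v with
  | nil => simp [nonBacktracking]
  | cons w l ih =>
    rw [List.length_cons, nonBacktracking, Finset.mem_biUnion]
    have hw := hl w (by simp)
    rw [verts, List.nodup_cons] at h
    refine ⟨w, Finset.mem_erase.2 ⟨?_, hw⟩, Finset.mem_image.2 ⟨l, ?_, rfl⟩⟩
    · rintro rfl
      rcases hp with rfl | hp
      · revert hw; decide
      · refine hp (List.mem_cons_of_mem _ ?_)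
        have : p + v + v + -v + -v = p := by abel
        rw [this]
        exact mem_verts_self _ _
    · exact ih (fun x hx => hl x (by simp [hx])) h.2 (Or.inr h.1)

lemma sum_dirs_mids {p a : ℤ × ℤ × ℤ} {l : List (ℤ × ℤ × ℤ)} (hl : ∀ v ∈ l, v ∈ dirs)
    (ha : SameParity a p) : ∑ w ∈ dirs, ((mids p l).count (a + w) : ZMod 2) =
      (if a = p then 1 else 0) + if a = pathEnd p l then 1 else 0 := by
  induction l generalizing p with
  | nil =>
    simp only [mids, pathEnd, List.count_nil, Nat.cast_zero, Finset.sum_const_zero]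
    exact (CharTwo.add_self_eq_zero _).symm
  | cons v l ih =>
    have hv := hl v (by simp)
    have ha' : SameParity a (p + v + v) := by
      simp only [SameParity, Prod.fst_add, Prod.snd_add] at ha ⊢
      omega
    have h1 : ∀ w ∈ dirs, (if p + v = a + w then (1 : ZMod 2) else 0) =
        (if w = v then (if a = p then 1 else 0) else 0) +
          if w = -v then (if a = p + v + v then 1 else 0) else 0 := by
      intro w hw
      have hvn : v ≠ -v := by
        rw [mem_dirs] at hv
        rcases hv with rfl | rfl | rfl | rfl | rfl | rfl <;> decide
      by_cases h : p + v = a + w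
      · rw [if_pos h]
        have hsp : SameParity p a := by
          simp only [SameParity] at ha ⊢
          omega
        rcases eq_or_eq_neg_of_sameParity hsp hv hw h with rfl | rfl
        · rw [if_pos rfl, if_pos (add_right_cancel h).symm, if_neg hvn, add_zero]
        · rw [if_neg hvn.symm, if_pos rfl, if_pos (by rw [h]; abel), zero_add]
      · rw [if_neg h]
        have h2 : w = v → a ≠ p := by rintro rfl rfl; exact h rfl
        have h3 : w = -v → a ≠ p + v + v := by rintro rfl rfl; exact h (by abel)
        by_cases h4 : w = v
        · rw [if_pos h4, if_neg (h2 h4), zero_add]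
          by_cases h5 : w = -v
          · rw [if_pos h5, if_neg (h3 h5)]
          · rw [if_neg h5]
        · rw [if_neg h4, zero_add]
          by_cases h5 : w = -v
          · rw [if_pos h5, if_neg (h3 h5)]
          · rw [if_neg h5]
    have h2 : ∑ w ∈ dirs, (if p + v = a + w then (1 : ZMod 2) else 0) =
        (if a = p then 1 else 0) + if a = p + v + v then 1 else 0 := by
      rw [Finset.sum_congr rfl h1, Finset.sum_add_distrib, Finset.sum_ite_eq', Finset.sum_ite_eq',
        if_pos hv, if_pos (neg_mem_dirs hv)]
    rw [pathEnd]
    simp only [mids, List.count_cons, beq_iff_eq, Nat.cast_add, Nat.cast_ite, Nat.cast_one,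
      Nat.cast_zero, Finset.sum_add_distrib]
    rw [ih (fun x hx => hl x (by simp [hx])) ha', h2]
    linear_combination CharTwo.add_self_eq_zero (if a = p + v + v then (1 : ZMod 2) else 0)

lemma notMem_mids {p a w : ℤ × ℤ × ℤ} {l : List (ℤ × ℤ × ℤ)} (hl : ∀ v ∈ l, v ∈ dirs)
    (ha : SameParity a (p + (1, 1, 1))) (hw : w ∈ dirs) : a + w ∉ mids p l := by
  intro hm
  obtain ⟨q, v, hv, h1, h2, -, -⟩ := exists_of_mem_mids hl hm
  obtain ⟨a1, a2, a3⟩ := a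
  obtain ⟨p1, p2, p3⟩ := p
  obtain ⟨q1, q2, q3⟩ := q
  simp only [SameParity, Prod.mk_add_mk] at ha h1
  rw [mem_dirs] at hv hw
  rcases hv with rfl | rfl | rfl | rfl | rfl | rfl <;>
    rcases hw with rfl | rfl | rfl | rfl | rfl | rfl <;>
    simp at h2 <;> omega

lemma pathEnd_le {p : ℤ × ℤ × ℤ} {l : List (ℤ × ℤ × ℤ)} (hl : ∀ v ∈ l, v ∈ dirs) :
    (pathEnd p l).2.1 ≤ p.2.1 + 2 * l.length := by
  induction l generalizing p with
  | nil => simp [pathEnd]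
  | cons v l ih =>
    have h1 := ih (p := p + v + v) (fun x hx => hl x (by simp [hx]))
    have h2 : v.2.1 ≤ 1 := by
      have hv := hl v (by simp)
      rw [mem_dirs] at hv
      rcases hv with rfl | rfl | rfl | rfl | rfl | rfl <;> simp
    rw [pathEnd, List.length_cons]
    simp only [Prod.snd_add, Prod.fst_add] at h1
    push_cast
    linarith

/-- A cycle that crosses the code an odd number of times contains a self-avoiding path between the
two open boundaries. -/
lemma IsCycle.exists_path (hF : IsCycle d L r F) (hr : r = 0 ∨ r = 1) (hd : 1 ≤ d)
    (h : lineParity d (project L r F) 0 ≠ 0) :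
    ∃ i₀ t₀ : ℤ, i₀ % 2 = 0 ∧ 0 ≤ i₀ ∧ i₀ ≤ 2 * d - 2 ∧ t₀ % 2 = r ∧ 1 ≤ t₀ ∧ t₀ ≤ 2 * L ∧
      ∃ l : List (ℤ × ℤ × ℤ), (∀ v ∈ l, v ∈ dirs) ∧ d ≤ l.length ∧
        l ∈ nonBacktracking l.length 0 ∧ (mids (i₀, -1, t₀) l).Nodup ∧
        (∀ m ∈ mids (i₀, -1, t₀) l, F m ≠ 0) ∧
        (pathEnd (i₀, -1, t₀) l).2.1 = 2 * d - 1 := by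
  obtain ⟨i₀, t₀, i₁, t₁, h1, h2, h3, h4, h5, h6, hreach⟩ := hF.exists_reachable hr hd h
  obtain ⟨w, hw⟩ := hreach.exists_isPath
  obtain ⟨l, hl, hv, he, hm⟩ := exists_directions w
  have hnd : (verts (i₀, -1, t₀) l).Nodup := hv ▸ hw.support_nodup
  refine ⟨i₀, t₀, h1, h2, h3, h4, h5, h6, l, hl, ?_, ?_, nodup_mids hl hnd, hm, by rw [he]⟩
  · have := pathEnd_le (p := (i₀, -1, t₀)) hl
    rw [he] at this
    simp only at this
    omega
  · exact mem_nonBacktracking (p := (i₀, -1, t₀)) (v := 0) hl (by simpa using hnd) (Or.inl rfl)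

end Lattice

/-! ### Chains of faults

The cells of `X` checks form one sublattice; exchanging the two spatial axes puts those of `Z`
checks into the same shape, with the other parity of the time coordinate. -/

section Chains

variable {d L : ℕ}

/-- The point of `ℤ³` at a grid position, with the spatial axes exchanged if `b`. -/
def place (b : Bool) (p : ℕ × ℕ × ℕ) : ℤ × ℤ × ℤ :=
  bif b then (p.2.1, p.1, p.2.2) else (p.1, p.2.1, p.2.2)

/-- The parity of the time coordinate of the cells in the sublattice selected by `b`. -/
def timeParity (b : Bool) : ℤ := bif b then 1 else 0

lemma timeParity_cases (b : Bool) : timeParity b = 0 ∨ timeParity b = 1 := by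
  cases b <;> simp [timeParity]

lemma place_injective (b : Bool) : Function.Injective (place b) := by
  rintro ⟨i, j, t⟩ ⟨i', j', t'⟩ h
  cases b <;> simp [place] at h ⊢ <;> omega

lemma mk_mem_dirs {x y z : ℤ} :
    (x, y, z) ∈ dirs ↔ x.natAbs + y.natAbs + z.natAbs = 1 := by
  simp only [mem_dirs, Prod.mk.injEq]
  omega

lemma near_iff_place (b : Bool) (p q : ℕ × ℕ × ℕ) :
    Near p q ↔ place b q - place b p ∈ dirs := by
  obtain ⟨i, j, t⟩ := p
  obtain ⟨i', j', t'⟩ := q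
  cases b <;> simp only [Near, place, cond_true, cond_false, Prod.mk_sub_mk, mk_mem_dirs] <;> omega

/-- The function on `ℤ³` given by bits at grid positions. -/
def spread {ι : Type} [Fintype ι] (b : Bool) (pos : ι → ℕ × ℕ × ℕ) (w : ι → ZMod 2)
    (x : ℤ × ℤ × ℤ) : ZMod 2 :=
  ∑ v, if place b (pos v) = x then w v else 0

lemma sum_near_eq {ι : Type} [Fintype ι] (b : Bool) (pos : ι → ℕ × ℕ × ℕ) (w : ι → ZMod 2)
    (p : ℕ × ℕ × ℕ) : ∑ v, (if Near p (pos v) then w v else 0) =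
      ∑ δ ∈ dirs, spread b pos w (place b p + δ) := by
  simp only [spread]
  rw [Finset.sum_comm]
  refine Finset.sum_congr rfl fun v _ => ?_
  simp only [← sub_eq_iff_eq_add']
  rw [Finset.sum_ite_eq]
  simp only [near_iff_place b]

lemma spread_place {ι : Type} [Fintype ι] (b : Bool) {pos : ι → ℕ × ℕ × ℕ}
    (hpos : Function.Injective pos) (w : ι → ZMod 2) (v : ι) :
    spread b pos w (place b (pos v)) = w v := by
  classical
  simp only [spread, (place_injective b).eq_iff, hpos.eq_iff]
  simp

lemma exists_of_spread_ne_zero {ι : Type} [Fintype ι] {b : Bool} {pos : ι → ℕ × ℕ × ℕ}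
    {w : ι → ZMod 2} {x : ℤ × ℤ × ℤ} (h : spread b pos w x ≠ 0) :
    ∃ v, place b (pos v) = x ∧ w v ≠ 0 := by
  obtain ⟨v, -, hv⟩ := Finset.exists_ne_zero_of_sum_ne_zero h
  by_cases hx : place b (pos v) = x
  · exact ⟨v, hx, by rwa [if_pos hx] at hv⟩
  · exact absurd (if_neg hx) hv

/-- Grid position of a noisy qubit. -/
def Noisy.pos (v : Noisy d L) : ℕ × ℕ × ℕ := v.1.pos

lemma Noisy.pos_injective : Function.Injective (Noisy.pos : Noisy d L → ℕ × ℕ × ℕ) :=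
  Qubit.pos_injective.comp Subtype.val_injective

/-- The chain of a fault pattern. -/
def chain (b : Bool) (f : Noisy d L → ZMod 2) : ℤ × ℤ × ℤ → ZMod 2 := spread b Noisy.pos f

lemma sum_extend (f : Noisy d L → ZMod 2) (P : Qubit d L → Prop) [DecidablePred P] :
    ∑ v, (if P v then extend f v else 0) = ∑ v : Noisy d L, if P v.1 then f v else 0 := by
  rw [← Fintype.sum_subtype_add_sum_subtype (fun v : Qubit d L => 0 < (v.1.2.2 : ℕ))]
  have h : ∑ v : {v : Qubit d L // ¬ 0 < (v.1.2.2 : ℕ)}, (if P v.1 then extend f v.1 else 0) = 0 :=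
    Finset.sum_eq_zero fun v _ => by rw [extend, dif_neg v.2, ite_self]
  rw [h, add_zero]
  refine Finset.sum_congr rfl fun v _ => ?_
  rw [extend, dif_pos v.2]

lemma faultSyndrome_eq (b : Bool) (f : Noisy d L → ZMod 2) (a : Cell d L) :
    faultSyndrome f a = ∑ δ ∈ dirs, chain b f (place b a.pos + δ) := by
  rw [faultSyndrome, cellParity, sum_extend f fun v => Near a.pos v.pos]
  exact sum_near_eq b Noisy.pos f a.pos

lemma exists_of_chain_ne_zero {b : Bool} {f : Noisy d L → ZMod 2} {x : ℤ × ℤ × ℤ}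
    (h : chain b f x ≠ 0) : ∃ v : Noisy d L, place b v.pos = x ∧ f v ≠ 0 :=
  exists_of_spread_ne_zero h

lemma chain_place (b : Bool) (f : Noisy d L → ZMod 2) (v : Noisy d L) :
    chain b f (place b v.pos) = f v :=
  spread_place b Noisy.pos_injective f v

lemma chain_supp (b : Bool) (f : Noisy d L → ZMod 2) (i j t : ℤ) (h : chain b f (i, j, t) ≠ 0) :
    0 ≤ i ∧ i ≤ 2 * d - 2 ∧ 0 ≤ j ∧ j ≤ 2 * d - 2 ∧ 1 ≤ t ∧ t ≤ 2 * L := by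
  obtain ⟨v, hv, -⟩ := exists_of_chain_ne_zero h
  have h1 := v.1.1.1.2
  have h2 := v.1.1.2.1.2
  have h3 := v.1.1.2.2.2
  have h4 := v.2
  cases b <;> simp [place, Noisy.pos, Qubit.pos] at hv <;> omega

lemma isCycle_chain {f : Noisy d L → ZMod 2} (hf : faultSyndrome f = 0) (b : Bool) :
    IsCycle d L (timeParity b) (chain b f) := by
  refine ⟨chain_supp b f, fun i j t hi hj ht h1 h2 => ?_⟩
  by_cases hin : 0 ≤ i ∧ i ≤ 2 * d - 2 ∧ 0 ≤ t ∧ t ≤ 2 * L + 1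
  · obtain ⟨hi1, hi2, ht1, ht2⟩ := hin
    obtain ⟨i, rfl⟩ := Int.eq_ofNat_of_zero_le hi1
    obtain ⟨j, rfl⟩ := Int.eq_ofNat_of_zero_le (by omega : 0 ≤ j)
    obtain ⟨t, rfl⟩ := Int.eq_ofNat_of_zero_le ht1
    obtain ⟨a, ha⟩ : ∃ a : Cell d L, place b a.pos = ((i : ℤ), (j : ℤ), (t : ℤ)) := by
      cases b
      · refine ⟨⟨(⟨i, by omega⟩, ⟨j, by omega⟩, ⟨t, by omega⟩), Or.inl ?_⟩, rfl⟩
        simp only [timeParity, cond_false] at ht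
        simp only [IsXCheck, Nat.even_iff, Nat.odd_iff]
        omega
      · refine ⟨⟨(⟨j, by omega⟩, ⟨i, by omega⟩, ⟨t, by omega⟩), Or.inr ?_⟩, rfl⟩
        simp only [timeParity, cond_true] at ht
        simp only [IsZCheck, Nat.even_iff, Nat.odd_iff]
        omega
    rw [← ha, ← faultSyndrome_eq, hf, Pi.zero_apply]
  · refine Finset.sum_eq_zero fun v hv => ?_
    by_contra hne
    have hs := chain_supp b f _ _ _ hne
    rw [mem_dirs] at hv
    rcases hv with rfl | rfl | rfl | rfl | rfl | rfl <;> simp only at hs <;> omega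

/-! ### Residual errors -/

/-- Position of a data qubit or check in slice `0`. -/
def sitePos (q : Fin (2 * d - 1) × Fin (2 * d - 1)) : ℕ × ℕ × ℕ := (q.1, q.2, 0)

/-- The residual error of one type: the projection of the chain of faults. -/
def residual (b : Bool) (f : Noisy d L → ZMod 2) : Bits (Data d) := fun q =>
  project L (timeParity b) (chain b f) (place b (sitePos q.1)).1 (place b (sitePos q.1)).2.1

lemma extend_dataAt (b : Bool) (f : Noisy d L → ZMod 2) (t : Fin (2 * L + 1)) (q : Data d) :
    extend f (dataAt t q) = chain b f (place b (q.1.1, q.1.2, t)) := by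
  by_cases h : 0 < (t : ℕ)
  · rw [extend, dif_pos (show 0 < ((dataAt t q : Qubit d L).1.2.2 : ℕ) from h)]
    exact (chain_place b f ⟨dataAt t q, h⟩).symm
  · rw [extend, dif_neg (show ¬ 0 < ((dataAt t q : Qubit d L).1.2.2 : ℕ) from h)]
    by_contra hne
    have h1 := chain_supp b f (place b (q.1.1, q.1.2, t)).1 (place b (q.1.1, q.1.2, t)).2.1
      (place b (q.1.1, q.1.2, t)).2.2 (Ne.symm hne)
    cases b <;> simp only [place, cond_true, cond_false] at h1 <;> omega

lemma sum_range_even (G : ℕ → ZMod 2) (L : ℕ) :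
    ∑ t ∈ Finset.range (2 * L + 1), (if Even t then G t else 0) =
      ∑ k ∈ Finset.range (L + 1), G (2 * k) := by
  induction L with
  | zero => simp
  | succ L ih =>
    rw [show 2 * (L + 1) + 1 = 2 * L + 1 + 1 + 1 by ring, Finset.sum_range_succ,
      Finset.sum_range_succ, ih, Finset.sum_range_succ _ (L + 1)]
    have h1 : ¬ Even (2 * L + 1) := by simp
    have h2 : Even (2 * L + 1 + 1) := ⟨L + 1, by ring⟩
    rw [if_neg h1, if_pos h2, add_zero]
    rfl

lemma sum_range_odd (G : ℕ → ZMod 2) (L : ℕ) :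
    ∑ t ∈ Finset.range (2 * L + 1), (if Odd t then G t else 0) =
      ∑ k ∈ Finset.range L, G (2 * k + 1) := by
  induction L with
  | zero => simp
  | succ L ih =>
    rw [show 2 * (L + 1) + 1 = 2 * L + 1 + 1 + 1 by ring, Finset.sum_range_succ,
      Finset.sum_range_succ, ih, Finset.sum_range_succ _ L]
    have h1 : Odd (2 * L + 1) := by simp
    have h2 : ¬ Odd (2 * L + 1 + 1) := by rw [Nat.odd_iff]; omega
    rw [if_pos h1, if_neg h2, add_zero]

lemma zPart_extend (f : Noisy d L → ZMod 2) : zPart (extend f) = residual false f := by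
  ext q
  have h := sum_range_even (fun t => chain false f (place false (q.1.1, q.1.2, t))) L
  rw [Finset.sum_range] at h
  rw [zPart, residual, project]
  simp only [extend_dataAt false]
  rw [h]
  refine Finset.sum_congr rfl fun k _ => ?_
  simp [place, timeParity, sitePos]

lemma xPart_extend (f : Noisy d L → ZMod 2) : xPart (extend f) = residual true f := by
  ext q
  have h := sum_range_odd (fun t => chain true f (place true (q.1.1, q.1.2, t))) L
  rw [Finset.sum_range] at h
  rw [xPart, residual, project, Finset.sum_range_succ]
  have h0 : chain true f ((place true (sitePos q.1)).1, (place true (sitePos q.1)).2.1,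
      2 * (L : ℤ) + timeParity true) = 0 := by
    by_contra hne
    have := chain_supp true f _ _ _ hne
    simp only [timeParity, cond_true] at this
    omega
  simp only [extend_dataAt true]
  rw [h, h0, add_zero]
  refine Finset.sum_congr rfl fun k _ => ?_
  simp [place, timeParity, sitePos]

lemma residual_dotProduct_eq_zero {f : Noisy d L → ZMod 2} (hf : faultSyndrome f = 0) (b : Bool)
    (h0 : lineParity d (project L (timeParity b) (chain b f)) 0 = 0) {α : Bits (Data d)}
    (hα : ∀ c : Check d, (place b (sitePos c.1)).1 % 2 = 1 → support c ⬝ᵥ α = 0) :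
    residual b f ⬝ᵥ α = 0 := by
  have hcyc := isCycle_chain hf b
  obtain ⟨W, hW, hU⟩ := exists_boundary
    (fun j => ⟨hcyc.project_eq_zero (by omega), hcyc.project_eq_zero (by omega)⟩)
    (fun i j hi hj h1 h2 => hcyc.project_closed (timeParity_cases b) hi hj h1 h2) h0
  set w : Check d → ZMod 2 := fun c => W (place b (sitePos c.1)).1 (place b (sitePos c.1)).2.1
    with hw
  have hinj : Function.Injective fun c : Check d => sitePos c.1 := by
    rintro ⟨⟨i, j⟩, hc⟩ ⟨⟨i', j'⟩, hc'⟩ h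
    simp only [sitePos, Prod.mk.injEq, and_true] at h
    simp only [Subtype.mk.injEq, Prod.mk.injEq, Fin.ext_iff]
    exact h
  have hspread : ∀ i j : ℤ, spread b (fun c : Check d => sitePos c.1) w (i, j, 0) = W i j := by
    intro i j
    by_cases hWz : W i j = 0
    · rw [hWz]
      by_contra hne
      obtain ⟨c, hc, hwc⟩ := exists_of_spread_ne_zero hne
      simp only [hw, hc] at hwc
      exact hwc hWz
    · obtain ⟨h1, h2, h3, h4, h5, h6⟩ := hW i j hWz
      obtain ⟨i, rfl⟩ := Int.eq_ofNat_of_zero_le h3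
      obtain ⟨j, rfl⟩ := Int.eq_ofNat_of_zero_le h5
      obtain ⟨c, hc⟩ : ∃ c : Check d, place b (sitePos c.1) = ((i : ℤ), (j : ℤ), (0 : ℤ)) := by
        cases b
        · refine ⟨⟨(⟨i, by omega⟩, ⟨j, by omega⟩), Or.inr ?_⟩, rfl⟩
          simp only [IsZCheck, Nat.even_iff, Nat.odd_iff]
          omega
        · refine ⟨⟨(⟨j, by omega⟩, ⟨i, by omega⟩), Or.inl ?_⟩, rfl⟩
          simp only [IsXCheck, Nat.even_iff, Nat.odd_iff]
          omega
      rw [← hc]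
      refine (spread_place b hinj w c).trans ?_
      simp only [hw, hc]
  have hspread' : ∀ i j t : ℤ, t ≠ 0 →
      spread b (fun c : Check d => sitePos c.1) w (i, j, t) = 0 := by
    intro i j t ht
    by_contra hne
    obtain ⟨c, hc, -⟩ := exists_of_spread_ne_zero hne
    apply ht
    have := congrArg (fun x => x.2.2) hc
    cases b <;> simpa [place, sitePos] using this.symm
  have hres : ∀ q : Data d, residual b f q = ∑ c : Check d, w c * support c q := by
    intro q
    have hs := sum_near_eq b (fun c : Check d => sitePos c.1) w (sitePos q.1)
    obtain ⟨i, j, hij⟩ : ∃ i j, place b (sitePos q.1) = (i, j, 0) := by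
      cases b <;> exact ⟨_, _, rfl⟩
    have hq1 := q.1.1.2
    have hq2 := q.1.2.2
    have hq := q.2
    simp only [IsData, Nat.even_iff] at hq
    rw [hij, sum_dirs, hspread, hspread, hspread, hspread, hspread' _ _ _ (by norm_num),
      hspread' _ _ _ (by norm_num), add_zero, add_zero] at hs
    rw [residual, hij, hU i j]
    · rw [← hs]
      refine Finset.sum_congr rfl fun c _ => ?_
      rw [support, mul_ite, mul_one, mul_zero]
      exact if_congr (near_comm _ _) rfl rfl
    all_goals cases b <;> simp [place, sitePos] at hij <;> omega
  have h1 : residual b f ⬝ᵥ α = ∑ c : Check d, w c * (support c ⬝ᵥ α) := by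
    simp only [dotProduct, hres, Finset.sum_mul, Finset.mul_sum]
    rw [Finset.sum_comm]
    simp only [mul_assoc]
  rw [h1]
  refine Finset.sum_eq_zero fun c _ => ?_
  by_cases hc : w c = 0
  · rw [hc, zero_mul]
  · rw [hα c (hW _ _ hc).1, mul_zero]

/-! ### Failure of minimum-weight decoding -/

/-- The qubits on a path. -/
def pathQubits (b : Bool) (p : ℤ × ℤ × ℤ) (l : List (ℤ × ℤ × ℤ)) : Finset (Noisy d L) :=
  Finset.univ.filter fun v => place b v.pos ∈ mids p l

lemma card_pathQubits {b : Bool} {f : Noisy d L → ZMod 2} {p : ℤ × ℤ × ℤ}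
    {l : List (ℤ × ℤ × ℤ)} (hnd : (mids p l).Nodup) (hF : ∀ m ∈ mids p l, chain b f m ≠ 0) :
    (pathQubits b p l : Finset (Noisy d L)).card = l.length := by
  rw [← length_mids p l, ← List.toFinset_card_of_nodup hnd]
  refine Finset.card_bij (fun v _ => place b v.pos) ?_ ?_ ?_
  · intro v hv
    exact List.mem_toFinset.2 (Finset.mem_filter.1 hv).2
  · intro v _ v' _ h
    exact Noisy.pos_injective (place_injective b h)
  · intro m hm
    obtain ⟨v, hv, -⟩ := exists_of_chain_ne_zero (hF m (List.mem_toFinset.1 hm))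
    exact ⟨v, Finset.mem_filter.2 ⟨Finset.mem_univ _, hv ▸ List.mem_toFinset.1 hm⟩, hv⟩

/-- The chain of faults along a path between the open boundaries is not detected. -/
lemma faultSyndrome_pathQubits {b : Bool} {f : Noisy d L → ZMod 2} {i₀ t₀ : ℤ}
    {l : List (ℤ × ℤ × ℤ)} (hi : i₀ % 2 = 0) (ht : t₀ % 2 = timeParity b)
    (hl : ∀ v ∈ l, v ∈ dirs) (hnd : (mids (i₀, -1, t₀) l).Nodup)
    (hF : ∀ m ∈ mids (i₀, -1, t₀) l, chain b f m ≠ 0)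
    (hend : (pathEnd (i₀, -1, t₀) l).2.1 = 2 * d - 1) :
    faultSyndrome (fun v : Noisy d L => if v ∈ pathQubits b (i₀, -1, t₀) l then 1 else 0) = 0 := by
  ext a
  have hcount : ∀ x, chain b (fun v : Noisy d L =>
      if v ∈ pathQubits b (i₀, -1, t₀) l then 1 else 0) x = ((mids (i₀, -1, t₀) l).count x : ZMod 2) := by
    intro x
    by_cases hx : x ∈ mids (i₀, -1, t₀) l
    · obtain ⟨v, rfl, -⟩ := exists_of_chain_ne_zero (hF x hx)
      rw [chain_place, List.count_eq_one_of_mem hnd hx, Nat.cast_one, if_pos]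
      exact Finset.mem_filter.2 ⟨Finset.mem_univ _, hx⟩
    · rw [List.count_eq_zero_of_not_mem hx, Nat.cast_zero]
      by_contra hne
      obtain ⟨v, rfl, hv⟩ := exists_of_chain_ne_zero hne
      by_cases hm : v ∈ (pathQubits b (i₀, -1, t₀) l : Finset (Noisy d L))
      · exact hx (Finset.mem_filter.1 hm).2
      · exact hv (if_neg hm)
  rw [faultSyndrome_eq b]
  simp only [hcount]
  have h1 := a.1.1.2
  have h2 := a.1.2.1.2
  have ha := a.2
  simp only [IsXCheck, IsZCheck, Nat.even_iff, Nat.odd_iff] at ha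
  have hpar : SameParity (place b a.pos) (i₀, -1, t₀) ∨
      SameParity (place b a.pos) ((i₀, -1, t₀) + (1, 1, 1)) := by
    cases b <;> simp only [SameParity, place, Cell.pos, timeParity, cond_true, cond_false,
      Prod.mk_add_mk] at ht ⊢ <;> omega
  have hj : 0 ≤ (place b a.pos).2.1 ∧ (place b a.pos).2.1 ≤ 2 * d - 2 := by
    cases b <;> simp only [place, Cell.pos, cond_true, cond_false] <;> omega
  rcases hpar with hpar | hpar
  · rw [sum_dirs_mids hl hpar, if_neg, if_neg, add_zero]
    · rfl
    · intro h
      rw [h] at hj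
      omega
    · intro h
      rw [h] at hj
      simp only at hj
      omega
  · refine Finset.sum_eq_zero fun w hw => ?_
    rw [List.count_eq_zero_of_not_mem (notMem_mids hl hpar hw), Nat.cast_zero]

lemma card_le_two_mul_of_weight_le {Γ : Finset (Noisy d L)} {e e' : Noisy d L → ZMod 2}
    (hee : ∀ v ∈ Γ, e v + e' v = 1)
    (hw : weight e' ≤ weight (e' + fun v => if v ∈ Γ then 1 else 0)) :
    Γ.card ≤ 2 * (Γ.filter fun v => e v = 1).card := by
  have hsplit : ∀ g : Noisy d L → ZMod 2, weight g = (Γ.filter fun v => g v = 1).card +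
      (Γᶜ.filter fun v => g v = 1).card := by
    intro g
    rw [weight, ← Finset.card_union_of_disjoint, ← Finset.filter_union, Finset.union_compl]
    exact Finset.disjoint_filter_filter disjoint_compl_right
  have hbit : ∀ x y : ZMod 2, x + y = 1 → ((y + 1 = 1 ↔ x = 1) ∧ (¬ x = 1 ↔ y = 1)) := by decide
  rw [hsplit, hsplit (e' + _)] at hw
  have hin : (Γ.filter fun v => (e' + fun v => if v ∈ Γ then 1 else 0 : Noisy d L → ZMod 2) v = 1) =
      Γ.filter fun v => e v = 1 := by
    refine Finset.filter_congr fun v hv => ?_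
    rw [Pi.add_apply, if_pos hv]
    exact (hbit _ _ (hee v hv)).1
  have hout : (Γᶜ.filter fun v => (e' + fun v => if v ∈ Γ then 1 else 0 : Noisy d L → ZMod 2) v = 1) =
      Γᶜ.filter fun v => e' v = 1 := by
    refine Finset.filter_congr fun v hv => ?_
    rw [Pi.add_apply, if_neg (Finset.mem_compl.1 hv), add_zero]
  have htot : (Γ.filter fun v => e v = 1).card + (Γ.filter fun v => e' v = 1).card = Γ.card := by
    rw [← Finset.filter_congr fun v hv => (hbit _ _ (hee v hv)).2]
    exact Finset.card_filter_add_card_filter_not _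
  rw [hin, hout] at hw
  omega

/-- If minimum-weight decoding fails, at least half of the qubits on some long path are faulty. -/
lemma exists_path_of_not_corrects {D : Decoder d L} (hD : IsMinimumWeight D) (hd : 1 ≤ d)
    {e : Noisy d L → ZMod 2} (he : ¬ Corrects D e) :
    ∃ (b : Bool) (i₀ t₀ : ℤ), 0 ≤ i₀ ∧ i₀ ≤ 2 * d - 2 ∧ 1 ≤ t₀ ∧ t₀ ≤ 2 * L ∧
      ∃ l : List (ℤ × ℤ × ℤ), d ≤ l.length ∧ l ∈ nonBacktracking l.length 0 ∧
        (pathQubits b (i₀, -1, t₀) l : Finset (Noisy d L)).card = l.length ∧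
        l.length ≤ 2 * ((pathQubits b (i₀, -1, t₀) l).filter fun v : Noisy d L => e v = 1).card := by
  obtain ⟨e', hs, hmin, hDs⟩ := hD (faultSyndrome e) ⟨e, rfl⟩
  have hsyn : ∀ f g : Noisy d L → ZMod 2, faultSyndrome (f + g) =
      faultSyndrome f + faultSyndrome g := by
    intro f g
    ext a
    rw [faultSyndrome, extend_add, cellParity_add]
    rfl
  have hf : faultSyndrome (e + e') = 0 := by
    rw [hsyn, hs, bits_add_self]
  obtain ⟨b, hb⟩ : ∃ b, lineParity d (project L (timeParity b) (chain b (e + e'))) 0 ≠ 0 := by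
    by_contra hno
    push Not at hno
    refine he ⟨fun β hβ => ?_, fun α hα => ?_⟩
    · rw [hDs, ← xPart_add, ← extend_add, xPart_extend]
      refine residual_dotProduct_eq_zero hf true (hno true) fun c hc => hβ c ?_
      have := c.2
      simp only [place, sitePos, cond_true] at hc
      simp only [IsXCheck, IsZCheck, Nat.even_iff, Nat.odd_iff] at this ⊢
      omega
    · rw [hDs, ← zPart_add, ← extend_add, zPart_extend]
      refine residual_dotProduct_eq_zero hf false (hno false) fun c hc => hα c ?_
      have := c.2
      simp only [place, sitePos, cond_false] at hc
      simp only [IsXCheck, IsZCheck, Nat.even_iff, Nat.odd_iff] at this ⊢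
      omega
  obtain ⟨i₀, t₀, h1, h2, h3, h4, h5, h6, l, hl, hlen, hnb, hnd, hF, hend⟩ :=
    (isCycle_chain hf b).exists_path (timeParity_cases b) hd hb
  have hcard := card_pathQubits hnd hF
  refine ⟨b, i₀, t₀, h2, h3, h5, h6, l, hlen, hnb, hcard, ?_⟩
  set Γ : Finset (Noisy d L) := pathQubits b (i₀, -1, t₀) l with hΓ
  have hee : ∀ v ∈ Γ, e v + e' v = 1 := by
    intro v hv
    have := hF _ (Finset.mem_filter.1 hv).2
    rw [chain_place] at this
    exact (zmod_two_cases _).resolve_left this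
  have hw := hmin (e' + fun v => if v ∈ Γ then 1 else 0) (by
    rw [hsyn, hs, faultSyndrome_pathQubits h1 h4 hl hnd hF hend, add_zero])
  rw [← hcard]
  exact card_le_two_mul_of_weight_le hee hw

end Chains

/-! ### The decoding graph -/

section DecodingGraph

variable {d L : ℕ}

lemma Cell.pos_injective : Function.Injective (Cell.pos : Cell d L → ℕ × ℕ × ℕ) := by
  rintro ⟨⟨a, b, c⟩, h⟩ ⟨⟨a', b', c'⟩, h'⟩ hp
  simp only [Cell.pos, Prod.mk.injEq] at hp
  simp only [Subtype.mk.injEq, Prod.mk.injEq, Fin.ext_iff]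
  exact hp

lemma exists_dirs_of_adj {a b : Cell d L} (h : (decodingGraph d L).Adj a b) :
    ∃ v ∈ dirs, place false a.pos + v + v = place false b.pos := by
  obtain ⟨hab, u, hau, hbu⟩ := h
  rw [near_iff_place false] at hau hbu
  set x := place false u.1.pos with hx
  have hsp : SameParity (place false a.pos) (place false b.pos) := by
    have ha := a.2
    have hb := b.2
    simp only [IsXCheck, IsZCheck, Nat.even_iff, Nat.odd_iff] at ha hb
    have h1 := mk_mem_dirs.1 (show (x.1 - ((a.1.1 : ℕ) : ℤ), x.2.1 - ((a.1.2.1 : ℕ) : ℤ),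
      x.2.2 - ((a.1.2.2 : ℕ) : ℤ)) ∈ dirs from hau)
    have h2 := mk_mem_dirs.1 (show (x.1 - ((b.1.1 : ℕ) : ℤ), x.2.1 - ((b.1.2.1 : ℕ) : ℤ),
      x.2.2 - ((b.1.2.2 : ℕ) : ℤ)) ∈ dirs from hbu)
    simp only [SameParity, place, cond_false, Cell.pos]
    rcases ha with ha | ha <;> rcases hb with hb | hb <;> omega
  have he : place false a.pos + (x - place false a.pos) =
      place false b.pos + (x - place false b.pos) := by abel
  rcases eq_or_eq_neg_of_sameParity hsp hau hbu he with h1 | h1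
  · exact absurd (Cell.pos_injective (place_injective false (sub_right_injective h1))).symm hab
  · refine ⟨_, hau, ?_⟩
    rw [eq_comm, ← sub_sub_cancel x (place false b.pos), h1]
    abel

lemma ncard_neighborSet_le (a : Cell d L) : ((decodingGraph d L).neighborSet a).ncard ≤ 6 := by
  classical
  rw [← Set.ncard_image_of_injective _ ((place_injective false).comp Cell.pos_injective),
    ← card_dirs]
  refine le_trans (Set.ncard_le_ncard (t := ↑(dirs.image fun v => place false a.pos + v + v)) ?_
    (Finset.finite_toSet _)) ?_
  · rintro _ ⟨b, hb, rfl⟩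
    obtain ⟨v, hv, h⟩ := exists_dirs_of_adj hb
    exact Finset.mem_coe.2 (Finset.mem_image.2 ⟨v, hv, h⟩)
  · rw [Set.ncard_coe_finset]
    exact Finset.card_image_le

end DecodingGraph

/-! ### Probability of a logical error -/

section Probability

variable {d L : ℕ}

lemma sum_faultProb_mul_prod (p x y : ℝ) (Γ : Finset (Noisy d L)) :
    ∑ e : Noisy d L → ZMod 2, faultProb p e * ∏ v ∈ Γ, (if e v = 1 then x else y) =
      (p * x + (1 - p) * y) ^ Γ.card := by
  have h := Finset.prod_univ_sum (fun _ : Noisy d L => (Finset.univ : Finset (ZMod 2)))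
    (fun v b => (if b = 1 then p else 1 - p) * if v ∈ Γ then (if b = 1 then x else y) else 1)
  rw [Fintype.piFinset_univ] at h
  have h1 : ∀ e : Noisy d L → ZMod 2, faultProb p e * ∏ v ∈ Γ, (if e v = 1 then x else y) =
      ∏ v, ((if e v = 1 then p else 1 - p) *
        if v ∈ Γ then (if e v = 1 then x else y) else 1) := by
    intro e
    rw [Finset.prod_mul_distrib, Finset.prod_ite_mem, Finset.univ_inter, faultProb]
  rw [Finset.sum_congr rfl fun e _ => h1 e, ← h]
  have h4 : ∀ f : ZMod 2 → ℝ, ∑ b, f b = f 0 + f 1 := fun f => Fin.sum_univ_two f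
  have h5 : ∀ v : Noisy d L, ∑ b : ZMod 2, ((if b = 1 then p else 1 - p) *
      if v ∈ Γ then (if b = 1 then x else y) else 1) =
      if v ∈ Γ then p * x + (1 - p) * y else 1 := by
    intro v
    rw [h4, if_neg zero_ne_one, if_neg zero_ne_one, if_pos rfl, if_pos rfl]
    split_ifs <;> ring
  rw [Finset.prod_congr rfl fun v _ => h5 v, Finset.prod_ite_mem, Finset.univ_inter,
    Finset.prod_const]

lemma one_le_prod_of_card_le {α : Type} (Γ : Finset α) (P : α → Prop) [DecidablePred P]
    (h : Γ.card ≤ 2 * (Γ.filter P).card) :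
    (1 : ℝ) ≤ ∏ v ∈ Γ, if P v then 10 else 1 / 10 := by
  rw [Finset.prod_ite, Finset.prod_const, Finset.prod_const]
  have h1 := Finset.card_filter_add_card_filter_not (s := Γ) P
  have h2 : (Γ.filter fun v => ¬ P v).card ≤ (Γ.filter P).card := by omega
  calc (1 : ℝ) = 10 ^ (Γ.filter P).card * (1 / 10) ^ (Γ.filter P).card := by
        rw [← mul_pow]; norm_num
    _ ≤ _ := by
        refine mul_le_mul_of_nonneg_left ?_ (by positivity)
        exact pow_le_pow_of_le_one (by norm_num) (by norm_num) h2

/-- Labels of the paths between the open boundaries: sublattice, start, and directions. -/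
def pathLabels (d L N : ℕ) : Finset (Bool × ℕ × ℕ × (_ : ℕ) × List (ℤ × ℤ × ℤ)) :=
  Finset.univ ×ˢ Finset.range (2 * d) ×ˢ Finset.range (2 * L + 1) ×ˢ
    (Finset.Ico d (N + 1)).sigma fun n => nonBacktracking n 0

lemma sum_pathLabels_le (d L N : ℕ) {x : ℝ} (h0 : 0 ≤ x) (h1 : 5 * x < 1) :
    ∑ τ ∈ pathLabels d L N, x ^ τ.2.2.2.1 ≤
      24 * d * (2 * L + 1) * ((5 * x) ^ d / (1 - 5 * x)) := by
  have hn : ∑ n ∈ Finset.Ico d (N + 1), ∑ _l ∈ nonBacktracking n 0, x ^ n ≤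
      6 * ((5 * x) ^ d / (1 - 5 * x)) := by
    refine le_trans ?_ (mul_le_mul_of_nonneg_left
      (geom_sum_Ico_le_of_lt_one (m := d) (n := N + 1) (by positivity) h1) (by norm_num))
    rw [Finset.mul_sum]
    refine Finset.sum_le_sum fun n _ => ?_
    rw [Finset.sum_const, nsmul_eq_mul, mul_pow, ← mul_assoc]
    refine mul_le_mul_of_nonneg_right ?_ (by positivity)
    exact_mod_cast card_nonBacktracking_zero n
  simp only [pathLabels, Finset.sum_product, Finset.sum_sigma]
  simp only [Finset.sum_const (M := ℝ) (s := Finset.univ), Finset.sum_const (M := ℝ)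
    (s := Finset.range _), nsmul_eq_mul, Finset.card_range, Finset.card_univ, Fintype.card_bool]
  push_cast
  have : (0 : ℝ) ≤ 2 * (2 * d * (2 * L + 1)) := by positivity
  nlinarith [mul_le_mul_of_nonneg_left hn this]

open Classical in
/-- Peierls-type bound on the probability that minimum-weight decoding fails. -/
lemma sum_not_corrects_le {D : Decoder d L} (hD : IsMinimumWeight D) (hd : 1 ≤ d) {p : ℝ}
    (h0 : 0 ≤ p) (h1 : p < 1 / 100) :
    ∑ e, (if Corrects D e then 0 else faultProb p e) ≤
      24 * d * (2 * L + 1) * ((50 * p + 1 / 2) ^ d / (1 - (50 * p + 1 / 2))) := by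
  set N := Fintype.card (Noisy d L) with hN
  set Γ : Bool × ℕ × ℕ × (_ : ℕ) × List (ℤ × ℤ × ℤ) → Finset (Noisy d L) := fun τ =>
    pathQubits τ.1 ((τ.2.1 : ℤ), -1, (τ.2.2.1 : ℤ)) τ.2.2.2.2 with hΓ
  set G : Bool × ℕ × ℕ × (_ : ℕ) × List (ℤ × ℤ × ℤ) → (Noisy d L → ZMod 2) → ℝ := fun τ e =>
    if (Γ τ).card = τ.2.2.2.1 then ∏ v ∈ Γ τ, (if e v = 1 then 10 else 1 / 10) else 0 with hG
  have hG0 : ∀ τ e, 0 ≤ G τ e := by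
    intro τ e
    simp only [hG]
    split_ifs
    · exact Finset.prod_nonneg fun v _ => by split_ifs <;> norm_num
    · exact le_rfl
  have hP := faultProb_nonneg (d := d) (L := L) h0 (by linarith : p ≤ 1)
  have hpt : ∀ e, (if Corrects D e then 0 else faultProb p e) ≤
      ∑ τ ∈ pathLabels d L N, faultProb p e * G τ e := by
    intro e
    split_ifs with he
    · exact Finset.sum_nonneg fun τ _ => mul_nonneg (hP e) (hG0 τ e)
    · obtain ⟨b, i₀, t₀, hi1, hi2, ht1, ht2, l, hl, hnb, hc, hw⟩ :=
        exists_path_of_not_corrects hD hd he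
      obtain ⟨i, rfl⟩ := Int.eq_ofNat_of_zero_le hi1
      obtain ⟨t, rfl⟩ := Int.eq_ofNat_of_zero_le (by omega : 0 ≤ t₀)
      have hlN : l.length ≤ N := hc ▸ Finset.card_le_univ _
      have hmem : (b, i, t, (⟨l.length, l⟩ : (_ : ℕ) × List (ℤ × ℤ × ℤ))) ∈ pathLabels d L N := by
        simp only [pathLabels, Finset.mem_product, Finset.mem_univ, Finset.mem_range,
          Finset.mem_sigma, Finset.mem_Ico, true_and]
        exact ⟨by omega, by omega, ⟨hl, by omega⟩, hnb⟩
      refine le_trans ?_ (Finset.single_le_sum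
        (f := fun τ => faultProb p e * G τ e) (fun τ _ => mul_nonneg (hP e) (hG0 τ e)) hmem)
      refine le_mul_of_one_le_right (hP e) ?_
      simp only [hG]
      rw [if_pos hc]
      refine one_le_prod_of_card_le _ _ ?_
      exact hc.trans_le hw
  calc _ ≤ ∑ e, ∑ τ ∈ pathLabels d L N, faultProb p e * G τ e := Finset.sum_le_sum fun e _ => hpt e
    _ = ∑ τ ∈ pathLabels d L N, ∑ e, faultProb p e * G τ e := Finset.sum_comm
    _ ≤ ∑ τ ∈ pathLabels d L N, (10 * p + 1 / 10) ^ τ.2.2.2.1 := by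
        refine Finset.sum_le_sum fun τ _ => ?_
        by_cases hc : (Γ τ).card = τ.2.2.2.1
        · simp only [hG, if_pos hc]
          rw [sum_faultProb_mul_prod, hc]
          exact pow_le_pow_left₀ (by nlinarith) (by nlinarith) _
        · simp only [hG, if_neg hc, mul_zero, Finset.sum_const_zero]
          positivity
    _ ≤ _ := by
        have := sum_pathLabels_le d L N (x := 10 * p + 1 / 10) (by linarith) (by linarith)
        rwa [show 5 * (10 * p + 1 / 10) = 50 * p + 1 / 2 by ring] at this

end Probability

/-! ### Thresholds -/

section Thresholds

open Filter Topology

lemma tendsto_failure_bound {L : ℕ → ℕ} (hL : ∃ C k : ℕ, ∀ d, L d ≤ C * (d + 1) ^ k) {q : ℝ}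
    (hq0 : 0 < q) (hq1 : q < 1) :
    Tendsto (fun d : ℕ => 24 * (d : ℝ) * (2 * (L d : ℝ) + 1) * (q ^ d / (1 - q))) atTop (𝓝 0) := by
  obtain ⟨C, k, hC⟩ := hL
  have h1 := tendsto_pow_const_mul_const_pow_of_abs_lt_one (k + 1) (r := q)
    (by rw [abs_of_pos hq0]; exact hq1)
  have h2 := ((tendsto_add_atTop_iff_nat 1).2 h1).const_mul (24 * (2 * C + 1) / (q * (1 - q)))
  rw [mul_zero] at h2
  have hq2 : 0 < 1 - q := by linarith
  refine squeeze_zero (fun d => by positivity) (fun d => ?_) h2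
  have h3 : (L d : ℝ) ≤ C * (d + 1) ^ k := by exact_mod_cast hC d
  have h4 : (1 : ℝ) ≤ (d + 1) ^ k := one_le_pow₀ (by linarith [(Nat.cast_nonneg d : (0 : ℝ) ≤ d)])
  have h5 : 24 * (d : ℝ) * (2 * (L d : ℝ) + 1) ≤ 24 * (2 * C + 1) * (d + 1) ^ (k + 1) := by
    have : (2 * (L d : ℝ) + 1) ≤ (2 * C + 1) * (d + 1) ^ k := by nlinarith
    calc 24 * (d : ℝ) * (2 * (L d : ℝ) + 1) ≤ 24 * (d + 1) * ((2 * C + 1) * (d + 1) ^ k) := by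
          gcongr
          linarith
      _ = _ := by ring
  calc _ ≤ 24 * (2 * C + 1) * ((d : ℝ) + 1) ^ (k + 1) * (q ^ d / (1 - q)) :=
        mul_le_mul_of_nonneg_right h5 (by positivity)
    _ = _ := by
        push_cast
        field_simp
        ring

lemma pauliNoiseCorrected_of_lt {L : ℕ → ℕ} (hL : ∃ C k : ℕ, ∀ d, L d ≤ C * (d + 1) ^ k)
    {D : ∀ d, Decoder d (L d)} (hD : ∀ d, IsMinimumWeight (D d)) {p : ℝ} (h0 : 0 ≤ p)
    (h1 : p < 1 / 100) : PauliNoiseCorrected L D p := by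
  intro ε hε
  have ht := tendsto_failure_bound hL (q := 50 * p + 1 / 2) (by linarith) (by linarith)
  filter_upwards [ht.eventually_le_const hε, eventually_ge_atTop 1] with d hd hd1 ψ hψ
  have h2 := fidelity_ge h0 (by linarith) (D d) hψ
  have h3 := sum_not_corrects_le (hD d) hd1 h0 h1
  linarith

lemma coherentNoiseCorrected_iff (L : ℕ → ℕ) (D : ∀ d, Decoder d (L d)) (θ : ℝ) :
    CoherentNoiseCorrected L D θ ↔ PauliNoiseCorrected L D (Real.sin (5 * θ) ^ 2) := by
  have h : ∀ d, (coherentInstrument θ : Syndrome d (L d) → Op (Data d) → Op (Data d)) =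
      pauliInstrument (Real.sin (5 * θ) ^ 2) := fun d => by
    funext s ρ
    exact coherentInstrument_eq_pauliInstrument θ s ρ
  simp only [CoherentNoiseCorrected, PauliNoiseCorrected, h]

lemma sSup_angle_eq (P : ℝ → Prop) :
    sSup {θ | θ ∈ Set.Icc 0 (Real.pi / 10) ∧ ∀ θ' ∈ Set.Ico 0 θ, P (Real.sin (5 * θ') ^ 2)} =
      Real.arcsin (√(sSup {p | p ∈ Set.Icc 0 1 ∧ ∀ p' ∈ Set.Ico 0 p, P p'})) / 5 := by
  set S := {p : ℝ | p ∈ Set.Icc 0 1 ∧ ∀ p' ∈ Set.Ico 0 p, P p'} with hS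
  have hne : S.Nonempty := ⟨0, by simp, by simp⟩
  have hbdd : BddAbove S := ⟨1, fun p hp => hp.1.2⟩
  set p₀ := sSup S with hp₀
  have hp0 : 0 ≤ p₀ := le_csSup hbdd ⟨by simp, by simp⟩
  have hp1 : p₀ ≤ 1 := csSup_le hne fun p hp => hp.1.2
  have hP : ∀ p' ∈ Set.Ico 0 p₀, P p' := by
    rintro p' ⟨h1, h2⟩
    obtain ⟨p, hp, hlt⟩ := exists_lt_of_lt_csSup hne h2
    exact hp.2 p' ⟨h1, hlt⟩
  have hs0 : 0 ≤ √p₀ := Real.sqrt_nonneg _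
  have hs1 : √p₀ ≤ 1 := Real.sqrt_le_one.2 hp1
  have ha0 := Real.arcsin_nonneg.2 hs0
  have ha1 := Real.arcsin_le_pi_div_two √p₀
  have hpi := Real.pi_pos
  refine IsGreatest.csSup_eq ⟨⟨⟨by positivity, by linarith⟩, ?_⟩, ?_⟩
  · rintro θ ⟨h1, h2⟩
    have h3 : Real.sin (5 * θ) < √p₀ :=
      (Real.lt_arcsin_iff_sin_lt ⟨by linarith, by linarith⟩ ⟨by linarith, hs1⟩).1 (by linarith)
    have h4 : 0 ≤ Real.sin (5 * θ) :=
      Real.sin_nonneg_of_nonneg_of_le_pi (by linarith) (by linarith)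
    exact hP _ ⟨sq_nonneg _, (Real.lt_sqrt h4).1 h3⟩
  · rintro θ ⟨⟨h1, h2⟩, h3⟩
    have h4 : 0 ≤ Real.sin (5 * θ) :=
      Real.sin_nonneg_of_nonneg_of_le_pi (by linarith) (by linarith)
    have h5 : Real.sin (5 * θ) ^ 2 ∈ S := by
      refine ⟨⟨sq_nonneg _, Real.sin_sq_le_one _⟩, ?_⟩
      rintro p' ⟨hp1', hp2'⟩
      have h6 : √p' < Real.sin (5 * θ) := (Real.sqrt_lt' (lt_of_le_of_ne h4 (by
        rintro h; rw [← h] at hp2'; norm_num at hp2'; linarith))).2 hp2'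
      have h7 : √p' ≤ 1 := h6.le.trans (Real.sin_le_one _)
      have h8 : Real.arcsin √p' < 5 * θ :=
        (Real.arcsin_lt_iff_lt_sin ⟨by linarith [Real.sqrt_nonneg p'], h7⟩
          ⟨by linarith, by linarith⟩).2 h6
      have h9 := h3 (Real.arcsin √p' / 5)
        ⟨div_nonneg (Real.arcsin_nonneg.2 (Real.sqrt_nonneg _)) (by norm_num), by linarith⟩
      rwa [mul_div_cancel₀ _ (by norm_num : (5 : ℝ) ≠ 0),
        Real.sin_arcsin (by linarith [Real.sqrt_nonneg p']) h7, Real.sq_sqrt hp1'] at h9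
    have h6 : Real.sin (5 * θ) ≤ √p₀ := Real.le_sqrt_of_sq_le (le_csSup hbdd h5)
    have h7 : 5 * θ ≤ Real.arcsin √p₀ :=
      (Real.le_arcsin_iff_sin_le ⟨by linarith, by linarith⟩ ⟨by linarith, hs1⟩).2 h6
    linarith

lemma θThreshold_eq (L : ℕ → ℕ) (D : ∀ d, Decoder d (L d)) :
    θThreshold L D = Real.arcsin (√(pThreshold L D)) / 5 := by
  simp only [θThreshold, coherentNoiseCorrected_iff]
  exact sSup_angle_eq (PauliNoiseCorrected L D)

lemma sin_sq_lt_of_abs_lt {θ : ℝ} (h : |θ| < Real.arcsin (1 / 10) / 5) :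
    Real.sin (5 * θ) ^ 2 < 1 / 100 := by
  have hpi := Real.arcsin_le_pi_div_two (1 / 10)
  have h1 : |5 * θ| < Real.arcsin (1 / 10) := by
    rw [abs_mul, abs_of_pos (by norm_num : (0 : ℝ) < 5)]; linarith
  obtain ⟨h2, h3⟩ := abs_lt.1 h1
  have h4 : Real.sin (5 * θ) < 1 / 10 :=
    (Real.lt_arcsin_iff_sin_lt ⟨by linarith, by linarith⟩ ⟨by norm_num, by norm_num⟩).1 h3
  have h5 : Real.sin (-(5 * θ)) < 1 / 10 :=
    (Real.lt_arcsin_iff_sin_lt ⟨by linarith, by linarith⟩ ⟨by norm_num, by norm_num⟩).1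
      (by linarith)
  rw [Real.sin_neg] at h5
  nlinarith

lemma abs_arcsin_sub_lt : |Real.arcsin (1 / 10) / 5 - 0.02| < 0.0001 := by
  have hpi := Real.pi_gt_three
  have h1 : (0.0995 : ℝ) < Real.arcsin (1 / 10) :=
    (Real.lt_arcsin_iff_sin_lt ⟨by linarith, by linarith⟩ ⟨by norm_num, by norm_num⟩).2
      ((Real.sin_lt (by norm_num)).trans (by norm_num))
  have h2 : Real.arcsin (1 / 10) < 0.1005 :=
    (Real.arcsin_lt_iff_lt_sin ⟨by norm_num, by norm_num⟩ ⟨by linarith, by linarith⟩).2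
      (lt_trans (by norm_num) (Real.sin_gt_sub_cube (x := 0.1005) (by norm_num)))
  rw [abs_lt]
  constructor <;> linarith

end Thresholds

end TeleportedSurfaceCode
end

open TeleportedSurfaceCode in
theorem mainTheorem6 :
    (∀ (d L : ℕ) (θ : ℝ) (s : Syndrome d L) (ρ : Op (Data d)), IsCodeOperator ρ →
      coherentInstrument θ s ρ = pauliInstrument (Real.sin (5 * θ) ^ 2) s ρ) ∧
    (∀ (d L : ℕ) (a : Cell d L), ((decodingGraph d L).neighborSet a).ncard ≤ 6) ∧
    (∀ (L : ℕ → ℕ), (∃ C k : ℕ, ∀ d, L d ≤ C * (d + 1) ^ k) →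
      ∀ D : ∀ d, Decoder d (L d), (∀ d, IsMinimumWeight (D d)) →
        1 / 100 ≤ pThreshold L D ∧
        θThreshold L D = Real.arcsin (√(pThreshold L D)) / 5 ∧
        Real.arcsin (1 / 10) / 5 ≤ θThreshold L D ∧
        ∀ θ : ℝ, |θ| < Real.arcsin (1 / 10) / 5 → CoherentNoiseCorrected L D θ) ∧
    |Real.arcsin (1 / 10) / 5 - 0.02| < 0.0001 := by
  refine ⟨fun d L θ s ρ _ => coherentInstrument_eq_pauliInstrument θ s ρ,
    fun d L a => ncard_neighborSet_le a, fun L hL D hD => ?_, abs_arcsin_sub_lt⟩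
  have hp : 1 / 100 ≤ pThreshold L D :=
    le_csSup ⟨1, fun p hp => hp.1.2⟩ ⟨⟨by norm_num, by norm_num⟩,
      fun p hp => pauliNoiseCorrected_of_lt hL hD hp.1 hp.2⟩
  refine ⟨hp, θThreshold_eq L D, ?_, fun θ hθ => ?_⟩
  · rw [θThreshold_eq]
    refine div_le_div_of_nonneg_right (Real.arcsin_le_arcsin ?_) (by norm_num)
    exact Real.le_sqrt_of_sq_le (le_trans (by norm_num) hp)
  · exact (coherentNoiseCorrected_iff L D θ).2
      (pauliNoiseCorrected_of_lt hL hD (sq_nonneg _) (sin_sq_lt_of_abs_lt hθ))
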